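/- Let $k\ge 1$ be fixed. An instance of balanced $k$-center clustering consists of $n$ points $p_1,\dots,p_n$ (repetitions allowed) of a metric space $(X,\mathrm{dist})$ and integers $L,U$ with $1\le L\le\lfloor n/k\rfloor\le\lceil n/k\rceil\le U\le n$. A solution consists of $k$ centers $c_1,\dots,c_k\in X$ and a partition of the points into $k$ clusters of sizes between $L$ and $U$; its radius is the largest distance of a point from the center of its cluster. A solution is an $\alpha$-approximation if its radius is at most $\alpha$ times the radius of every solution. Consider the following algorithm. 1. Select $S=\{s_1,\dots,s_k\}$ from the input points by Gonzalez's algorithm: $s_1$ is an arbitrary input point, and each further $s_j$ is an input point with the largest minimum distance to $s_1,\dots,s_{j-1}$. 2. Compute the $nk$ distances from the input points to $S$ and sort them into an increasing list $\mathcal R$. 3. For each $k$-tuple $(s'_1,\dots,s'_k)\in S^k$, find by binary search the smallest $r\in\mathcal R$ for which the following system is feasible, and record $r$, the tuple and a solution of the system if $r$ is at most the best value found so far. For $\emptyset\ne J\subseteq\{1,\dots,k\}$ let $n_J$ be the number of input points that lie in the balls of radius $r$ around the $s'_j$ with $j\in J$ and in no other of the $k$ balls of radius $r$ around $s'_1,\dots,s'_k$.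 If some input point lies in none of the $k$ balls, then $r$ is rejected. Otherwise the system, in unknowns $x_J^j\ge 0$ ($j\in J$), is $\sum_{j\in J}x_J^j=n_J$ for all $J$, and $L\le\sum_{J\ni j}x_J^j\le U$ for all $j$. 4. For the tuple with the smallest recorded $r$, transform the recorded solution of the system into an integer solution, by shifting fractional values along cycles and paths. Return the tuple as the centers, together with a partition that puts $x_J^j$ of the points counted by $n_J$ into cluster $j$. The running time is the number of steps on a machine with unit-cost list operations, rational arithmetic (including rounding down) and comparisons of distances, on which a distance of two input points is acquired by one oracle call. Then for every instance, and every choice of the initial point $s_1$, the algorithm returns a $4$-approximation for balanced $k$-center clustering. Moreover, if acquiring the distance between any two input points takes $O(D)$ steps, where $D\ge 1$, then the running time is $O(n(\log n+D))$, where the constant depends only on $k$ and on the constant in the assumption $O(D)$. -/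

import Mathlib

/-! ### The problem -/

/-- A solution of balanced `k`-center clustering for the `n` points `P` of a metric space `X`,
with lower and upper bounds `L`, `U` on the cluster sizes: `k` centers anywhere in `X`, and an
assignment of the points to the `k` clusters such that every cluster has between `L` and `U`
points. -/
structure BalancedClustering {X : Type*} {n : ℕ} (_P : Fin n → X) (k L U : ℕ) where
  center : Fin k → X
  assign : Fin n → Fin k
  lower : ∀ j, L ≤ (Finset.univ.filter (fun i => assign i = j)).card
  upper : ∀ j, (Finset.univ.filter (fun i => assign i = j)).card ≤ U

/-- The `k` balls of radius `r` around the centers cover the respective clusters. -/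
def BalancedClustering.CoveredBy {X : Type*} [MetricSpace X] {n : ℕ} {P : Fin n → X}
    {k L U : ℕ} (s : BalancedClustering P k L U) (r : ℝ) : Prop :=
  ∀ i, dist (P i) (s.center (s.assign i)) ≤ r

/-- A solution is an `α`-approximation if whenever some solution has radius at most `r`, this
one has radius at most `α * r`. (So its radius is at most `α` times the infimum of the radii.) -/
def BalancedClustering.IsApprox {X : Type*} [MetricSpace X] {n : ℕ} {P : Fin n → X}
    {k L U : ℕ} (s : BalancedClustering P k L U) (α : ℝ) : Prop :=
  ∀ (t : BalancedClustering P k L U) (r : ℝ), t.CoveredBy r → s.CoveredBy (α * r)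

namespace Prog

/-! ### The machine model

A first-order programming language with an explicit step count. Data are Booleans, numbers,
pairs, linked lists, references to input points, and distances. Input points can only be
compared through a distance oracle, distances can only be compared with each other. Numbers are
rationals with unit-cost arithmetic, as in the real RAM. Control flow consists of `let`,
conditionals, folds over lists and loops with a bounded number of rounds.

Programs are terms in parametric higher-order syntax: a program is a term that is polymorphic in
the type family `V` of variables, so it is one fixed text that cannot depend on the input. -/

/-- The data types of the language. -/
inductive Ty : Type
  | bool | num | dst | pt
  | prod (a b : Ty)
  | list (a : Ty)

/-- The values of each data type, where `ι` is the type of references to input points, and `K`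
is the type of distances. -/
@[reducible] def Ty.Val (ι K : Type) : Ty → Type
  | .bool => Bool
  | .num => ℚ
  | .dst => K
  | .pt => ι
  | .prod a b => Ty.Val ι K a × Ty.Val ι K b
  | .list a => List (Ty.Val ι K a)

/-- Terms (programs) with variables from `V`. -/
inductive Tm (V : Ty → Type) : Ty → Type
  | var {a : Ty} (x : V a) : Tm V a
  | letV {a b : Ty} (t : Tm V a) (f : V a → Tm V b) : Tm V b
  | boolLit (b : Bool) : Tm V .bool
  | ite {a : Ty} (c : Tm V .bool) (t e : Tm V a) : Tm V a
  | lit (q : ℚ) : Tm V .num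
  | add (s t : Tm V .num) : Tm V .num
  | sub (s t : Tm V .num) : Tm V .num
  | mul (s t : Tm V .num) : Tm V .num
  | div (s t : Tm V .num) : Tm V .num
  | floor (t : Tm V .num) : Tm V .num
  | le (s t : Tm V .num) : Tm V .bool
  | eq (s t : Tm V .num) : Tm V .bool
  | dist (p q : Tm V .pt) : Tm V .dst
  | leD (s t : Tm V .dst) : Tm V .bool
  | pair {a b : Ty} (s : Tm V a) (t : Tm V b) : Tm V (.prod a b)
  | fst {a b : Ty} (t : Tm V (.prod a b)) : Tm V a
  | snd {a b : Ty} (t : Tm V (.prod a b)) : Tm V b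
  | nil {a : Ty} : Tm V (.list a)
  | cons {a : Ty} (s : Tm V a) (t : Tm V (.list a)) : Tm V (.list a)
  | casesV {a b : Ty} (l : Tm V (.list a)) (e : Tm V b) (f : V a → V (.list a) → Tm V b) : Tm V b
  | foldlV {a b : Ty} (l : Tm V (.list a)) (s : Tm V b) (f : V b → V a → Tm V b) : Tm V b
  | foldrV {a b : Ty} (l : Tm V (.list a)) (s : Tm V b) (f : V a → V b → Tm V b) : Tm V b
  | loopV {b : Ty} (m : Tm V .num) (s : Tm V b) (c : V b → Tm V .bool) (f : V b → Tm V b) : Tm V b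

/-- The state after at most `m` rounds of `while c do f`, started at the given state. -/
def loopVal {β : Type} (c : β → Bool) (f : β → β) : ℕ → β → β
  | 0, s => s
  | m + 1, s => if c s then loopVal c f m (f s) else s

/-- The steps of at most `m` rounds of `while c do f`, where evaluating the condition and the
body at state `s` takes `tc s` and `tf s` steps. -/
def loopCost {β : Type} (c : β → Bool) (f : β → β) (tc tf : β → ℕ) : ℕ → β → ℕ
  | 0, _ => 1
  | m + 1, s => 1 + tc s + if c s then tf s + loopCost c f tc tf m (f s) else 0

/-- The steps of a left fold whose body takes `t s x` steps at state `s` and list entry `x`. -/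
def foldlCost {α β : Type} (f : β → α → β) (t : β → α → ℕ) : β → List α → ℕ
  | _, [] => 1
  | s, x :: l => 1 + t s x + foldlCost f t (f s x) l

/-- The steps of a right fold whose body takes `t x s` steps at list entry `x` and state `s`. -/
def foldrCost {α β : Type} (f : α → β → β) (t : α → β → ℕ) (s : β) : List α → ℕ
  | [] => 1
  | x :: l => 1 + t x (l.foldr f s) + foldrCost f t s l

section Semantics

variable {ι K : Type} [LinearOrder K]

/-- The value of a term, with distance oracle `d`. -/
def Tm.val (d : ι → ι → K) : {a : Ty} → Tm (Ty.Val ι K) a → Ty.Val ι K a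
  | _, .var x => x
  | _, .letV t f => Tm.val d (f (Tm.val d t))
  | _, .boolLit b => b
  | _, .ite c t e => if Tm.val d c = true then Tm.val d t else Tm.val d e
  | _, .lit q => q
  | _, .add s t => (Tm.val d s + Tm.val d t : ℚ)
  | _, .sub s t => (Tm.val d s - Tm.val d t : ℚ)
  | _, .mul s t => (Tm.val d s * Tm.val d t : ℚ)
  | _, .div s t => (Tm.val d s / Tm.val d t : ℚ)
  | _, .floor t => ((⌊(Tm.val d t : ℚ)⌋ : ℤ) : ℚ)
  | _, .le s t => decide ((Tm.val d s : ℚ) ≤ (Tm.val d t : ℚ))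
  | _, .eq s t => decide ((Tm.val d s : ℚ) = (Tm.val d t : ℚ))
  | _, .dist p q => d (Tm.val d p) (Tm.val d q)
  | _, .leD s t => decide ((Tm.val d s : K) ≤ (Tm.val d t : K))
  | _, .pair s t => (Tm.val d s, Tm.val d t)
  | _, .fst t => (Tm.val d t).1
  | _, .snd t => (Tm.val d t).2
  | _, .nil => []
  | _, .cons s t => Tm.val d s :: Tm.val d t
  | _, .casesV l e f =>
      match Tm.val d l with
      | [] => Tm.val d e
      | x :: l' => Tm.val d (f x l')
  | _, .foldlV l s f => (Tm.val d l).foldl (fun y x => Tm.val d (f y x)) (Tm.val d s)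
  | _, .foldrV l s f => (Tm.val d l).foldr (fun x y => Tm.val d (f x y)) (Tm.val d s)
  | _, .loopV m s c f =>
      loopVal (fun y => Tm.val d (c y)) (fun y => Tm.val d (f y)) ⌊(Tm.val d m : ℚ)⌋₊ (Tm.val d s)

/-- The number of steps taken by the evaluation of a term: one step for every operation that is
executed, and in addition `τ p q` steps for an evaluation of the distance of `p` and `q`. -/
def Tm.cost (d : ι → ι → K) (τ : ι → ι → ℕ) : {a : Ty} → Tm (Ty.Val ι K) a → ℕ
  | _, .var _ => 1
  | _, .letV t f => 1 + Tm.cost d τ t + Tm.cost d τ (f (t.val d))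
  | _, .boolLit _ => 1
  | _, .ite c t e => 1 + Tm.cost d τ c + if c.val d = true then Tm.cost d τ t else Tm.cost d τ e
  | _, .lit _ => 1
  | _, .add s t => 1 + Tm.cost d τ s + Tm.cost d τ t
  | _, .sub s t => 1 + Tm.cost d τ s + Tm.cost d τ t
  | _, .mul s t => 1 + Tm.cost d τ s + Tm.cost d τ t
  | _, .div s t => 1 + Tm.cost d τ s + Tm.cost d τ t
  | _, .floor t => 1 + Tm.cost d τ t
  | _, .le s t => 1 + Tm.cost d τ s + Tm.cost d τ t
  | _, .eq s t => 1 + Tm.cost d τ s + Tm.cost d τ t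
  | _, .dist p q => 1 + τ (p.val d) (q.val d) + Tm.cost d τ p + Tm.cost d τ q
  | _, .leD s t => 1 + Tm.cost d τ s + Tm.cost d τ t
  | _, .pair s t => 1 + Tm.cost d τ s + Tm.cost d τ t
  | _, .fst t => 1 + Tm.cost d τ t
  | _, .snd t => 1 + Tm.cost d τ t
  | _, .nil => 1
  | _, .cons s t => 1 + Tm.cost d τ s + Tm.cost d τ t
  | _, .casesV l e f => 1 + Tm.cost d τ l +
      match l.val d with
      | [] => Tm.cost d τ e
      | x :: l' => Tm.cost d τ (f x l')
  | _, .foldlV l s f => Tm.cost d τ l + Tm.cost d τ s +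
      foldlCost (fun y x => (f y x).val d) (fun y x => Tm.cost d τ (f y x)) (s.val d) (l.val d)
  | _, .foldrV l s f => Tm.cost d τ l + Tm.cost d τ s +
      foldrCost (fun x y => (f x y).val d) (fun x y => Tm.cost d τ (f x y)) (s.val d) (l.val d)
  | _, .loopV m s c f => Tm.cost d τ m + Tm.cost d τ s +
      loopCost (fun y => (c y).val d) (fun y => (f y).val d) (fun y => Tm.cost d τ (c y))
        (fun y => Tm.cost d τ (f y)) ⌊(m.val d : ℚ)⌋₊ (s.val d)

end Semantics

/-! ### Program text for the usual list routines

Everything below is program text: Lean functions between terms only serve as abbreviations. -/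

section Library

variable {V : Ty → Type} {a b c : Ty}

instance : Add (Tm V .num) := ⟨.add⟩
instance : Sub (Tm V .num) := ⟨.sub⟩
instance : Mul (Tm V .num) := ⟨.mul⟩
instance : Div (Tm V .num) := ⟨.div⟩

/-- `let x := t; f x`. The argument is evaluated once. -/
def bind' (t : Tm V a) (f : Tm V a → Tm V b) : Tm V b := .letV t fun x => f (.var x)

def cases' (l : Tm V (.list a)) (e : Tm V b) (f : Tm V a → Tm V (.list a) → Tm V b) : Tm V b :=
  .casesV l e fun x t => f (.var x) (.var t)

def foldl' (l : Tm V (.list a)) (s : Tm V b) (f : Tm V b → Tm V a → Tm V b) : Tm V b :=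
  .foldlV l s fun y x => f (.var y) (.var x)

def foldr' (l : Tm V (.list a)) (s : Tm V b) (f : Tm V a → Tm V b → Tm V b) : Tm V b :=
  .foldrV l s fun x y => f (.var x) (.var y)

/-- `repeat at most m times: while c do f`. -/
def while' (m : Tm V .num) (s : Tm V b) (c : Tm V b → Tm V .bool) (f : Tm V b → Tm V b) : Tm V b :=
  .loopV m s (fun y => c (.var y)) fun y => f (.var y)

/-- `repeat m times: f`. -/
def repeat' (m : Tm V .num) (s : Tm V b) (f : Tm V b → Tm V b) : Tm V b :=
  while' m s (fun _ => .boolLit true) f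

def not' (s : Tm V .bool) : Tm V .bool := .ite s (.boolLit false) (.boolLit true)
def and' (s t : Tm V .bool) : Tm V .bool := .ite s t (.boolLit false)
def or' (s t : Tm V .bool) : Tm V .bool := .ite s (.boolLit true) t

/-- The first entry of a list (`e` if there is none). -/
def head (e : Tm V a) (l : Tm V (.list a)) : Tm V a := cases' l e fun x _ => x

def tail (l : Tm V (.list a)) : Tm V (.list a) := cases' l .nil fun _ t => t

def isNil (l : Tm V (.list a)) : Tm V .bool := cases' l (.boolLit true) fun _ _ => .boolLit false

/-- The entry at position `i` (counted from `0`) of a list (`e` if there is none). -/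
def nth (e : Tm V a) (l : Tm V (.list a)) (i : Tm V .num) : Tm V a := head e (repeat' i l tail)

def length (l : Tm V (.list a)) : Tm V .num := foldl' l (.lit 0) fun s _ => s + .lit 1

def append (l l' : Tm V (.list a)) : Tm V (.list a) := foldr' l l' .cons

/-- The entries of `l` in reverse order, followed by `l'`. -/
def revAppend (l l' : Tm V (.list a)) : Tm V (.list a) := foldl' l l' fun s x => .cons x s

def map (l : Tm V (.list a)) (f : Tm V a → Tm V b) : Tm V (.list b) :=
  foldr' l .nil fun x s => .cons (f x) s

def flatMap (l : Tm V (.list a)) (f : Tm V a → Tm V (.list b)) : Tm V (.list b) :=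
  foldr' l .nil fun x s => append (f x) s

def filter (l : Tm V (.list a)) (p : Tm V a → Tm V .bool) : Tm V (.list a) :=
  foldr' l .nil fun x s => .ite (p x) (.cons x s) s

def any (l : Tm V (.list a)) (p : Tm V a → Tm V .bool) : Tm V .bool :=
  foldl' l (.boolLit false) fun s x => or' s (p x)

def all (l : Tm V (.list a)) (p : Tm V a → Tm V .bool) : Tm V .bool :=
  foldl' l (.boolLit true) fun s x => and' s (p x)

/-- The number of entries that satisfy `p`. -/
def count (l : Tm V (.list a)) (p : Tm V a → Tm V .bool) : Tm V .num :=
  foldl' l (.lit 0) fun s x => .ite (p x) (s + .lit 1) s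

/-- The entries before the first one that satisfies `p`. -/
def before (l : Tm V (.list a)) (p : Tm V a → Tm V .bool) : Tm V (.list a) :=
  foldr' l .nil fun x s => .ite (p x) .nil (.cons x s)

/-- The entries up to and including the first one that satisfies `p`. -/
def upTo (l : Tm V (.list a)) (p : Tm V a → Tm V .bool) : Tm V (.list a) :=
  foldr' l .nil fun x s => .ite (p x) (.cons x .nil) (.cons x s)

/-- `f x₀ y₀, f x₁ y₁, …` for two lists of the same length. -/
def zipWith (l : Tm V (.list a)) (l' : Tm V (.list b)) (f : Tm V a → Tm V b → Tm V c) :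
    Tm V (.list c) :=
  revAppend (.snd (foldl' l (.pair l' .nil) fun s x =>
    cases' (.fst s) s fun y t => .pair t (.cons (f x y) (.snd s)))) .nil

/-- The list `0, 1, …, m - 1`. -/
def range (m : Tm V .num) : Tm V (.list .num) :=
  bind' m fun m =>
  .snd (repeat' m (.pair m .nil) fun s =>
    bind' (.fst s - .lit 1) fun i => .pair i (.cons i (.snd s)))

/-- The merge of two increasing lists of distances. -/
def merge (l l' : Tm V (.list .dst)) : Tm V (.list .dst) :=
  bind' l fun l => bind' l' fun l' =>
  bind' (while' (length l + length l') (.pair l (.pair l' .nil))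
    (fun s => not' (or' (isNil (.fst s)) (isNil (.fst (.snd s)))))
    (fun s => cases' (.fst s) s fun x t => cases' (.fst (.snd s)) s fun y t' =>
      .ite (.leD x y)
        (.pair t (.pair (.fst (.snd s)) (.cons x (.snd (.snd s)))))
        (.pair (.fst s) (.pair t' (.cons y (.snd (.snd s))))))) fun s =>
  revAppend (.snd (.snd s)) (append (.fst s) (.fst (.snd s)))

/-- Merge the first list with the second, the third with the fourth, and so on. -/
def mergePass (ls : Tm V (.list (.list .dst))) : Tm V (.list (.list .dst)) :=
  bind' (foldl' ls (.pair .nil .nil) fun s l =>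
    cases' (.fst s) (.pair (.cons l .nil) (.snd s)) fun p _ =>
      .pair .nil (.cons (merge p l) (.snd s))) fun s =>
  append (.fst s) (.snd s)

/-- Merge sort: the entries of a list of distances in increasing order. -/
def sort (l : Tm V (.list .dst)) : Tm V (.list .dst) :=
  bind' l fun l =>
  head .nil (while' (length l) (map l fun x => .cons x .nil)
    (fun ls => not' (isNil (tail ls))) mergePass)

end Library

/-! ### Systems of linear inequalities -/

section LinearSystems

variable {V : Ty → Type}

/-- The inequality `∑ i, u i * x i ≤ v`, given as the pair of `u` and `v`. -/
abbrev Ineq : Ty := .prod (.list .num) .num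

/-- `∑ i, u i * y i`. -/
def dot (u y : Tm V (.list .num)) : Tm V .num :=
  foldl' (zipWith u y fun s t => s * t) (.lit 0) fun s t => s + t

/-- The inequality `e` without its leading coefficient, divided by `q`. -/
def scaleTail (e : Tm V Ineq) (q : Tm V .num) : Tm V Ineq :=
  bind' q fun q => .pair (map (tail (.fst e)) fun s => s / q) (.snd e / q)

def leading (e : Tm V Ineq) : Tm V .num := head (.lit 0) (.fst e)

/-- The upper bounds that a system imposes on its first variable `x`:
an entry `(u, v)` stands for `x + ∑ i, u i * y i ≤ v`. -/
def upperBounds (sys : Tm V (.list Ineq)) : Tm V (.list Ineq) :=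
  map (filter sys fun e => not' (.le (leading e) (.lit 0))) fun e => scaleTail e (leading e)

/-- The lower bounds that a system imposes on its first variable `x`:
an entry `(u, v)` stands for `- x + ∑ i, u i * y i ≤ v`. -/
def lowerBounds (sys : Tm V (.list Ineq)) : Tm V (.list Ineq) :=
  map (filter sys fun e => not' (.le (.lit 0) (leading e))) fun e =>
    scaleTail e (.lit 0 - leading e)

/-- The inequalities of a system in which its first variable does not occur. -/
def unbounded (sys : Tm V (.list Ineq)) : Tm V (.list Ineq) :=
  map (filter sys fun e => .eq (leading e) (.lit 0)) fun e => .pair (tail (.fst e)) (.snd e)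

/-- Decides whether a system of linear inequalities in `m` variables is feasible, and computes
a solution if it is. The variables are eliminated one after the other (Gaussian elimination for
inequalities, that is, Fourier-Motzkin elimination), and then the solution is found by back
substitution. The system must contain the inequality `- x ≤ 0` for every variable `x`. -/
def solve (m : Tm V .num) (sys : Tm V (.list Ineq)) : Tm V (.prod .bool (.list .num)) :=
  bind' (repeat' m (.pair sys .nil) fun s =>
    bind' (upperBounds (.fst s)) fun up =>
    bind' (lowerBounds (.fst s)) fun low =>
    .pair
      (append (unbounded (.fst s)) (flatMap up fun e => map low fun e' =>
        .pair (zipWith (.fst e) (.fst e') fun s t => s + t) (.snd e + .snd e')))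
      (.cons low (.snd s))) fun s =>
  .pair (all (.fst s) fun e => .le (.lit 0) (.snd e))
    (foldl' (.snd s) .nil fun y low =>
      .cons (foldl' low (.lit 0) fun x e =>
        bind' (dot (.fst e) y - .snd e) fun z => .ite (.le z x) x z) y)

end LinearSystems

/-! ### The algorithm -/

section Algorithm

variable {V : Ty → Type}

/-- Gonzalez's algorithm: starting with `s₁`, repeatedly selects a point that has the largest
minimum distance to the points selected before, until `k` points are selected. The second
component of the state holds the points with their distances to the set of selected points. -/
def gonzalez (ps : Tm V (.list .pt)) (s₁ : Tm V .pt) (k : Tm V .num) : Tm V (.list .pt) :=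
  .fst (repeat' (k - .lit 1)
    (.pair (.cons s₁ .nil) (map ps fun p => .pair p (.dist p s₁))) fun s =>
      bind' (.fst (foldl' (.snd s) (.pair s₁ (.dist s₁ s₁)) fun best e =>
        .ite (.leD (.snd e) (.snd best)) best e)) fun q =>
      .pair (append (.fst s) (.cons q .nil))
        (map (.snd s) fun e => bind' (.dist (.fst e) q) fun x =>
          .pair (.fst e) (.ite (.leD x (.snd e)) x (.snd e))))

/-- All `k`-tuples of positions `0, …, k - 1`. -/
def tuples (k : Tm V .num) : Tm V (.list (.list .num)) :=
  bind' k fun k => bind' (range k) fun js =>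
  repeat' k (.cons .nil .nil) fun ts => flatMap ts fun t => map js fun j => .cons j t

/-- The regions cut out by `k` balls: all subsets `J` of `0, …, k - 1`, each given as the pair of
its code `∑ j ∈ J, 2 ^ j` and the list of its members. A point belongs to the region `J` if it
is contained in the balls `j ∈ J` and in no other. -/
def regions (k : Tm V .num) : Tm V (.list (.prod .num (.list .num))) :=
  .snd (foldl' (range k) (.pair (.lit 1) (.cons (.pair (.lit 0) .nil) .nil)) fun s j =>
    .pair (.lit 2 * .fst s) (append (.snd s)
      (map (.snd s) fun e => .pair (.fst e + .fst s) (.cons j (.snd e)))))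

/-- The region codes of all points for the `k` balls of radius `r` around the `k`-tuple `t`.
The table `T` holds, for every point, the list of its distances to the selected points. -/
def codes (T : Tm V (.list (.list .dst))) (t : Tm V (.list .num)) (r : Tm V .dst) :
    Tm V (.list .num) :=
  map T fun row => .snd (foldl' t (.pair (.lit 1) (.lit 0)) fun s i =>
    .pair (.lit 2 * .fst s)
      (.ite (.leD (nth r row i) r) (.snd s + .fst s) (.snd s)))

/-- The variables of the system: the pairs `(J, j)` of a region and one of its balls, `j ∈ J`. -/
def sysVars (regs : Tm V (.list (.prod .num (.list .num)))) : Tm V (.list (.prod .num .num)) :=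
  flatMap regs fun e => map (.snd e) fun j => .pair (.fst e) j

/-- The inequality `∑ (x v, v with p v) ≤ q`. -/
def sumLe (vs : Tm V (.list (.prod .num .num))) (p : Tm V (.prod .num .num) → Tm V .bool)
    (q : Tm V .num) : Tm V Ineq :=
  .pair (map vs fun v => .ite (p v) (.lit 1) (.lit 0)) q

/-- The inequality `q ≤ ∑ (x v, v with p v)`. -/
def leSum (vs : Tm V (.list (.prod .num .num))) (p : Tm V (.prod .num .num) → Tm V .bool)
    (q : Tm V .num) : Tm V Ineq :=
  .pair (map vs fun v => .ite (p v) (.lit (-1)) (.lit 0)) (.lit 0 - q)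

/-- The system of linear equations and inequalities for the region codes `cs` of the points:
the variables of a region add up to the number of points of the region, the variables of a
cluster add up to a number between `L` and `U`, and the variables are non-negative.
(The region outside all balls has no variables, so that it must not contain a point.) -/
def system (k L U : Tm V .num) (regs : Tm V (.list (.prod .num (.list .num))))
    (vs : Tm V (.list (.prod .num .num))) (cs : Tm V (.list .num)) : Tm V (.list Ineq) :=
  append
    (flatMap regs fun e => bind' (count cs fun x => .eq x (.fst e)) fun q =>
      .cons (sumLe vs (fun v => .eq (.fst v) (.fst e)) q)
        (.cons (leSum vs (fun v => .eq (.fst v) (.fst e)) q) .nil))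
    (append
      (flatMap (range k) fun j =>
        .cons (sumLe vs (fun v => .eq (.snd v) j) U)
          (.cons (leSum vs (fun v => .eq (.snd v) j) L) .nil))
      (map vs fun w =>
        leSum vs (fun v => and' (.eq (.fst v) (.fst w)) (.eq (.snd v) (.snd w))) (.lit 0)))

/-- A value of one variable: the region, the ball, and the value. -/
abbrev Entry : Ty := .prod .num (.prod .num .num)

def isFractional (e : Tm V Entry) : Tm V .bool :=
  not' (.eq (.snd (.snd e)) (.floor (.snd (.snd e))))

/-- A couple `(J, (v, w))` of two variables `(J, v)`, `(J, w)` of the same region `J`: an edge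
of color `J` from `v` to `w` in the multigraph on the balls. -/
abbrev Couple : Ty := .prod .num (.prod .num .num)

/-- Finds a cycle in which consecutive edges have different colors, or else a path of this kind
between two balls that have just one fractional variable each. Here `fs` is the list of the
fractional variables. The walk starts at a ball with just one fractional variable, if there is
one. The state consists of a flag telling whether the search has ended, the couples found so
far (latest first), the current ball, and the region through which it was reached. -/
def findCouples (k : Tm V .num) (fs : Tm V (.list (.prod .num .num))) : Tm V (.list Couple) :=
  bind' (.snd (head (head (.pair (.lit 0) (.lit 0)) fs)
    (filter fs fun f => .eq (count fs fun g => .eq (.snd g) (.snd f)) (.lit 1)))) fun start =>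
  .fst (.snd (while' (k + .lit 1)
    (.pair (.boolLit false) (.pair .nil (.pair start (.lit (-1)))))
    (fun s => not' (.fst s))
    (fun s =>
      bind' (.fst (.snd s)) fun path =>
      bind' (.fst (.snd (.snd s))) fun v =>
      bind' (.snd (.snd (.snd s))) fun J₀ =>
      cases' (filter fs fun f => and' (.eq (.snd f) v) (not' (.eq (.fst f) J₀)))
        -- no edge leads on: the walk ends
        (.pair (.boolLit true) (.snd s))
        fun f _ => bind' (.fst f) fun J =>
        cases' (filter path fun e => .eq (.fst e) J)
          (bind' (.snd (head f (filter fs fun g =>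
              and' (.eq (.fst g) J) (not' (.eq (.snd g) v))))) fun w =>
            .ite (any path fun e => .eq (.fst (.snd e)) w)
              -- back at the ball `w`: a cycle is closed
              (.pair (.boolLit true) (.pair (.cons (.pair J (.pair v w))
                (upTo path fun e => .eq (.fst (.snd e)) w)) (.pair w J)))
              -- the walk goes on to the ball `w`
              (.pair (.boolLit false)
                (.pair (.cons (.pair J (.pair v w)) path) (.pair w J))))
          -- back at the region `J`: a cycle is closed through the end of the earlier edge
          fun e _ => .pair (.boolLit true) (.pair
            (.cons (.pair J (.pair v (.snd (.snd e)))) (before path fun e => .eq (.fst e) J))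
            (.pair v J)))))

/-- The given variable is decreased. -/
def isFirst (path : Tm V (.list Couple)) (e : Tm V Entry) : Tm V .bool :=
  any path fun q => and' (.eq (.fst q) (.fst e)) (.eq (.fst (.snd q)) (.fst (.snd e)))

/-- The given variable is increased. -/
def isSecond (path : Tm V (.list Couple)) (e : Tm V Entry) : Tm V .bool :=
  any path fun q => and' (.eq (.fst q) (.fst e)) (.eq (.snd (.snd q)) (.fst (.snd e)))

/-- Transforms a solution of the system into an integer solution: as long as there is a fractional
variable, the fractional values are shifted along a cycle or path, by the largest amount `δ`
such that no value passes an integer. -/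
def round (k : Tm V .num) (es : Tm V (.list Entry)) : Tm V (.list Entry) :=
  bind' es fun es =>
  while' (length es) es (fun es => any es isFractional) fun es =>
    bind' (findCouples k (map (filter es isFractional) fun e =>
      .pair (.fst e) (.fst (.snd e)))) fun path =>
    bind' (foldl' es (.lit 1) fun δ e =>
      bind' (.snd (.snd e)) fun x =>
      bind' (.ite (isFirst path e) (x - .floor x)
        (.ite (isSecond path e) (.floor x + .lit 1 - x) δ)) fun y =>
      .ite (.le y δ) y δ) fun δ =>
    map es fun e => .pair (.fst e) (.pair (.fst (.snd e))
      (.ite (isFirst path e) (.snd (.snd e) - δ)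
        (.ite (isSecond path e) (.snd (.snd e) + δ) (.snd (.snd e)))))

/-- Assigns the points with region codes `cs` to the clusters `0, …, k - 1`, such that the number
of points from region `J` in cluster `j` is the (integer) value of the variable `(J, j)`. -/
def labels (cs : Tm V (.list .num)) (es : Tm V (.list Entry)) : Tm V (.list .num) :=
  .snd (foldr' cs (.pair es .nil) fun x s =>
    bind' (foldr' (.fst s) (.pair (.boolLit false) (.pair (.lit 0) .nil)) fun e u =>
      .ite (and' (not' (.fst u)) (and' (.eq (.fst e) x) (.le (.lit 1) (.snd (.snd e)))))
        (.pair (.boolLit true) (.pair (.fst (.snd e))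
          (.cons (.pair (.fst e) (.pair (.fst (.snd e)) (.snd (.snd e) - .lit 1)))
            (.snd (.snd u)))))
        (.pair (.fst u) (.pair (.fst (.snd u)) (.cons e (.snd (.snd u)))))) fun u =>
    .pair (.snd (.snd u)) (.cons (.fst (.snd u)) (.snd s)))

/-- A radius, a `k`-tuple of positions in the list of selected points, and a solution of the
corresponding system. -/
abbrev Record : Ty := .prod .dst (.prod (.list .num) (.list .num))

/-- The binary search for the smallest radius `r` in the increasing list `R` for which the system
of the `k`-tuple `t` is feasible. The search is between the positions `lo` (inclusive) and
`hi` (exclusive) of `R`. Feasible solutions are recorded if `r` is at most the best radius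
known so far. -/
def search (k L U : Tm V .num) (regs : Tm V (.list (.prod .num (.list .num))))
    (vs : Tm V (.list (.prod .num .num))) (T : Tm V (.list (.list .dst)))
    (R : Tm V (.list .dst)) (best : Tm V Record) (t : Tm V (.list .num)) : Tm V Record :=
  bind' (length R) fun m =>
  .snd (while' m (.pair (.pair (.lit 0) m) best)
    (fun s => not' (.le (.snd (.fst s)) (.fst (.fst s))))
    (fun s =>
      bind' (.floor ((.fst (.fst s) + .snd (.fst s)) / .lit 2)) fun mid =>
      bind' (nth (.fst (.snd s)) R mid) fun r =>
      bind' (codes T t r) fun cs =>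
      bind' (solve (length vs) (system k L U regs vs cs)) fun x =>
      .ite (.fst x)
        (.pair (.pair (.fst (.fst s)) mid)
          (.ite (.leD r (.fst (.snd s))) (.pair r (.pair t (.snd x))) (.snd s)))
        (.pair (.pair (mid + .lit 1) (.snd (.fst s))) (.snd s))))

/-- The 4-approximation algorithm for balanced `k`-center clustering. The input consists of the
list `ps` of the points, the initial point `s₁` for Gonzalez's algorithm, and the numbers
`k`, `L`, `U`. The output consists of the list of the `k` cluster centers, and of the list of
the clusters (`0, …, k - 1`) to which the points are assigned. -/
def algorithm (ps : Tm V (.list .pt)) (s₁ : Tm V .pt) (k L U : Tm V .num) :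
    Tm V (.prod (.list .pt) (.list .num)) :=
  -- step 1
  bind' (gonzalez ps s₁ k) fun S =>
  -- step 2
  bind' (map ps fun p => map S fun s => .dist p s) fun T =>
  bind' (sort (flatMap T fun row => row)) fun R =>
  bind' (foldl' R (.dist s₁ s₁) fun _ r => r) fun rMax =>
  -- step 3
  bind' (regions k) fun regs =>
  bind' (sysVars regs) fun vs =>
  bind' (foldl' (tuples k) (.pair rMax (.pair .nil .nil)) fun best t =>
    search k L U regs vs T R best t) fun best =>
  -- step 4
  bind' (.fst (.snd best)) fun t =>
  bind' (round k (zipWith vs (.snd (.snd best)) fun v x =>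
    .pair (.fst v) (.pair (.snd v) x))) fun es =>
  .pair (map t fun i => nth s₁ S i) (labels (codes T t (.fst best)) es)

end Algorithm

/-- The algorithm on the input points `0, …, n - 1` with initial point `i₀`. -/
def run {K : Type} {n : ℕ} (i₀ : Fin n) (k L U : ℕ) :
    Tm (Ty.Val (Fin n) K) (.prod (.list .pt) (.list .num)) :=
  .letV (.var (List.finRange n)) fun ps => .letV (.var i₀) fun s₁ =>
  .letV (.var (k : ℚ)) fun k => .letV (.var (L : ℚ)) fun L => .letV (.var (U : ℚ)) fun U =>
  algorithm (.var ps) (.var s₁) (.var k) (.var L) (.var U)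

end Prog

/-! Approximation. Suppose that some solution has radius `r`. Gonzalez's selection leaves two cases.
Either the `k` selected points are pairwise more than `2 * r` apart; then they lie in different
clusters of the solution, hence one in each. Or every input point is within `2 * r` of a selected
one. In both cases every point is within `2 * r` of a selected point (`exists_near_selected`). Since
`1 ≤ L`, each cluster contains a point `q`, and going through the center and `q`, each point of the
cluster is within `r + r + 2 * r` of the selected point near `q` (`exists_tuple`). So some tuple of
selected points admits a balanced assignment whose radius `ρ ≤ 4 * r` is a distance of an input
point to a selected one, that is, an entry of the sorted list. This assignment solves the system of
the tuple at all radii from `ρ` on (`solves_of_assign`), and therefore the binary search ends with a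
record of radius at most `ρ` (`loopVal_searchStep`). Feasibility is decided correctly because
Fourier-Motzkin elimination is sound and complete (`solveList_spec`).

Rounding. Take the balls as vertices, and join the balls of two fractional variables of the same
region by an edge with this region as its color. As region sums are integers, no region has just one
fractional variable, so a walk that enters a region can leave it. The walk either closes a cycle of
distinct colors, or ends as a path between two balls with a single fractional variable each
(`walkStep_spec`). A shift along it keeps all region sums. The sum of a ball changes only if the
ball has a single fractional variable, and then it stays between the same two integers, so that the
bounds `L` and `U` survive. Each maximal shift makes a variable an integer (`shift_maxShift`). The
integer solution is finally distributed to the points one by one (`assign_of_solves`).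

Running time. Regions, variables, tuples, elimination and rounding have sizes that depend on `k`
only; their cost is bounded by a function of `k`, up to the counting of points, by rules that follow
the syntax of the terms (`Bd`). The long lists, of length `n` or `n * k`, are treated by explicit
estimates (`Runs`): linearly many distance evaluations, a merge sort with logarithmically many
passes, and for each tuple a binary search with logarithmically many rounds of linear cost. The sum
is formed in `exists_cost_run`. -/

namespace Prog

/-! ### Values of the library routines. -/

section Values

variable {ι K : Type} [LinearOrder K] (d : ι → ι → K) {a b c : Ty}

attribute [simp] Tm.val

@[simp] theorem val_hadd (s t : Tm (Ty.Val ι K) .num) :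
    (s + t).val d = (s.val d + t.val d : ℚ) := rfl
@[simp] theorem val_hsub (s t : Tm (Ty.Val ι K) .num) :
    (s - t).val d = (s.val d - t.val d : ℚ) := rfl
@[simp] theorem val_hdiv (s t : Tm (Ty.Val ι K) .num) :
    (s / t).val d = (s.val d / t.val d : ℚ) := rfl

@[simp] theorem val_bind' (t : Tm (Ty.Val ι K) a) (f : Tm _ a → Tm _ b) :
    (bind' t f).val d = (f (.var (t.val d))).val d := rfl

/-- The value at a list that is given by the cases of the empty and of a nonempty list. -/
def caseList {α β : Type*} (l : List α) (e : β) (f : α → List α → β) : β :=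
  match l with
  | [] => e
  | x :: t => f x t

@[simp] theorem caseList_nil {α β : Type*} (e : β) (f : α → List α → β) :
    caseList [] e f = e := rfl

@[simp] theorem caseList_cons {α β : Type*} (x : α) (t : List α) (e : β) (f : α → List α → β) :
    caseList (x :: t) e f = f x t := rfl

@[simp] theorem val_cases' (l : Tm (Ty.Val ι K) (.list a)) (e : Tm _ b)
    (f : Tm _ a → Tm _ (.list a) → Tm _ b) :
    (cases' l e f).val d = caseList (l.val d) (e.val d) fun x t => (f (.var x) (.var t)).val d := by
  simp only [cases', Tm.val]
  cases l.val d <;> rfl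

@[simp] theorem val_foldl' (l : Tm (Ty.Val ι K) (.list a)) (s : Tm _ b)
    (f : Tm _ b → Tm _ a → Tm _ b) :
    (foldl' l s f).val d = (l.val d).foldl (fun y x => (f (.var y) (.var x)).val d) (s.val d) := rfl

@[simp] theorem val_foldr' (l : Tm (Ty.Val ι K) (.list a)) (s : Tm _ b)
    (f : Tm _ a → Tm _ b → Tm _ b) :
    (foldr' l s f).val d = (l.val d).foldr (fun x y => (f (.var x) (.var y)).val d) (s.val d) := rfl

@[simp] theorem val_while' (m : Tm (Ty.Val ι K) .num) (s : Tm _ b) (p : Tm _ b → Tm _ .bool)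
    (f : Tm _ b → Tm _ b) :
    (while' m s p f).val d = loopVal (fun y => (p (.var y)).val d) (fun y => (f (.var y)).val d)
      ⌊(m.val d : ℚ)⌋₊ (s.val d) := rfl

theorem loopVal_true {β : Type} (f : β → β) (m : ℕ) (s : β) :
    loopVal (fun _ => true) f m s = f^[m] s := by
  induction m generalizing s with
  | zero => rfl
  | succ m ih => simp [loopVal, ih]

@[simp] theorem val_repeat' (m : Tm (Ty.Val ι K) .num) (s : Tm _ b) (f : Tm _ b → Tm _ b) :
    (repeat' m s f).val d = (fun y => (f (.var y)).val d)^[⌊(m.val d : ℚ)⌋₊] (s.val d) := by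
  simp only [repeat', val_while', Tm.val]
  exact loopVal_true _ _ _

@[simp] theorem val_not' (s : Tm (Ty.Val ι K) .bool) : (not' s).val d = !(s.val d : Bool) := by
  simp only [not', Tm.val]; cases (s.val d : Bool) <;> rfl

@[simp] theorem val_and' (s t : Tm (Ty.Val ι K) .bool) :
    (and' s t).val d = ((s.val d : Bool) && (t.val d : Bool)) := by
  simp only [and', Tm.val]; cases (s.val d : Bool) <;> rfl

@[simp] theorem val_or' (s t : Tm (Ty.Val ι K) .bool) :
    (or' s t).val d = ((s.val d : Bool) || (t.val d : Bool)) := by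
  simp only [or', Tm.val]; cases (s.val d : Bool) <;> rfl

@[simp] theorem val_head (e : Tm (Ty.Val ι K) a) (l : Tm _ (.list a)) :
    (head e l).val d = (l.val d).headD (e.val d) := by
  simp only [head, cases', Tm.val]; cases l.val d <;> rfl

@[simp] theorem val_tail (l : Tm (Ty.Val ι K) (.list a)) : (tail l).val d = (l.val d).tail := by
  simp only [tail, cases', Tm.val]; cases l.val d <;> rfl

@[simp] theorem val_isNil (l : Tm (Ty.Val ι K) (.list a)) :
    (isNil l).val d = List.isEmpty (l.val d) := by
  simp only [isNil, cases', Tm.val]; cases l.val d <;> rfl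

@[simp] theorem val_nth (e : Tm (Ty.Val ι K) a) (l : Tm _ (.list a)) (i : Tm _ .num) :
    (nth e l i).val d = (l.val d).getD ⌊(i.val d : ℚ)⌋₊ (e.val d) := by
  have h : ∀ (m : ℕ) (l : List (a.Val ι K)), List.tail^[m] l = l.drop m := by
    intro m
    induction m with
    | zero => simp
    | succ m ih => intro l; rw [Function.iterate_succ_apply, ih]; simp
  simp only [nth, val_head, val_repeat', val_tail, Tm.val]
  rw [show (fun y : List (a.Val ι K) => y.tail) = List.tail from rfl, h]
  simp [List.headD_eq_head?_getD, List.head?_drop, List.getD_eq_getElem?_getD]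

theorem foldl_add_one {α : Type} (p : α → Bool) (l : List α) (q : ℚ) :
    l.foldl (fun s x => if p x = true then s + 1 else s) q = q + l.countP p := by
  induction l generalizing q with
  | nil => simp
  | cons x l ih =>
    rw [List.foldl_cons, ih, List.countP_cons]
    split_ifs <;> simp; ring

@[simp] theorem val_length (l : Tm (Ty.Val ι K) (.list a)) :
    (length l).val d = ((List.length (l.val d) : ℕ) : ℚ) := by
  have := foldl_add_one (fun _ : a.Val ι K => true) (l.val d) 0
  simpa [length] using this

@[simp] theorem val_append (l l' : Tm (Ty.Val ι K) (.list a)) :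
    (append l l').val d = (l.val d ++ l'.val d : List (a.Val ι K)) := by
  simp [append]

@[simp] theorem val_revAppend (l l' : Tm (Ty.Val ι K) (.list a)) :
    (revAppend l l').val d = ((l.val d).reverse ++ l'.val d : List (a.Val ι K)) := by
  simp [revAppend]

@[simp] theorem val_map (l : Tm (Ty.Val ι K) (.list a)) (f : Tm _ a → Tm _ b) :
    (map l f).val d = (l.val d).map fun x => (f (.var x)).val d := by
  simp only [map, val_foldr', Tm.val]
  induction l.val d with
  | nil => rfl
  | cons x l ih => simp [ih]

@[simp] theorem val_flatMap (l : Tm (Ty.Val ι K) (.list a)) (f : Tm _ a → Tm _ (.list b)) :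
    (flatMap l f).val d = (l.val d).flatMap fun x => (f (.var x)).val d := by
  simp only [flatMap, val_foldr', val_append, Tm.val]
  induction l.val d with
  | nil => rfl
  | cons x l ih => simp [ih]

@[simp] theorem val_filter (l : Tm (Ty.Val ι K) (.list a)) (p : Tm _ a → Tm _ .bool) :
    (filter l p).val d = (l.val d).filter fun x => (p (.var x)).val d := by
  simp only [filter, val_foldr', Tm.val]
  induction l.val d with
  | nil => rfl
  | cons x l ih => simp [ih, List.filter_cons]

@[simp] theorem val_any (l : Tm (Ty.Val ι K) (.list a)) (p : Tm _ a → Tm _ .bool) :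
    (any l p).val d = (l.val d).any fun x => (p (.var x)).val d := by
  have h : ∀ (l : List (a.Val ι K)) (q : a.Val ι K → Bool) (s : Bool),
      l.foldl (fun s x => s || q x) s = (s || l.any q) := by
    intro l q
    induction l with
    | nil => simp
    | cons x l ih => intro s; simp [ih, Bool.or_assoc]
  simp only [any, val_foldl', val_or', Tm.val]
  exact (h _ _ _).trans (by simp)

@[simp] theorem val_all (l : Tm (Ty.Val ι K) (.list a)) (p : Tm _ a → Tm _ .bool) :
    (all l p).val d = (l.val d).all fun x => (p (.var x)).val d := by
  have h : ∀ (l : List (a.Val ι K)) (q : a.Val ι K → Bool) (s : Bool),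
      l.foldl (fun s x => s && q x) s = (s && l.all q) := by
    intro l q
    induction l with
    | nil => simp
    | cons x l ih => intro s; simp [ih, Bool.and_assoc]
  simp only [all, val_foldl', val_and', Tm.val]
  exact (h _ _ _).trans (by simp)

@[simp] theorem val_count (l : Tm (Ty.Val ι K) (.list a)) (p : Tm _ a → Tm _ .bool) :
    (count l p).val d = ((List.countP (fun x => (p (.var x)).val d) (l.val d) : ℕ) : ℚ) := by
  have := foldl_add_one (fun x : a.Val ι K => (p (.var x)).val d) (l.val d) 0
  simpa [count] using this

@[simp] theorem val_before (l : Tm (Ty.Val ι K) (.list a)) (p : Tm _ a → Tm _ .bool) :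
    (before l p).val d = (l.val d).takeWhile fun x => !((p (.var x)).val d : Bool) := by
  simp only [before, val_foldr', Tm.val]
  induction l.val d with
  | nil => rfl
  | cons x l ih =>
    rw [List.foldr_cons, ih, List.takeWhile_cons]
    cases ((p (.var x)).val d : Bool) <;> rfl

/-- The entries of a list up to and including the first one that satisfies `p`. -/
def takeUpTo {α : Type*} (p : α → Bool) : List α → List α
  | [] => []
  | x :: l => if p x then [x] else x :: takeUpTo p l

@[simp] theorem val_upTo (l : Tm (Ty.Val ι K) (.list a)) (p : Tm _ a → Tm _ .bool) :
    (upTo l p).val d = takeUpTo (fun x => (p (.var x)).val d) (l.val d) := by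
  simp only [upTo, val_foldr', Tm.val]
  induction l.val d with
  | nil => rfl
  | cons x l ih => rw [List.foldr_cons, ih, takeUpTo]

@[simp] theorem val_zipWith (l : Tm (Ty.Val ι K) (.list a)) (l' : Tm _ (.list b))
    (f : Tm _ a → Tm _ b → Tm _ c) :
    (zipWith l l' f).val d =
      List.zipWith (fun x y => (f (.var x) (.var y)).val d) (l.val d) (l'.val d) := by
  -- The fold collects the results in reverse order. Once the second list is used up the state stays
  -- put, which agrees with the truncation of `List.zipWith`.
  have h : ∀ (l : List (a.Val ι K)) (s : List (b.Val ι K) × List (c.Val ι K)),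
      (l.foldl (fun s x => caseList s.1 s fun y t =>
        (t, (f (.var x) (.var y)).val d :: s.2)) s).2 =
      (List.zipWith (fun x y => (f (.var x) (.var y)).val d) l s.1).reverse ++ s.2 := by
    intro l
    induction l with
    | nil => simp
    | cons x l ih =>
      rintro ⟨s, s'⟩
      rw [List.foldl_cons, ih]
      cases s <;> simp
  simp only [zipWith, val_revAppend, Tm.val, val_foldl', val_cases']
  refine (congrArg (fun z => List.reverse z ++ []) (h (l.val d) (l'.val d, []))).trans ?_
  simp

@[simp] theorem val_range (m : Tm (Ty.Val ι K) .num) (n : ℕ) (hm : m.val d = (n : ℚ)) :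
    (range m).val d = (List.range n).map (fun i : ℕ => (i : ℚ)) := by
  -- The program counts down, so that consing gives increasing order. For the induction the
  -- countdown runs from `i + j` to `i` with any list already present.
  have h : ∀ (j : ℕ) (l : List ℚ) (i : ℕ), (fun y : ℚ × List ℚ => (y.1 - 1, (y.1 - 1) :: y.2))^[j]
      (((i + j : ℕ) : ℚ), l) = ((i : ℚ), (List.range' i j).map (fun i : ℕ => (i : ℚ)) ++ l) := by
    intro j
    induction j with
    | zero => simp
    | succ j ih =>
      intro l i
      rw [Function.iterate_succ_apply]
      have : (((i + (j + 1) : ℕ) : ℚ) - 1) = ((i + j : ℕ) : ℚ) := by push_cast; ring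
      simp only [this]
      rw [ih, List.range'_concat]
      simp
  simp only [range, val_bind', Tm.val, val_repeat', hm, Nat.floor_natCast, val_hsub]
  have := h n [] 0
  simp only [zero_add] at this
  refine (congrArg Prod.snd this).trans ?_
  simp [List.range_eq_range']

end Values

/-! ### Loops with a bounded number of rounds, and merge sort. -/

section Sorting

variable {ι K : Type} [LinearOrder K] (d : ι → ι → K)

theorem loopVal_inv {β : Type} {c : β → Bool} {f : β → β} (Inv : β → Prop)
    (hf : ∀ s, Inv s → c s = true → Inv (f s)) (m : ℕ) {s : β} (hs : Inv s) :
    Inv (loopVal c f m s) := by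
  induction m generalizing s with
  | zero => exact hs
  | succ m ih =>
    rw [loopVal]
    split_ifs with h
    · exact ih (hf s hs h)
    · exact hs

/-- A loop ends by its condition if some rank decreases in each round. -/
theorem loopVal_end {β : Type} {c : β → Bool} {f : β → β} (Inv : β → Prop) (ρ : β → ℕ)
    (hf : ∀ s, Inv s → c s = true → Inv (f s) ∧ ρ (f s) < ρ s) (m : ℕ) {s : β} (hs : Inv s)
    (hm : ρ s ≤ m) : c (loopVal c f m s) = false := by
  induction m generalizing s with
  | zero =>
    rw [loopVal]
    by_contra h
    have := (hf s hs (by simpa using h)).2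
    omega
  | succ m ih =>
    rw [loopVal]
    split_ifs with h
    · have := hf s hs h
      exact ih this.1 (by omega)
    · simpa using h

-- The reversed output followed by the merge of the remaining lists is the same in all rounds. Each
-- round consumes one entry, so the sum of the lengths is enough as a limit of the rounds.
@[simp] theorem val_merge (l l' : Tm (Ty.Val ι K) (.list .dst)) :
    (merge l l').val d = List.merge (l.val d : List K) (l'.val d) (fun x y => decide (x ≤ y)) := by
  have h : ∀ (m : ℕ) (l l' acc : List K), l.length + l'.length ≤ m →
      ∀ z, z = (loopVal (fun s : List K × List K × List K => !(s.1.isEmpty || s.2.1.isEmpty))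
        (fun s => caseList s.1 s fun x t => caseList s.2.1 s fun y t' =>
          if decide (x ≤ y) = true then (t, s.2.1, x :: s.2.2)
          else (s.1, t', y :: s.2.2)) m (l, l', acc)) →
      z.2.2.reverse ++ (z.1 ++ z.2.1) =
      acc.reverse ++ List.merge l l' (fun x y => decide (x ≤ y)) := by
    intro m
    induction m with
    | zero =>
      intro l l' acc h z hz
      obtain rfl := List.length_eq_zero_iff.1 (show l.length = 0 by omega)
      obtain rfl := List.length_eq_zero_iff.1 (show l'.length = 0 by omega)
      simp [hz, loopVal]
    | succ m ih =>
      intro l l' acc h z hz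
      rcases l with _ | ⟨x, l⟩
      · simp [hz, loopVal]
      rcases l' with _ | ⟨y, l'⟩
      · simp [hz, loopVal]
      rw [loopVal] at hz
      rw [List.cons_merge_cons]
      simp only [List.isEmpty_cons, Bool.or_false, Bool.not_false, if_true, caseList_cons] at hz
      simp only [List.length_cons] at h
      split_ifs at hz ⊢ with hxy
      · rw [ih _ _ _ (by simp; omega) z hz]; simp
      · rw [ih _ _ _ (by simp; omega) z hz]; simp
  simp only [merge, val_bind', val_revAppend, val_append, Tm.val, val_while', val_length, val_not', val_or',
    val_isNil, val_cases']
  rw [← Nat.cast_add, Nat.floor_natCast]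
  exact (h _ (l.val d) (l'.val d) [] le_rfl _ rfl).trans (by simp)

/-- The lists of `ls` merged in couples. -/
def mergePairs (ls : List (List K)) : List (List K) :=
  let s := ls.foldl (fun (s : List (List K) × List (List K)) l =>
    caseList s.1 (l :: [], s.2) fun p _ =>
      ([], List.merge p l (fun x y => decide (x ≤ y)) :: s.2)) ([], [])
  s.1 ++ s.2

@[simp] theorem val_mergePass (ls : Tm (Ty.Val ι K) (.list (.list .dst))) :
    (mergePass ls).val d = mergePairs (ls.val d) := by
  simp only [mergePass, val_bind', val_append, Tm.val, val_foldl', val_cases', val_merge,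
    mergePairs]

end Sorting
end Prog

namespace Prog

section Sorting

variable {ι K : Type} [LinearOrder K] (d : ι → ι → K)

/-- The state of the fold is a waiting list, if any, and the output. A waiting list counts for one
and an output list for two of the lists read so far, which gives half of their number, rounded up.
This count makes the number of passes logarithmic. -/
theorem mergePairs_spec (ls : List (List K)) (hs : ∀ l ∈ ls, l.Pairwise (· ≤ ·)) :
    (∀ l ∈ mergePairs ls, l.Pairwise (· ≤ ·)) ∧ (mergePairs ls).flatten.Perm ls.flatten ∧
      (mergePairs ls).length = (ls.length + 1) / 2 := by
  have h : ∀ (ls : List (List K)) (s : List (List K) × List (List K)),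
      (∀ l ∈ ls, l.Pairwise (· ≤ ·)) → (∀ l ∈ s.1 ++ s.2, l.Pairwise (· ≤ ·)) → s.1.length ≤ 1 →
      ∀ z, z = ls.foldl (fun (s : List (List K) × List (List K)) l =>
        caseList s.1 (l :: [], s.2) fun p _ =>
        ([], List.merge p l (fun x y => decide (x ≤ y)) :: s.2)) s →
      (∀ l ∈ z.1 ++ z.2, l.Pairwise (· ≤ ·)) ∧
      (z.1 ++ z.2).flatten.Perm ((s.1 ++ s.2).flatten ++ ls.flatten) ∧
      z.1.length ≤ 1 ∧ z.1.length + 2 * z.2.length = s.1.length + 2 * s.2.length + ls.length := by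
    intro ls
    induction ls with
    | nil => rintro s - h1 h2 z rfl; simpa using ⟨by simpa using h1, h2⟩
    | cons l ls ih =>
      rintro ⟨p, acc⟩ h0 h1 h2 z hz
      rw [List.foldl_cons] at hz
      rcases p with _ | ⟨p, q⟩
      · obtain ⟨g1, g2, g3, g4⟩ := ih _ (fun l' hl' => h0 l' (by simp [hl']))
          (by simp only [caseList_nil]
              intro l' hl'
              rcases List.mem_cons.1 hl' with rfl | hl'
              · exact h0 _ (by simp)
              · exact h1 _ (by simpa using hl')) (by simp) z hz
        refine ⟨g1, g2.trans ?_, g3, ?_⟩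
        · simp only [caseList_nil, List.cons_append, List.flatten_cons, List.nil_append,
            ← List.append_assoc]
          exact List.Perm.append_right _ List.perm_append_comm
        · rw [g4]; simp; ring
      · obtain rfl : q = [] := by simpa using h2
        obtain ⟨g1, g2, g3, g4⟩ := ih _ (fun l' hl' => h0 l' (by simp [hl']))
          (by simp only [caseList_cons]
              intro l' hl'
              rcases List.mem_cons.1 hl' with rfl | hl'
              · have := List.pairwise_merge (le := fun x y : K => decide (x ≤ y))
                  (fun a b c => by simpa using le_trans) (fun a b => by simpa using le_total a b)
                  p l (by simpa using h1 p (by simp)) (by simpa using h0 l (by simp))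
                simpa using this
              · exact h1 _ (by simp [hl'])) (by simp) z hz
        refine ⟨g1, g2.trans ?_, g3, ?_⟩
        · simp only [caseList_cons, List.cons_append, List.flatten_cons, List.nil_append,
            ← List.append_assoc]
          refine List.Perm.append_right _ ?_
          refine (List.Perm.append_right _ (List.merge_perm_append _)).trans ?_
          rw [List.append_assoc, List.append_assoc]
          exact List.Perm.append_left _ List.perm_append_comm
        · rw [g4]; simp; ring
  obtain ⟨g1, g2, g3, g4⟩ := h ls ([], []) hs (by simp) (by simp) _ rfl
  refine ⟨g1, g2, ?_⟩
  simp only [mergePairs, List.length_append]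
  simp only [List.length_nil] at g4
  omega

/-- The invariant of merge sort: the lists are sorted, and they comprise the entries of `l`. -/
def SortInv (l : List K) (ls : List (List K)) : Prop :=
  (∀ x ∈ ls, x.Pairwise (· ≤ ·)) ∧ ls.flatten.Perm l

theorem SortInv.start (l : List K) : SortInv l (l.map fun x => [x]) := by
  constructor
  · simp
  · rw [← List.flatMap_def]; simp

theorem SortInv.mergePairs {l : List K} {ls : List (List K)} (h : SortInv l ls) :
    SortInv l (mergePairs ls) :=
  ⟨(mergePairs_spec ls h.1).1, (mergePairs_spec ls h.1).2.1.trans h.2⟩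

theorem val_sort (l : Tm (Ty.Val ι K) (.list .dst)) :
    List.Pairwise (· ≤ ·) ((sort l).val d : List K) ∧
      List.Perm ((sort l).val d : List K) (l.val d) := by
  simp only [sort, val_bind', val_head, val_while', val_length, Tm.val, val_map, val_not',
    val_isNil, val_tail, val_mergePass, Nat.floor_natCast]
  set z := loopVal (fun y : List (List K) => !y.tail.isEmpty) Prog.mergePairs
    (List.length (l.val d)) (List.map (fun x => [x]) (l.val d)) with hz
  have h1 : SortInv (l.val d) z := loopVal_inv (SortInv (l.val d))
    (fun s hs _ => hs.mergePairs) _ (.start _)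
  -- The number of lists serves as the rank: a pass lowers it as long as there are two, and
  -- initially it equals the limit of the rounds.
  have h2 : (!z.tail.isEmpty) = false := loopVal_end
    (c := fun y : List (List K) => !y.tail.isEmpty) (f := Prog.mergePairs) (SortInv (l.val d))
    List.length
    (fun s hs hc => ⟨hs.mergePairs, by
      rw [(mergePairs_spec s hs.1).2.2]
      rcases s with _ | ⟨x, _ | ⟨y, s⟩⟩ <;> simp at hc ⊢
      omega⟩) _ (.start _) (by simp)
  clear_value z
  rcases z with _ | ⟨r, _ | ⟨r', z⟩⟩
  · exact ⟨by simp, by simpa [SortInv] using h1⟩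
  · exact ⟨h1.1 r (by simp), by simpa [SortInv] using h1.2⟩
  · simp at h2

end Sorting

/-! ### Fourier-Motzkin elimination. -/

section FourierMotzkin

variable {ι K : Type} [LinearOrder K] (d : ι → ι → K)

/-- `∑ i, u i * y i`. -/
def dotProd (u y : List ℚ) : ℚ := (List.zipWith (· * ·) u y).sum

@[simp] theorem dotProd_nil (y : List ℚ) : dotProd [] y = 0 := rfl

@[simp] theorem dotProd_cons (a : ℚ) (u : List ℚ) (x : ℚ) (y : List ℚ) :
    dotProd (a :: u) (x :: y) = a * x + dotProd u y := by simp [dotProd]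

theorem val_dot (u y : Tm (Ty.Val ι K) (.list .num)) :
    (dot u y).val d = dotProd (u.val d) (y.val d) := by
  have h : ∀ (l : List ℚ) (q : ℚ), l.foldl (fun s t => s + t) q = q + l.sum := by
    intro l
    induction l with
    | nil => simp
    | cons x l ih => intro q; rw [List.foldl_cons, ih, List.sum_cons, add_assoc]
  simp only [dot, val_foldl', Tm.val, val_zipWith]
  exact (h _ _).trans (zero_add _)

theorem dotProd_div (u y : List ℚ) (q : ℚ) :
    dotProd (u.map fun s => s / q) y = dotProd u y / q := by
  induction u generalizing y with
  | nil => simp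
  | cons a u ih =>
    rcases y with _ | ⟨x, y⟩
    · simp [dotProd]
    · rw [List.map_cons, dotProd_cons, dotProd_cons, ih]; ring

theorem dotProd_add (u u' y : List ℚ) (h : u.length = u'.length) :
    dotProd (List.zipWith (fun s t => s + t) u u') y = dotProd u y + dotProd u' y := by
  induction u generalizing y u' with
  | nil => obtain rfl : u' = [] := by simpa using h.symm
           simp
  | cons a u ih =>
    rcases u' with _ | ⟨a', u'⟩
    · simp at h
    rcases y with _ | ⟨x, y⟩
    · simp [dotProd]
    · rw [List.zipWith_cons_cons, dotProd_cons, dotProd_cons, dotProd_cons, ih _ _ (by simpa using h)]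
      ring

/-- The inequality `∑ i, e.1 i * x i ≤ e.2`. -/
def Holds (x : List ℚ) (e : List ℚ × ℚ) : Prop := dotProd e.1 x ≤ e.2

def upperList (sys : List (List ℚ × ℚ)) : List (List ℚ × ℚ) :=
  (sys.filter fun e => !decide (e.1.headD 0 ≤ 0)).map fun e =>
    (e.1.tail.map fun s => s / e.1.headD 0, e.2 / e.1.headD 0)

def lowerList (sys : List (List ℚ × ℚ)) : List (List ℚ × ℚ) :=
  (sys.filter fun e => !decide (0 ≤ e.1.headD 0)).map fun e =>
    (e.1.tail.map fun s => s / (0 - e.1.headD 0), e.2 / (0 - e.1.headD 0))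

/-- The Fourier-Motzkin elimination of the first variable. -/
def eliminate (sys : List (List ℚ × ℚ)) : List (List ℚ × ℚ) :=
  ((sys.filter fun e => decide (e.1.headD 0 = 0)).map fun e => (e.1.tail, e.2)) ++
    (upperList sys).flatMap fun e => (lowerList sys).map fun e' =>
      (List.zipWith (fun s t => s + t) e.1 e'.1, e.2 + e'.2)

/-- The least non-negative number that satisfies the lower bounds `low` at `y`. -/
def leastAbove (low : List (List ℚ × ℚ)) (y : List ℚ) : ℚ :=
  low.foldl (fun x e => if dotProd e.1 y - e.2 ≤ x then x else dotProd e.1 y - e.2) 0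

/-- The eliminated system after `m` eliminations, and the lists of lower bounds. -/
def eliminateAll (m : ℕ) (sys : List (List ℚ × ℚ)) :
    List (List ℚ × ℚ) × List (List (List ℚ × ℚ)) :=
  (fun s : List (List ℚ × ℚ) × List (List (List ℚ × ℚ)) =>
    (eliminate s.1, lowerList s.1 :: s.2))^[m] (sys, [])

def solveList (m : ℕ) (sys : List (List ℚ × ℚ)) : Bool × List ℚ :=
  ((eliminateAll m sys).1.all fun e => decide (0 ≤ e.2),
    (eliminateAll m sys).2.foldl (fun y low => leastAbove low y :: y) [])

theorem val_solve (m : Tm (Ty.Val ι K) .num) (sys : Tm (Ty.Val ι K) (.list Ineq)) :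
    (solve m sys).val d = solveList ⌊(m.val d : ℚ)⌋₊ (sys.val d) := by
  simp only [solve, val_bind', val_repeat', Tm.val, val_append, upperBounds, lowerBounds, unbounded,
    val_map, val_flatMap, val_zipWith, val_filter, leading, val_head, val_not', scaleTail, val_tail,
    val_hdiv, val_hsub, val_foldl', val_all, val_dot]
  simp only [solveList, eliminateAll, leastAbove, eliminate, upperList, lowerList, decide_eq_true_eq]
  rfl

/-- The third clause, that the value is attained, is what back substitution needs in order to
satisfy the upper bounds. -/
theorem le_leastAbove {low : List (List ℚ × ℚ)} {y : List ℚ} :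
    0 ≤ leastAbove low y ∧ (∀ e ∈ low, dotProd e.1 y - e.2 ≤ leastAbove low y) ∧
      (leastAbove low y = 0 ∨ ∃ e ∈ low, leastAbove low y = dotProd e.1 y - e.2) := by
  unfold leastAbove
  induction low using List.reverseRecOn with
  | nil => simp
  | append_singleton low e ih =>
    rw [List.foldl_append, List.foldl_cons, List.foldl_nil]
    obtain ⟨h1, h2, h3⟩ := ih
    split_ifs with h
    · refine ⟨h1, ?_, ?_⟩
      · intro e' he'
        rcases List.mem_append.1 he' with he' | he'
        · exact h2 e' he'
        · rw [List.mem_singleton.1 he']; exact h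
      · rcases h3 with h3 | ⟨e', h3, h4⟩
        · exact .inl h3
        · exact .inr ⟨e', by simp [h3], h4⟩
    · push Not at h
      refine ⟨h1.trans h.le, ?_, .inr ⟨e, by simp, rfl⟩⟩
      intro e' he'
      rcases List.mem_append.1 he' with he' | he'
      · exact (h2 e' he').trans h.le
      · rw [List.mem_singleton.1 he']

/-- The sign conditions of all variables are among the inequalities of a system. -/
def HasSigns (m : ℕ) (sys : List (List ℚ × ℚ)) : Prop :=
  ∀ i < m, ((List.range m).map (fun j => if j = i then (-1 : ℚ) else 0), (0 : ℚ)) ∈ sys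

theorem length_eliminate {m : ℕ} {sys : List (List ℚ × ℚ)} (h : ∀ e ∈ sys, e.1.length = m + 1) :
    ∀ e ∈ eliminate sys, e.1.length = m := by
  intro e he
  simp only [eliminate, upperList, lowerList, List.mem_append, List.mem_map, List.mem_flatMap,
    List.mem_filter] at he
  rcases he with ⟨e, ⟨he, -⟩, rfl⟩ | ⟨_, ⟨e, ⟨he, -⟩, rfl⟩, _, ⟨e', ⟨he', -⟩, rfl⟩, rfl⟩
  · simp [h e he]
  · simp [h e he, h e' he']

/-- The sign condition of a later variable does not contain the first one, so the elimination passes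
it on with its index lowered by one. -/
theorem HasSigns.eliminate {m : ℕ} {sys : List (List ℚ × ℚ)} (h : HasSigns (m + 1) sys) :
    HasSigns m (eliminate sys) := by
  intro i hi
  refine List.mem_append_left _ (List.mem_map.2 ⟨_, List.mem_filter.2 ⟨h (i + 1) (by omega), ?_⟩, ?_⟩)
  · simp [List.range_succ_eq_map]
  · simp [List.range_succ_eq_map, Function.comp_def]

theorem holds_cons {x : ℚ} {y : List ℚ} {e : List ℚ × ℚ} (h : e.1 ≠ []) :
    Holds (x :: y) e ↔ e.1.headD 0 * x + dotProd e.1.tail y ≤ e.2 := by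
  obtain ⟨_ | ⟨a, u⟩, v⟩ := e
  · exact absurd rfl h
  · simp [Holds]

/-- A solution of a system gives one of the system without its first variable. -/
theorem holds_eliminate {m : ℕ} {sys : List (List ℚ × ℚ)} (h : ∀ e ∈ sys, e.1.length = m + 1)
    {x : ℚ} {y : List ℚ} (hx : ∀ e ∈ sys, Holds (x :: y) e) : ∀ e ∈ eliminate sys, Holds y e := by
  intro e he
  have hn : ∀ e ∈ sys, e.1 ≠ [] := fun e he => by
    have := h e he; intro h'; simp [h'] at this
  simp only [eliminate, upperList, lowerList, List.mem_append, List.mem_map, List.mem_flatMap,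
    List.mem_filter] at he
  rcases he with ⟨e, ⟨he, h0⟩, rfl⟩ | ⟨_, ⟨e, ⟨he, h1⟩, rfl⟩, _, ⟨e', ⟨he', h2⟩, rfl⟩, rfl⟩
  · have := (holds_cons (hn e he)).1 (hx e he)
    simp only [decide_eq_true_eq] at h0
    rw [h0, zero_mul, zero_add] at this
    exact this
  -- The first variable lies between the lower bound from `e'` and the upper bound from `e`.
  -- Comparing the two bounds gives the combined inequality.
  · have g := (holds_cons (hn e he)).1 (hx e he)
    have g' := (holds_cons (hn e' he')).1 (hx e' he')
    simp only [Bool.not_eq_true', decide_eq_false_iff_not, not_le] at h1 h2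
    simp only [Holds]
    rw [dotProd_add _ _ _ (by simp [h e he, h e' he']), dotProd_div, dotProd_div]
    generalize e.1.headD 0 = α at *
    generalize e'.1.headD 0 = β at *
    have k1 : x ≤ e.2 / α - dotProd e.1.tail y / α := by
      rw [← sub_div, le_div_iff₀ h1]; linarith
    have k2 : dotProd e'.1.tail y / (0 - β) - e'.2 / (0 - β) ≤ x := by
      rw [← sub_div, div_le_iff₀ (by linarith)]; linarith
    linarith

/-- Back substitution of one variable. -/
theorem holds_leastAbove {m : ℕ} {sys : List (List ℚ × ℚ)} (h : ∀ e ∈ sys, e.1.length = m + 1)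
    (hs : HasSigns (m + 1) sys) {y : List ℚ} (hy : ∀ e ∈ eliminate sys, Holds y e) :
    ∀ e ∈ sys, Holds (leastAbove (lowerList sys) y :: y) e := by
  have hn : ∀ e ∈ sys, e.1 ≠ [] := fun e he => by
    have := h e he; intro h'; simp [h'] at this
  obtain ⟨-, g2, g3⟩ := le_leastAbove (low := lowerList sys) (y := y)
  -- The start value `0` of the maximum is itself a lower bound of the system, namely the sign
  -- condition of the first variable. So some lower bound is attained in any case.
  have g3' : ∃ e ∈ lowerList sys, leastAbove (lowerList sys) y = dotProd e.1 y - e.2 := by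
    rcases g3 with g3 | g3
    · refine ⟨_, List.mem_map.2 ⟨_, List.mem_filter.2 ⟨hs 0 (by omega), ?_⟩, rfl⟩, ?_⟩
      · simp [List.range_succ_eq_map]
      · rw [g3, dotProd_div]
        have : ∀ (l : ℕ) (y : List ℚ), dotProd (List.replicate l 0) y = 0 := by
          intro l
          induction l with
          | zero => simp
          | succ l ih => rintro (_ | ⟨x, y⟩) <;> simp [dotProd, List.replicate_succ] at ih ⊢; exact ih y
        simp [List.range_succ_eq_map, this, Function.comp_def]
    · exact g3
  generalize leastAbove (lowerList sys) y = x at *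
  intro e he
  rw [holds_cons (hn e he)]
  rcases lt_trichotomy (e.1.headD 0) 0 with h0 | h0 | h0
  · have := g2 _ (List.mem_map.2 ⟨e, List.mem_filter.2 ⟨he, by simpa using h0⟩, rfl⟩)
    simp only [dotProd_div] at this
    rw [← sub_div, div_le_iff₀ (by linarith)] at this
    linarith
  · have := hy _ (List.mem_append_left _ (List.mem_map.2
      ⟨e, List.mem_filter.2 ⟨he, by simpa using h0⟩, rfl⟩))
    rw [h0, zero_mul, zero_add]
    exact this
  -- The upper bound `e` holds because the eliminated system contains its combination with the lower
  -- bound `e'` whose value was chosen.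
  · obtain ⟨e', he', rfl⟩ := g3'
    have hl : e'.1.length = m := by
      simp only [lowerList, List.mem_map, List.mem_filter] at he'
      obtain ⟨e', ⟨he', -⟩, rfl⟩ := he'
      simp [h e' he']
    have := hy _ (List.mem_append_right _ (List.mem_flatMap.2 ⟨_, List.mem_map.2
      ⟨e, List.mem_filter.2 ⟨he, by simpa using h0⟩, rfl⟩, List.mem_map.2 ⟨e', he', rfl⟩⟩))
    simp only [Holds] at this
    rw [dotProd_add _ _ _ (by simp [h e he, hl]), dotProd_div] at this
    have k : dotProd e'.1 y - e'.2 ≤ (e.2 - dotProd e.1.tail y) / e.1.headD 0 := by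
      rw [sub_div]; linarith
    rw [le_div_iff₀ h0] at k
    linarith

/-- Solutions pass to the eliminated systems by `holds_eliminate` and come back by
`holds_leastAbove`. Without variables, an inequality only says that its right side is non-negative,
which is the final test. -/
theorem solveList_spec (m : ℕ) (sys : List (List ℚ × ℚ)) (h : ∀ e ∈ sys, e.1.length = m)
    (hs : HasSigns m sys) :
    (∀ x : List ℚ, x.length = m → (∀ e ∈ sys, Holds x e) → (solveList m sys).1 = true) ∧
    ((solveList m sys).1 = true → (solveList m sys).2.length = m ∧
      ∀ e ∈ sys, Holds (solveList m sys).2 e) := by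
  have main : ∀ (m : ℕ) (sys : List (List ℚ × ℚ)) (lows : List (List (List ℚ × ℚ))),
      (∀ e ∈ sys, e.1.length = m) → HasSigns m sys →
      ∀ z, z = (fun s : List (List ℚ × ℚ) × List (List (List ℚ × ℚ)) =>
        (eliminate s.1, lowerList s.1 :: s.2))^[m] (sys, lows) →
      (∀ x : List ℚ, x.length = m → (∀ e ∈ sys, Holds x e) → ∀ e ∈ z.1, 0 ≤ e.2) ∧
      ((∀ e ∈ z.1, 0 ≤ e.2) → ∃ y : List ℚ, y.length = m ∧ (∀ e ∈ sys, Holds y e) ∧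
        -- The lower bounds are stacked with the last eliminated variable on top. Hence the fold
        -- first builds a solution `y` of the present system, and then goes on with the older bounds
        -- `lows`.
        z.2.foldl (fun y low => leastAbove low y :: y) [] =
          lows.foldl (fun y low => leastAbove low y :: y) y) := by
    intro m
    induction m with
    | zero =>
      rintro sys lows h hs z rfl
      have h' : ∀ e ∈ sys, ∀ y, Holds y e ↔ 0 ≤ e.2 := fun e he y => by
        rw [Holds, List.length_eq_zero_iff.1 (h e he), dotProd_nil]
      exact ⟨fun x _ hx e he => (h' e he x).1 (hx e he), fun hz =>
        ⟨[], rfl, fun e he => (h' e he _).2 (hz e he), rfl⟩⟩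
    | succ m ih =>
      intro sys lows h hs z hz
      rw [Function.iterate_succ_apply] at hz
      obtain ⟨h1, h2⟩ := ih _ _ (length_eliminate h) hs.eliminate z hz
      constructor
      · rintro (_ | ⟨x, y⟩) hx hx'
        · simp at hx
        · exact h1 y (by simpa using hx) (holds_eliminate h hx')
      · intro hz
        obtain ⟨y, hy, hy', h3⟩ := h2 hz
        exact ⟨_ :: y, by simp [hy], holds_leastAbove h hs hy', by rw [h3, List.foldl_cons]⟩
  obtain ⟨h1, h2⟩ := main m sys [] h hs _ rfl
  constructor
  · intro x hx hx'
    simpa [solveList, eliminateAll] using fun a b hab => h1 x hx hx' _ hab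
  · intro hz
    obtain ⟨y, hy, hy', h3⟩ := h2 (fun e he => by
      have := List.all_eq_true.1 hz e he
      simpa using this)
    have : (solveList m sys).2 = y := h3
    rw [this]
    exact ⟨hy, hy'⟩

end FourierMotzkin
end Prog

namespace Prog

/-! ### Cycles and paths of fractional variables. -/

section Couples

variable {ι K : Type} [LinearOrder K] (d : ι → ι → K)

/-- One step of the walk along the couples of the fractional variables `fs`. -/
def walkStep (fs : List (ℚ × ℚ)) (s : Bool × List (ℚ × ℚ × ℚ) × ℚ × ℚ) :
    Bool × List (ℚ × ℚ × ℚ) × ℚ × ℚ :=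
  caseList (fs.filter fun f => decide (f.2 = s.2.2.1) && !decide (f.1 = s.2.2.2)) (true, s.2)
    fun f _ => caseList (s.2.1.filter fun e => decide (e.1 = f.1))
      (if (s.2.1.any fun e => decide (e.2.1 = ((fs.filter fun g =>
            decide (g.1 = f.1) && !decide (g.2 = s.2.2.1)).headD f).2)) = true then
        (true, (f.1, s.2.2.1, ((fs.filter fun g =>
            decide (g.1 = f.1) && !decide (g.2 = s.2.2.1)).headD f).2) ::
          takeUpTo (fun e => decide (e.2.1 = ((fs.filter fun g =>
            decide (g.1 = f.1) && !decide (g.2 = s.2.2.1)).headD f).2)) s.2.1,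
          ((fs.filter fun g => decide (g.1 = f.1) && !decide (g.2 = s.2.2.1)).headD f).2, f.1)
      else
        (false, (f.1, s.2.2.1, ((fs.filter fun g =>
            decide (g.1 = f.1) && !decide (g.2 = s.2.2.1)).headD f).2) :: s.2.1,
          ((fs.filter fun g => decide (g.1 = f.1) && !decide (g.2 = s.2.2.1)).headD f).2, f.1))
      fun e _ => (true, (f.1, s.2.2.1, e.2.2) :: s.2.1.takeWhile (fun e => !decide (e.1 = f.1)),
        s.2.2.1, f.1)

/-- The ball at which the walk starts. -/
def walkStart (fs : List (ℚ × ℚ)) : ℚ :=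
  ((fs.filter fun f => decide ((fs.countP fun g => decide (g.2 = f.2) : ℚ) = 1)).headD
    (fs.headD (0, 0))).2

def couples (k : ℚ) (fs : List (ℚ × ℚ)) : List (ℚ × ℚ × ℚ) :=
  (loopVal (fun s => !s.1) (walkStep fs) ⌊k + 1⌋₊ (false, [], walkStart fs, -1)).2.1

theorem val_findCouples (k : Tm (Ty.Val ι K) .num) (fs : Tm (Ty.Val ι K) (.list (.prod .num .num))) :
    (findCouples k fs).val d = couples (k.val d) (fs.val d) := by
  simp only [findCouples, val_bind', val_while', Tm.val, val_head, val_filter, val_count,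
    val_not', val_and', val_cases', val_any, val_upTo, val_before]
  rfl

/-- The edges `p` (latest first) form a walk from `a` to `b`. -/
def IsWalk (p : List (ℚ × ℚ × ℚ)) (a b : ℚ) : Prop :=
  b :: p.map (fun q => q.2.1) = p.map (fun q => q.2.2) ++ [a]

theorem IsWalk.cons {p : List (ℚ × ℚ × ℚ)} {a b : ℚ} (h : IsWalk p a b) (J w : ℚ) :
    IsWalk ((J, b, w) :: p) a w := by
  simp only [IsWalk, List.map_cons, List.cons_append, List.cons.injEq, true_and]
  exact h

theorem isWalk_cons {q : ℚ × ℚ × ℚ} {p : List (ℚ × ℚ × ℚ)} {a b : ℚ} :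
    IsWalk (q :: p) a b ↔ b = q.2.2 ∧ IsWalk p a q.2.1 := by
  simp only [IsWalk, List.map_cons, List.cons_append, List.cons.injEq]

/-- As the latest edges come first, the cut is made behind the latest edge that leaves `w`. With a
new edge back to `w`, what remains is a closed walk. -/
theorem IsWalk.takeUpTo {p : List (ℚ × ℚ × ℚ)} {a b w : ℚ} (h : IsWalk p a b)
    (hw : ∃ q ∈ p, q.2.1 = w) : IsWalk (takeUpTo (fun e => decide (e.2.1 = w)) p) w b := by
  induction p generalizing b with
  | nil => simp at hw
  | cons q p ih =>
    rw [isWalk_cons] at h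
    rw [Prog.takeUpTo]
    split_ifs with hq
    · simp only [decide_eq_true_eq] at hq
      simp [IsWalk, h.1, hq]
    · simp only [decide_eq_true_eq] at hq
      exact isWalk_cons.2 ⟨h.1, ih h.2 (by simpa [hq] using hw)⟩

theorem takeUpTo_sublist {α : Type*} (f : α → Bool) (l : List α) :
    (takeUpTo f l).Sublist l := by
  induction l with
  | nil => exact List.Sublist.refl _
  | cons x l ih =>
    rw [takeUpTo]
    split_ifs
    · simp
    · exact ih.cons_cons x

/-- The latest edge `e` of color `J` is dropped together with all earlier ones, so the remaining
walk starts at the end of `e`. The edge that closes it again has color `J`, in place of `e`. -/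
theorem IsWalk.takeWhile {p : List (ℚ × ℚ × ℚ)} {a b J : ℚ} (h : IsWalk p a b)
    {e : ℚ × ℚ × ℚ} {l : List (ℚ × ℚ × ℚ)} (he : p.filter (fun e => decide (e.1 = J)) = e :: l) :
    IsWalk (p.takeWhile fun e => !decide (e.1 = J)) e.2.2 b := by
  induction p generalizing b with
  | nil => simp at he
  | cons q p ih =>
    rw [isWalk_cons] at h
    rw [List.takeWhile_cons]
    by_cases hq : q.1 = J
    · rw [List.filter_cons_of_pos (by simpa using hq)] at he
      obtain ⟨rfl, -⟩ := List.cons.inj he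
      simp [hq, IsWalk, h.1]
    · rw [List.filter_cons_of_neg (by simpa using hq)] at he
      simp only [hq, decide_false, Bool.not_false, if_true]
      exact isWalk_cons.2 ⟨h.1, ih h.2 he⟩

/-- A list of couples along which the values of the fractional variables `fs` can be shifted. -/
structure Shiftable (fs : List (ℚ × ℚ)) (p : List (ℚ × ℚ × ℚ)) : Prop where
  ne_nil : p ≠ []
  nodup : (p.map fun q => q.1).Nodup
  mem : ∀ q ∈ p, (q.1, q.2.1) ∈ fs ∧ (q.1, q.2.2) ∈ fs ∧ q.2.1 ≠ q.2.2
  balance : ∀ j, (p.map fun q => q.2.1).count j = (p.map fun q => q.2.2).count j ∨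
    fs.countP (fun f => decide (f.2 = j)) ≤ 1

/-- The invariant of the walk. -/
structure WalkInv (fs : List (ℚ × ℚ)) (s : Bool × List (ℚ × ℚ × ℚ) × ℚ × ℚ) : Prop where
  done : s.1 = true → Shiftable fs s.2.1
  walk : s.1 = false → IsWalk s.2.1 (walkStart fs) s.2.2.1
  nodup : s.1 = false → (s.2.1.map fun q => q.1).Nodup
  mem : s.1 = false → ∀ q ∈ s.2.1, (q.1, q.2.1) ∈ fs ∧ (q.1, q.2.2) ∈ fs ∧ q.2.1 ≠ q.2.2
  balls : s.1 = false → (s.2.2.1 :: s.2.1.map fun q => q.2.1).Nodup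
  color : s.1 = false → (s.2.1.map fun q => q.1).headD (-1) = s.2.2.2
  current : s.1 = false → ∃ f ∈ fs, f.2 = s.2.2.1

/-- For a closed walk, the two sides of the list equation `IsWalk` have the same extra entry `b`.
Counting `j` on both sides shows that a ball is left as often as it is entered. -/
theorem shiftable_of_cycle {fs : List (ℚ × ℚ)} {p : List (ℚ × ℚ × ℚ)} {b : ℚ} (h0 : p ≠ [])
    (h1 : (p.map fun q => q.1).Nodup)
    (h2 : ∀ q ∈ p, (q.1, q.2.1) ∈ fs ∧ (q.1, q.2.2) ∈ fs ∧ q.2.1 ≠ q.2.2)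
    (h3 : IsWalk p b b) : Shiftable fs p := by
  refine ⟨h0, h1, h2, fun j => .inl ?_⟩
  have := congrArg (List.count j) h3
  rw [List.count_append, List.count_cons, List.count_cons, List.count_nil] at this
  omega

/-- The current ball and the starting points of the edges are distinct balls with fractional
variables, one more than there are edges. This bounds the number of rounds of the search. -/
theorem WalkInv.length_lt {fs : List (ℚ × ℚ)} {s : Bool × List (ℚ × ℚ × ℚ) × ℚ × ℚ} {k : ℕ}
    (h : WalkInv fs s) (hs : s.1 = false) (hk : ((fs.map fun f => f.2).toFinset).card ≤ k) :
    s.2.1.length < k := by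
  have : (s.2.2.1 :: s.2.1.map fun q => q.2.1).toFinset ⊆ (fs.map fun f => f.2).toFinset := by
    intro j hj
    simp only [List.toFinset_cons, Finset.mem_insert, List.mem_toFinset, List.mem_map] at hj ⊢
    rcases hj with rfl | ⟨q, hq, rfl⟩
    · exact h.current hs
    · exact ⟨_, (h.mem hs q hq).1, rfl⟩
  have := Finset.card_le_card this
  rw [List.toFinset_card_of_nodup (h.balls hs)] at this
  simp only [List.length_cons, List.length_map] at this
  omega

theorem walkStart_mem {fs : List (ℚ × ℚ)} (h : fs ≠ []) : ∃ f ∈ fs, f.2 = walkStart fs := by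
  unfold walkStart
  rcases hl : fs.filter (fun f => decide ((fs.countP fun g => decide (g.2 = f.2) : ℚ) = 1)) with
    _ | ⟨f, l⟩
  · rcases fs with _ | ⟨f, fs⟩
    · exact absurd rfl h
    · rw [hl]; exact ⟨f, by simp, rfl⟩
  · rw [hl]; exact ⟨f, (List.mem_filter.1 (hl ▸ List.mem_cons_self : f ∈ fs.filter _)).1, rfl⟩

/-- The start prefers balls with a single fractional variable. So if the walk gets stuck at such a
ball, its other end is of the same kind. -/
theorem walkStart_count {fs : List (ℚ × ℚ)} {f : ℚ × ℚ} (hf : f ∈ fs)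
    (h : fs.countP (fun g => decide (g.2 = f.2)) = 1) :
    fs.countP (fun g => decide (g.2 = walkStart fs)) = 1 := by
  unfold walkStart
  rcases hl : fs.filter (fun f => decide ((fs.countP fun g => decide (g.2 = f.2) : ℚ) = 1)) with
    _ | ⟨f', l⟩
  · have := List.filter_eq_nil_iff.1 hl f hf
    simp [h] at this
  · have := (List.mem_filter.1 (hl ▸ List.mem_cons_self : f' ∈ fs.filter _)).2
    rw [hl]
    simpa using this

/-- Hypothesis `h1` makes `-1` a valid mark for "not reached through any region", and `h2` says that
a region with a fractional variable has a second one, so that the default of `headD` is never taken.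
-/
theorem walkStep_spec {fs : List (ℚ × ℚ)} (hn : fs.Nodup) (h1 : ∀ f ∈ fs, f.1 ≠ -1)
    (h2 : ∀ f ∈ fs, ∃ g ∈ fs, g.1 = f.1 ∧ g.2 ≠ f.2)
    (s : Bool × List (ℚ × ℚ × ℚ) × ℚ × ℚ) (h : WalkInv fs s) (hs : s.1 = false) :
    WalkInv fs (walkStep fs s) ∧
      ((walkStep fs s).1 = true ∨ (walkStep fs s).2.1.length = s.2.1.length + 1) := by
  obtain ⟨flag, p, v, J₀⟩ := s
  obtain rfl : flag = false := hs
  have hw := h.walk rfl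
  have hnd := h.nodup rfl
  have hm := h.mem rfl
  have hb := h.balls rfl
  have hc := h.color rfl
  have hv := h.current rfl
  simp only at hw hnd hm hb hc hv
  have ofDone : ∀ s' : Bool × List (ℚ × ℚ × ℚ) × ℚ × ℚ, s'.1 = true → Shiftable fs s'.2.1 →
      WalkInv fs s' ∧ (s'.1 = true ∨ s'.2.1.length = p.length + 1) := by
    intro s' h' hg
    refine ⟨⟨fun _ => hg, ?_, ?_, ?_, ?_, ?_, ?_⟩, .inl h'⟩ <;> simp [h']
  simp only [walkStep]
  rcases hf : fs.filter (fun f => decide (f.2 = v) && !decide (f.1 = J₀)) with _ | ⟨f, l⟩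
  · rw [hf, caseList_nil]
    refine ofDone _ rfl ?_
    rw [List.filter_eq_nil_iff] at hf
    simp only [Bool.and_eq_true, decide_eq_true_eq, Bool.not_eq_true', decide_eq_false_iff_not,
      not_and, not_not] at hf
    -- All fractional variables of the ball `v` belong to the region `J₀` through which it was
    -- reached, and a region and a ball determine the variable.
    have hcount : fs.countP (fun g => decide (g.2 = v)) ≤ 1 := by
      refine le_trans (le_of_eq ?_) (List.nodup_iff_count_le_one.1 hn (J₀, v))
      rw [List.count]
      refine List.countP_congr fun g hg => ?_
      simp only [decide_eq_true_eq, beq_iff_eq]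
      exact ⟨fun h => Prod.ext (hf g hg h) h, fun h => by rw [h]⟩
    have hcount' : fs.countP (fun g => decide (g.2 = v)) = 1 := by
      have : 0 < fs.countP (fun g => decide (g.2 = v)) := by
        rw [List.countP_pos_iff]; simpa using hv
      omega
    refine ⟨?_, hnd, hm, fun j => ?_⟩
    -- With an empty path the region `J₀` would be `-1`, but the ball `v` has a fractional variable,
    -- and its region would have to be `J₀`.
    · rintro rfl
      obtain ⟨f, hf', hfv⟩ := hv
      exact h1 f hf' ((hf f hf' hfv).trans hc.symm)
    -- Both ends of the path have a single fractional variable. At all other balls the list equation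
    -- of the walk gives the balance.
    · by_cases hjv : j = v
      · exact .inr (hjv ▸ hcount)
      · by_cases hjs : j = walkStart fs
        · obtain ⟨f, hf', rfl⟩ := hv
          exact .inr (hjs ▸ (walkStart_count hf' hcount').le)
        · left
          have := congrArg (List.count j) hw
          rw [List.count_append, List.count_cons_of_ne (Ne.symm hjv),
            List.count_cons_of_ne (Ne.symm hjs)] at this
          simpa using this
  rw [hf, caseList_cons]
  obtain ⟨hff, hf'⟩ := List.mem_filter.1 (hf ▸ List.mem_cons_self : f ∈ fs.filter _)
  simp only [Bool.and_eq_true, decide_eq_true_eq, Bool.not_eq_true', decide_eq_false_iff_not] at hf'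
  obtain ⟨rfl, hJ⟩ := hf'
  rcases he : p.filter (fun e => decide (e.1 = f.1)) with _ | ⟨e, l'⟩
  · rw [he, caseList_nil]
    have hJp : f.1 ∉ p.map fun q => q.1 := by
      intro hmem
      obtain ⟨q, hq, hqJ⟩ := List.mem_map.1 hmem
      have := List.filter_eq_nil_iff.1 he q hq
      simp [hqJ] at this
    obtain ⟨w, hw0⟩ : ∃ w, w = ((fs.filter fun g =>
      decide (g.1 = f.1) && !decide (g.2 = f.2)).headD f).2 := ⟨_, rfl⟩
    rw [← hw0]
    have hw1 : (f.1, w) ∈ fs ∧ f.2 ≠ w := by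
      rcases hl : fs.filter (fun g => decide (g.1 = f.1) && !decide (g.2 = f.2)) with _ | ⟨g, l⟩
      · obtain ⟨g, hg, hg'⟩ := h2 f hff
        have := List.filter_eq_nil_iff.1 hl g hg
        simp [hg'] at this
      · obtain ⟨hg, hg'⟩ := List.mem_filter.1 (hl ▸ List.mem_cons_self : g ∈ fs.filter _)
        rw [hl, List.headD_cons] at hw0
        simp only [Bool.and_eq_true, decide_eq_true_eq, Bool.not_eq_true',
          decide_eq_false_iff_not] at hg'
        rw [← hg'.1, hw0]
        exact ⟨hg, Ne.symm hg'.2⟩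
    split_ifs with ha
    · refine ofDone _ rfl ?_
      simp only [List.any_eq_true, decide_eq_true_eq] at ha
      have hsub := takeUpTo_sublist (fun e : ℚ × ℚ × ℚ => decide (e.2.1 = w)) p
      refine shiftable_of_cycle (by simp) ?_ ?_ ((hw.takeUpTo ha).cons _ _)
      · rw [List.map_cons, List.nodup_cons]
        exact ⟨fun h => hJp ((hsub.map _).subset h), hnd.sublist (hsub.map _)⟩
      · intro q hq
        rcases List.mem_cons.1 hq with rfl | hq
        · exact ⟨hff, hw1⟩
        · exact hm q (hsub.subset hq)
    · simp only [List.any_eq_true, decide_eq_true_eq] at ha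
      refine ⟨⟨by simp, fun _ => hw.cons _ _, fun _ => ?_, fun _ => ?_, fun _ => ?_, fun _ => rfl,
        fun _ => ⟨_, hw1.1, rfl⟩⟩, .inr (by simp)⟩
      · rw [List.map_cons, List.nodup_cons]
        exact ⟨hJp, hnd⟩
      · intro q hq
        rcases List.mem_cons.1 hq with rfl | hq
        · exact ⟨hff, hw1⟩
        · exact hm q hq
      · rw [List.map_cons, List.nodup_cons]
        refine ⟨?_, hb⟩
        intro hmem
        rcases List.mem_cons.1 hmem with hmem | hmem
        · exact hw1.2 hmem.symm
        · exact ha (by simpa using hmem)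
  · rw [he, caseList_cons]
    refine ofDone _ rfl ?_
    have hsub := List.takeWhile_sublist (l := p) (fun e : ℚ × ℚ × ℚ => !decide (e.1 = f.1))
    obtain ⟨hep, hej⟩ := List.mem_filter.1 (he ▸ List.mem_cons_self : e ∈ p.filter _)
    simp only [decide_eq_true_eq] at hej
    refine shiftable_of_cycle (by simp) ?_ ?_ ((hw.takeWhile he).cons _ _)
    · rw [List.map_cons, List.nodup_cons]
      refine ⟨?_, hnd.sublist (hsub.map _)⟩
      intro hmem
      obtain ⟨q, hq, hqJ⟩ := List.mem_map.1 hmem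
      have := List.mem_takeWhile_imp hq
      simp [hqJ] at this
    · intro q hq
      rcases List.mem_cons.1 hq with rfl | hq
      · refine ⟨hff, hej ▸ (hm e hep).2.1, ?_⟩
        simp only
        intro heq
        -- The closing edge is not a loop: `e` is not the latest edge, whose color is `J₀`, so the
        -- end of `e` is the start of a later edge and thus differs from the current ball.
        rcases p with _ | ⟨q, p⟩
        · simp at hep
        rw [isWalk_cons] at hw
        rcases List.mem_cons.1 hep with rfl | hep
        · exact hJ (hej ▸ hc)
        · have : f.2 ∈ q.2.1 :: p.map fun q => q.2.1 := by
            rw [show q.2.1 :: p.map (fun q => q.2.1) = _ from hw.2]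
            exact List.mem_append_left _ (List.mem_map.2 ⟨e, hep, heq.symm⟩)
          exact (List.nodup_cons.1 hb).1 this
      · exact hm q (hsub.subset hq)

/-- Each round ends the search or adds an edge, and an unfinished path has fewer than `k` edges, so
the limit of `k + 1` rounds is never what stops the search. -/
theorem couples_spec {fs : List (ℚ × ℚ)} (h0 : fs ≠ []) (hn : fs.Nodup) (h1 : ∀ f ∈ fs, f.1 ≠ -1)
    (h2 : ∀ f ∈ fs, ∃ g ∈ fs, g.1 = f.1 ∧ g.2 ≠ f.2) (k : ℕ)
    (hk : ((fs.map fun f => f.2).toFinset).card ≤ k) : Shiftable fs (couples k fs) := by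
  have hi : WalkInv fs (false, [], walkStart fs, -1) := by
    refine ⟨by simp, fun _ => ?_, ?_, ?_, ?_, ?_, fun _ => walkStart_mem h0⟩ <;> simp [IsWalk]
  have hstep := walkStep_spec hn h1 h2
  have hfloor : ⌊(k : ℚ) + 1⌋₊ = k + 1 := by exact_mod_cast Nat.floor_natCast (R := ℚ) (k + 1)
  rw [couples, hfloor]
  set z := loopVal (fun s : Bool × List (ℚ × ℚ × ℚ) × ℚ × ℚ => !s.1) (walkStep fs) (k + 1)
    (false, [], walkStart fs, -1) with hz
  have e1 : WalkInv fs z := loopVal_inv (WalkInv fs)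
    (fun s hs hc => (hstep s hs (by simpa using hc)).1) _ hi
  have e2 : (!z.1) = false := loopVal_end (c := fun s : Bool × List (ℚ × ℚ × ℚ) × ℚ × ℚ => !s.1)
    (f := walkStep fs) (WalkInv fs)
    (fun s => if s.1 = true then 0 else k + 1 - s.2.1.length)
    (fun s hs hc => ⟨(hstep s hs (by simpa using hc)).1, by
      have hc' : s.1 = false := by simpa using hc
      have hl := hs.length_lt hc' hk
      rcases (hstep s hs hc').2 with h' | h'
      · simp only [h', hc', if_true]; simp; omega
      · simp only [hc', h']; split_ifs <;> simp <;> omega⟩) _ hi (by simp)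
  exact e1.done (by simpa using e2)

end Couples
end Prog

namespace Prog

/-! ### Rounding of a fractional solution. -/

section Rounding

variable {ι K : Type} [LinearOrder K] (d : ι → ι → K)

/-- The list of the variables `vs` with their values. -/
def entries (vs : List (ℚ × ℚ)) (x : ℚ × ℚ → ℚ) : List (ℚ × ℚ × ℚ) :=
  vs.map fun v => (v.1, v.2, x v)

/-- Whether the variable `v` is decreased along `p`. -/
def decreased (p : List (ℚ × ℚ × ℚ)) (v : ℚ × ℚ) : Bool :=
  p.any fun q => decide (q.1 = v.1) && decide (q.2.1 = v.2)

/-- Whether the variable `v` is increased along `p`. -/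
def increased (p : List (ℚ × ℚ × ℚ)) (v : ℚ × ℚ) : Bool :=
  p.any fun q => decide (q.1 = v.1) && decide (q.2.2 = v.2)

/-- The largest shift of the variable `v` such that it does not pass an integer. -/
def slack (p : List (ℚ × ℚ × ℚ)) (x : ℚ × ℚ → ℚ) (δ : ℚ) (v : ℚ × ℚ) : ℚ :=
  if decreased p v = true then x v - ⌊x v⌋ else if increased p v = true then ⌊x v⌋ + 1 - x v else δ

def maxShift (vs : List (ℚ × ℚ)) (p : List (ℚ × ℚ × ℚ)) (x : ℚ × ℚ → ℚ) : ℚ :=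
  vs.foldl (fun δ v => if slack p x δ v ≤ δ then slack p x δ v else δ) 1

def shift (p : List (ℚ × ℚ × ℚ)) (δ : ℚ) (x : ℚ × ℚ → ℚ) (v : ℚ × ℚ) : ℚ :=
  if decreased p v = true then x v - δ else if increased p v = true then x v + δ else x v

/-- The variables with fractional values. -/
def fractional (vs : List (ℚ × ℚ)) (x : ℚ × ℚ → ℚ) : List (ℚ × ℚ) :=
  vs.filter fun v => !decide (x v = ⌊x v⌋)

/-- One round of the rounding of the values of the variables. -/
def roundStep (k : ℚ) (vs : List (ℚ × ℚ)) (x : ℚ × ℚ → ℚ) : ℚ × ℚ → ℚ :=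
  shift (couples k (fractional vs x)) (maxShift vs (couples k (fractional vs x)) x) x

/-- Transports a loop along a map of states. It replaces the lists of entries that the program
handles by functions on the variables. -/
theorem loopVal_conj {β γ : Type} {c : β → Bool} {f : β → β} {c' : γ → Bool} {f' : γ → γ}
    (g : β → γ) (hc : ∀ s, c' (g s) = c s) (hf : ∀ s, f' (g s) = g (f s)) (m : ℕ) (s : β) :
    loopVal c' f' m (g s) = g (loopVal c f m s) := by
  induction m generalizing s with
  | zero => rfl
  | succ m ih =>
    rw [loopVal, loopVal, hc, hf, ih]
    split_ifs <;> rfl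

theorem val_round (k : Tm (Ty.Val ι K) .num) (es : Tm (Ty.Val ι K) (.list Entry))
    (vs : List (ℚ × ℚ)) (x : ℚ × ℚ → ℚ) (hes : es.val d = entries vs x) :
    (round k es).val d = entries vs (loopVal (fun x => (vs.any fun v => !decide (x v = ⌊x v⌋)))
      (roundStep (k.val d) vs) vs.length x) := by
  simp only [round, val_bind', val_while', val_length, val_any, isFractional, val_not', Tm.val,
    val_findCouples, val_map, val_filter, val_foldl', isFirst, isSecond, val_and', val_hsub,
    hes]
  rw [Nat.floor_natCast, show List.length (entries vs x) = vs.length by simp [entries]]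
  refine loopVal_conj (entries vs) (fun x => ?_) (fun x => ?_) _ _
  · simp only [entries, List.any_map, Function.comp_def]
    rfl
  · simp only [entries, List.filter_map, List.map_map, Function.comp_def, List.foldl_map,
      roundStep, maxShift, shift, slack, decreased, increased, fractional, decide_eq_true_eq,
      List.map_id']
    rfl

/-- The third argument of `slack` matters only for variables that do not change. For the others it
is set to `0` here, which makes the slack independent of the progress of the fold. -/
theorem maxShift_spec (vs : List (ℚ × ℚ)) (p : List (ℚ × ℚ × ℚ)) (x : ℚ × ℚ → ℚ) :
    (∀ v ∈ vs, decreased p v = true ∨ increased p v = true → maxShift vs p x ≤ slack p x 0 v) ∧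
    (maxShift vs p x = 1 ∨ ∃ v ∈ vs, (decreased p v = true ∨ increased p v = true) ∧
      maxShift vs p x = slack p x 0 v) := by
  unfold maxShift
  induction vs using List.reverseRecOn with
  | nil => simp
  | append_singleton vs v ih =>
    rw [List.foldl_append, List.foldl_cons, List.foldl_nil]
    obtain ⟨h1, h2⟩ := ih
    set δ := List.foldl (fun δ v => if slack p x δ v ≤ δ then slack p x δ v else δ) 1 vs
    by_cases hv : decreased p v = true ∨ increased p v = true
    · have hs : slack p x δ v = slack p x 0 v := by
        simp only [slack]; split_ifs <;> simp_all
      rw [hs]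
      split_ifs with h
      · constructor
        · intro w hw hw'
          rcases List.mem_append.1 hw with hw | hw
          · exact h.trans (h1 w hw hw')
          · rw [List.mem_singleton.1 hw]
        · exact .inr ⟨v, by simp, hv, rfl⟩
      · constructor
        · intro w hw hw'
          rcases List.mem_append.1 hw with hw | hw
          · exact h1 w hw hw'
          · rw [List.mem_singleton.1 hw]; exact (not_le.1 h).le
        · rcases h2 with h2 | ⟨w, hw, h2⟩
          · exact .inl h2
          · exact .inr ⟨w, by simp [hw], h2⟩
    · have hs : slack p x δ v = δ := by
        simp only [slack]; split_ifs <;> simp_all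
      rw [hs, if_pos le_rfl]
      constructor
      · intro w hw hw'
        rcases List.mem_append.1 hw with hw | hw
        · exact h1 w hw hw'
        · rw [List.mem_singleton.1 hw] at hw'; exact absurd hw' hv
      · rcases h2 with h2 | ⟨w, hw, h2⟩
        · exact .inl h2
        · exact .inr ⟨w, by simp [hw], h2⟩

/-- The sum of the values of the variables of the region `J`. -/
def regionSum (vs : List (ℚ × ℚ)) (x : ℚ × ℚ → ℚ) (J : ℚ) : ℚ :=
  ∑ v ∈ vs.toFinset with v.1 = J, x v

/-- The sum of the values of the variables of the ball `j`. -/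
def ballSum (vs : List (ℚ × ℚ)) (x : ℚ × ℚ → ℚ) (j : ℚ) : ℚ :=
  ∑ v ∈ vs.toFinset with v.2 = j, x v

/-- The values `y` keep the sums over regions, the signs, and the integer bounds on the sums over
balls of the values `x`. -/
structure Keeps (vs : List (ℚ × ℚ)) (x y : ℚ × ℚ → ℚ) : Prop where
  region : ∀ J, regionSum vs y J = regionSum vs x J
  nonneg : ∀ v ∈ vs, 0 ≤ x v → 0 ≤ y v
  lower : ∀ j (z : ℤ), (z : ℚ) ≤ ballSum vs x j → (z : ℚ) ≤ ballSum vs y j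
  upper : ∀ j (z : ℤ), ballSum vs x j ≤ (z : ℚ) → ballSum vs y j ≤ (z : ℚ)

theorem Keeps.refl (vs : List (ℚ × ℚ)) (x : ℚ × ℚ → ℚ) : Keeps vs x x :=
  ⟨fun _ => rfl, fun _ _ h => h, fun _ _ h => h, fun _ _ h => h⟩

theorem Keeps.trans {vs : List (ℚ × ℚ)} {x y z : ℚ × ℚ → ℚ} (h : Keeps vs x y)
    (h' : Keeps vs y z) : Keeps vs x z :=
  ⟨fun J => (h'.region J).trans (h.region J), fun v hv hx => h'.nonneg v hv (h.nonneg v hv hx),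
    fun j z hz => h'.lower j z (h.lower j z hz), fun j z hz => h'.upper j z (h.upper j z hz)⟩

/-- Turns sums of multiplicities into numbers of list entries. It serves for the shifts, for the
labels, and for the solution that an assignment defines. -/
theorem sum_count {vs : List (ℚ × ℚ)} (P : ℚ × ℚ → Prop) [DecidablePred P] (A : List (ℚ × ℚ))
    (hA : ∀ v ∈ A, v ∈ vs) :
    ∑ v ∈ vs.toFinset with P v, (A.count v : ℚ) = A.countP (fun v => decide (P v)) := by
  induction A with
  | nil => simp
  | cons a A ih =>
    have : ∀ v, ((a :: A).count v : ℚ) = A.count v + if a = v then 1 else 0 := by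
      intro v
      rw [List.count_cons]
      push_cast
      simp [beq_iff_eq]
    simp only [this, Finset.sum_add_distrib, ih fun v hv => hA v (by simp [hv]), List.countP_cons,
      Finset.sum_ite_eq, Finset.mem_filter, List.mem_toFinset, hA a (by simp)]
    simp

/-- As the colors along `p` are distinct, a variable occurs in at most one couple, and there on one
side only. So the nested conditionals amount to an expression that is linear in multiplicities. -/
theorem shift_eq {fs : List (ℚ × ℚ)} {p : List (ℚ × ℚ × ℚ)} (hp : Shiftable fs p) (δ : ℚ)
    (x : ℚ × ℚ → ℚ) (v : ℚ × ℚ) :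
    shift p δ x v = x v + δ * ((p.map fun q => (q.1, q.2.2)).count v : ℚ) -
      δ * ((p.map fun q => (q.1, q.2.1)).count v : ℚ) := by
  have hA : (p.map fun q => (q.1, q.2.1)).Nodup := List.Nodup.of_map Prod.fst (by
    rw [List.map_map]; exact hp.nodup)
  have hB : (p.map fun q => (q.1, q.2.2)).Nodup := List.Nodup.of_map Prod.fst (by
    rw [List.map_map]; exact hp.nodup)
  have hA' : decreased p v = true ↔ v ∈ p.map fun q => (q.1, q.2.1) := by
    simp [decreased, Prod.ext_iff]
  have hB' : increased p v = true ↔ v ∈ p.map fun q => (q.1, q.2.2) := by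
    simp [increased, Prod.ext_iff]
  have hAB : v ∈ (p.map fun q => (q.1, q.2.1)) → v ∉ p.map fun q => (q.1, q.2.2) := by
    intro h1 h2
    obtain ⟨q, hq, rfl⟩ := List.mem_map.1 h1
    obtain ⟨q', hq', h⟩ := List.mem_map.1 h2
    simp only [Prod.mk.injEq] at h
    obtain rfl := List.inj_on_of_nodup_map hp.nodup hq' hq h.1
    exact (hp.mem _ hq).2.2 h.2.symm
  rw [shift]
  split_ifs with h1 h2
  · rw [hA'] at h1
    rw [List.count_eq_one_of_mem hA h1, List.count_eq_zero_of_not_mem (hAB h1)]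
    simp
  · rw [hB'] at h2
    rw [hA'] at h1
    rw [List.count_eq_one_of_mem hB h2, List.count_eq_zero_of_not_mem h1]
    simp
  · rw [hB'] at h2
    rw [hA'] at h1
    rw [List.count_eq_zero_of_not_mem h2, List.count_eq_zero_of_not_mem h1]
    simp

/-- Used for regions, where both variables of a couple belong to the same sum, and for balls that
are entered as often as they are left. -/
theorem sum_shift {vs fs : List (ℚ × ℚ)} {p : List (ℚ × ℚ × ℚ)} (hp : Shiftable fs p)
    (hfs : ∀ v ∈ fs, v ∈ vs) (δ : ℚ) (x : ℚ × ℚ → ℚ) (P : ℚ × ℚ → Prop) [DecidablePred P]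
    (hP : p.countP (fun q => decide (P (q.1, q.2.1))) =
      p.countP (fun q => decide (P (q.1, q.2.2)))) :
    ∑ v ∈ vs.toFinset with P v, shift p δ x v = ∑ v ∈ vs.toFinset with P v, x v := by
  simp only [shift_eq hp, Finset.sum_sub_distrib, Finset.sum_add_distrib, ← Finset.mul_sum]
  rw [sum_count P _ (fun v hv => by
    obtain ⟨q, hq, rfl⟩ := List.mem_map.1 hv; exact hfs _ (hp.mem q hq).2.1),
    sum_count P _ (fun v hv => by
    obtain ⟨q, hq, rfl⟩ := List.mem_map.1 hv; exact hfs _ (hp.mem q hq).1)]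
  rw [List.countP_map, List.countP_map]
  simp only [Function.comp_def]
  rw [hP]
  ring

theorem changed_mem {fs : List (ℚ × ℚ)} {p : List (ℚ × ℚ × ℚ)} (hp : Shiftable fs p) {v : ℚ × ℚ}
    (hv : decreased p v = true ∨ increased p v = true) : v ∈ fs := by
  simp only [decreased, increased, List.any_eq_true, Bool.and_eq_true, decide_eq_true_eq] at hv
  rcases hv with ⟨q, hq, h1, h2⟩ | ⟨q, hq, h1, h2⟩
  · rw [show v = (q.1, q.2.1) from Prod.ext h1.symm h2.symm]; exact (hp.mem q hq).1
  · rw [show v = (q.1, q.2.2) from Prod.ext h1.symm h2.symm]; exact (hp.mem q hq).2.1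

theorem mem_fractional {vs : List (ℚ × ℚ)} {x : ℚ × ℚ → ℚ} {v : ℚ × ℚ} :
    v ∈ fractional vs x ↔ v ∈ vs ∧ x v ≠ ⌊x v⌋ := by
  simp [fractional]

/-- A shift by the largest possible amount makes some fractional value an integer. -/
theorem shift_maxShift {vs : List (ℚ × ℚ)} {p : List (ℚ × ℚ × ℚ)} {x : ℚ × ℚ → ℚ}
    (hp : Shiftable (fractional vs x) p) :
    Keeps vs x (shift p (maxShift vs p x) x) ∧
      ((fractional vs (shift p (maxShift vs p x) x)).toFinset ⊂ (fractional vs x).toFinset) := by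
  obtain ⟨h1, h2⟩ := maxShift_spec vs p x
  set δ := maxShift vs p x
  have hfs : ∀ v ∈ fractional vs x, v ∈ vs := fun v hv => (mem_fractional.1 hv).1
  have hslack : ∀ v, decreased p v = true ∨ increased p v = true →
      0 < slack p x 0 v ∧ slack p x 0 v < 1 := by
    intro v hv
    have h := (mem_fractional.1 (changed_mem hp hv)).2
    have h3 := lt_of_le_of_ne (Int.floor_le (x v)) (Ne.symm h)
    have h4 := Int.lt_floor_add_one (x v)
    simp only [slack]
    split_ifs with h5 h6
    · constructor <;> linarith
    · constructor <;> linarith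
    · simp_all
  -- The start value `1` of the minimum is never the result: the path is not empty, and a fractional
  -- value is less than `1` away from both of its neighboring integers.
  obtain ⟨w, hw, hw', hδ⟩ : ∃ v ∈ vs, (decreased p v = true ∨ increased p v = true) ∧
      δ = slack p x 0 v := by
    rcases h2 with h2 | h2
    · obtain ⟨q, hq⟩ := List.exists_mem_of_ne_nil _ hp.ne_nil
      have hq' : decreased p (q.1, q.2.1) = true := by
        simp only [decreased, List.any_eq_true, Bool.and_eq_true, decide_eq_true_eq]
        exact ⟨q, hq, rfl, rfl⟩
      have := h1 _ (hfs _ (hp.mem q hq).1) (.inl hq')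
      have := (hslack _ (.inl hq')).2
      linarith
    · exact h2
  have hδ0 : 0 < δ := hδ ▸ (hslack w hw').1
  have hbounds : ∀ v ∈ vs, (⌊x v⌋ : ℚ) ≤ shift p δ x v ∧
      (decreased p v = true ∨ increased p v = true → shift p δ x v ≤ ⌊x v⌋ + 1) := by
    intro v hv
    have h3 := Int.floor_le (x v)
    have h4 := Int.lt_floor_add_one (x v)
    have h5 := h1 v hv
    simp only [slack, shift] at h5 ⊢
    split_ifs at h5 ⊢ with h6 h7
    · have := h5 (.inl h6)
      constructor
      · linarith
      · intro; linarith
    · have := h5 (.inr h7)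
      constructor
      · linarith
      · intro; linarith
    · exact ⟨h3, by simp [h6, h7]⟩
  have hsame : ∀ v, v ∉ fractional vs x → shift p δ x v = x v := by
    intro v hv
    have h3 : ¬ decreased p v = true := fun h => hv (changed_mem hp (.inl h))
    have h4 : ¬ increased p v = true := fun h => hv (changed_mem hp (.inr h))
    rw [shift, if_neg h3, if_neg h4]
  -- A ball whose sum may change has a single fractional variable `v`; its other variables are
  -- integers with sum `N`, and they do not move. So the ball sum moves like `v`, which passes no
  -- integer.
  have hball : ∀ j, ballSum vs (shift p δ x) j = ballSum vs x j ∨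
      ∃ v ∈ vs, ∃ N : ℤ, (decreased p v = true ∨ increased p v = true) ∧
        ballSum vs (shift p δ x) j = shift p δ x v + N ∧ ballSum vs x j = x v + N := by
    intro j
    rcases hp.balance j with h | h
    · left
      refine sum_shift hp hfs δ x (fun v => v.2 = j) ?_
      simp only [List.count_eq_countP, List.countP_map] at h
      refine Eq.trans ?_ (h.trans ?_) <;> exact List.countP_congr (by simp)
    · by_cases hch : ∃ v ∈ vs, v.2 = j ∧ (decreased p v = true ∨ increased p v = true)
      · obtain ⟨v, hv, hvj, hv'⟩ := hch
        right
        have hother : ∀ u ∈ vs, u.2 = j → u ≠ v → u ∉ fractional vs x := by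
          intro u hu huj huv huf
          have hsub : [u, v].Subperm ((fractional vs x).filter fun f => decide (f.2 = j)) := by
            refine List.subperm_of_subset (by simp [huv]) ?_
            intro t ht
            simp only [List.mem_cons, List.not_mem_nil, or_false] at ht
            rcases ht with rfl | rfl
            · simp [huf, huj]
            · simp [changed_mem hp hv', hvj]
          have := hsub.length_le
          rw [← List.countP_eq_length_filter] at this
          simp at this
          omega
        have hmem : v ∈ vs.toFinset.filter (fun u => u.2 = j) := by simp [hv, hvj]
        refine ⟨v, hv, ∑ u ∈ (vs.toFinset.filter (fun u => u.2 = j)).erase v, ⌊x u⌋, hv', ?_, ?_⟩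
        · rw [ballSum, ← Finset.add_sum_erase _ _ hmem]
          push_cast
          congr 1
          refine Finset.sum_congr rfl fun u hu => ?_
          simp only [Finset.mem_erase, Finset.mem_filter, List.mem_toFinset] at hu
          have h3 := hother u hu.2.1 hu.2.2 hu.1
          rw [hsame u h3]
          by_contra h4
          exact h3 (mem_fractional.2 ⟨hu.2.1, h4⟩)
        · rw [ballSum, ← Finset.add_sum_erase _ _ hmem]
          push_cast
          congr 1
          refine Finset.sum_congr rfl fun u hu => ?_
          simp only [Finset.mem_erase, Finset.mem_filter, List.mem_toFinset] at hu
          have h3 := hother u hu.2.1 hu.2.2 hu.1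
          by_contra h4
          exact h3 (mem_fractional.2 ⟨hu.2.1, h4⟩)
      · left
        push Not at hch
        refine Finset.sum_congr rfl fun u hu => ?_
        simp only [Finset.mem_filter, List.mem_toFinset] at hu
        obtain ⟨h3, h4⟩ := hch u hu.1 hu.2
        simp [shift, h3, h4]
  refine ⟨⟨fun J => ?_, fun v hv h => ?_, fun j z hz => ?_, fun j z hz => ?_⟩, ?_⟩
  · exact sum_shift hp hfs δ x (fun v => v.1 = J) rfl
  · refine le_trans ?_ (hbounds v hv).1
    exact_mod_cast Int.floor_nonneg.2 h
  · rcases hball j with h | ⟨v, hv, N, hv', h3, h4⟩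
    · rwa [h]
    · rw [h4] at hz
      rw [h3]
      have h5 : ((z - N : ℤ) : ℚ) ≤ x v := by push_cast; linarith
      have h6 : ((z - N : ℤ) : ℚ) ≤ ⌊x v⌋ := by exact_mod_cast Int.le_floor.2 h5
      have := (hbounds v hv).1
      push_cast at h6
      linarith
  · rcases hball j with h | ⟨v, hv, N, hv', h3, h4⟩
    · rwa [h]
    · rw [h4] at hz
      rw [h3]
      have h5 : x v ≤ ((z - N : ℤ) : ℚ) := by push_cast; linarith
      have hfr := (mem_fractional.1 (changed_mem hp hv')).2
      have h6 : ⌊x v⌋ < z - N := by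
        rw [Int.floor_lt]
        refine lt_of_le_of_ne h5 fun h => hfr ?_
        rw [h, Int.floor_intCast]
      have h7 : ((⌊x v⌋ + 1 : ℤ) : ℚ) ≤ ((z - N : ℤ) : ℚ) := by exact_mod_cast h6
      have := (hbounds v hv).2 hv'
      push_cast at h7
      linarith
  · rw [Finset.ssubset_iff_of_subset]
    -- The variable `w` that determines `δ` reaches an integer.
    · refine ⟨w, by simpa using changed_mem hp hw', ?_⟩
      rw [List.mem_toFinset, mem_fractional]
      rintro ⟨-, h⟩
      refine h ?_
      have : ∃ z : ℤ, shift p δ x w = z := by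
        rw [hδ]
        simp only [slack, shift]
        split_ifs with h6 h7
        · exact ⟨⌊x w⌋, by ring⟩
        · exact ⟨⌊x w⌋ + 1, by push_cast; ring⟩
        · simp_all
      obtain ⟨z, hz⟩ := this
      rw [hz, Int.floor_intCast]
    · intro v hv
      rw [List.mem_toFinset] at hv ⊢
      by_contra h
      rw [mem_fractional, hsame v h] at hv
      exact h (mem_fractional.2 hv)

/-- A region with exactly one fractional variable would have a fractional sum. This supplies the
condition of `couples_spec` that fractional variables have partners in their regions. -/
theorem roundStep_spec {vs : List (ℚ × ℚ)} {x : ℚ × ℚ → ℚ} (hn : vs.Nodup)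
    (h1 : ∀ v ∈ vs, v.1 ≠ -1) (k : ℕ) (hk : ((vs.map fun f => f.2).toFinset).card ≤ k)
    (hx : ∀ J, ∃ z : ℤ, regionSum vs x J = z) (hf : fractional vs x ≠ []) :
    Keeps vs x (roundStep k vs x) ∧
      ((fractional vs (roundStep k vs x)).toFinset ⊂ (fractional vs x).toFinset) := by
  refine shift_maxShift (couples_spec hf (hn.filter _)
    (fun f hf => h1 f (mem_fractional.1 hf).1) ?_ k (le_trans (Finset.card_le_card ?_) hk))
  · intro v hv
    obtain ⟨hv, hv'⟩ := mem_fractional.1 hv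
    by_contra! hcon
    obtain ⟨z, hz⟩ := hx v.1
    have hmem : v ∈ vs.toFinset.filter (fun u => u.1 = v.1) := by simp [hv]
    rw [regionSum, ← Finset.add_sum_erase _ _ hmem] at hz
    have : ∑ u ∈ (vs.toFinset.filter (fun u => u.1 = v.1)).erase v, x u =
        ((∑ u ∈ (vs.toFinset.filter (fun u => u.1 = v.1)).erase v, ⌊x u⌋ : ℤ) : ℚ) := by
      push_cast
      refine Finset.sum_congr rfl fun u hu => ?_
      simp only [Finset.mem_erase, Finset.mem_filter, List.mem_toFinset] at hu
      by_contra h4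
      exact hu.1 (Prod.ext hu.2.2 (hcon u (mem_fractional.2 ⟨hu.2.1, h4⟩) hu.2.2))
    rw [this, ← eq_sub_iff_add_eq, ← Int.cast_sub] at hz
    exact hv' (by rw [hz, Int.floor_intCast])
  · intro j
    simp only [List.mem_toFinset, List.mem_map]
    rintro ⟨f, hf, rfl⟩
    exact ⟨f, (mem_fractional.1 hf).1, rfl⟩

/-- The number of fractional variables drops in each round, so as many rounds as there are variables
suffice. Region sums are kept, and therefore they remain integers as the next round requires. -/
theorem round_spec {vs : List (ℚ × ℚ)} (x : ℚ × ℚ → ℚ) (hn : vs.Nodup)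
    (h1 : ∀ v ∈ vs, v.1 ≠ -1) (k : ℕ) (hk : ((vs.map fun f => f.2).toFinset).card ≤ k)
    (hx : ∀ J, ∃ z : ℤ, regionSum vs x J = z) (kt : Tm (Ty.Val ι K) .num)
    (es : Tm (Ty.Val ι K) (.list Entry)) (hkt : kt.val d = (k : ℚ)) (hes : es.val d = entries vs x) :
    ∃ y, (round kt es).val d = entries vs y ∧ Keeps vs x y ∧ ∀ v ∈ vs, ∃ z : ℤ, y v = z := by
  rw [val_round d kt es vs x hes, hkt]
  refine ⟨_, rfl, ?_⟩
  set c : (ℚ × ℚ → ℚ) → Bool := fun x => vs.any fun v => !decide (x v = ⌊x v⌋) with hc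
  have hfr : ∀ y, c y = true → fractional vs y ≠ [] := by
    intro y hy
    simp only [hc, List.any_eq_true] at hy
    obtain ⟨v, hv, hv'⟩ := hy
    exact List.ne_nil_of_mem (mem_fractional.2 ⟨hv, by simpa using hv'⟩)
  have hstep : ∀ y, Keeps vs x y → c y = true → Keeps vs x (roundStep k vs y) ∧
      (fractional vs (roundStep k vs y)).toFinset.card < (fractional vs y).toFinset.card := by
    intro y hy hc'
    obtain ⟨h2, h3⟩ := roundStep_spec hn h1 k hk
      (fun J => by rw [hy.region]; exact hx J) (hfr y hc')
    exact ⟨hy.trans h2, Finset.card_lt_card h3⟩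
  have h3 : Keeps vs x (loopVal c (roundStep k vs) vs.length x) :=
    loopVal_inv (Keeps vs x) (fun y hy hc => (hstep y hy hc).1) _ (.refl vs x)
  have h4 := loopVal_end (c := c) (f := roundStep k vs) (Keeps vs x)
    (fun y => (fractional vs y).toFinset.card) hstep vs.length (.refl vs x)
    ((List.toFinset_card_le _).trans (List.length_filter_le _ _))
  refine ⟨h3, fun v hv => ?_⟩
  have := List.any_eq_false.1 h4 v hv
  exact ⟨_, by simpa using this⟩

end Rounding
end Prog

namespace Prog

variable {ι K : Type} [LinearOrder K] (d : ι → ι → K)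

/-! ### Distribution of the points according to an integer solution. -/

section Labels

/-- The first ball (from the right) with a positive entry for the region `c`. -/
def pick (c : ℚ) (es : List (ℚ × ℚ × ℚ)) : Bool × ℚ × List (ℚ × ℚ × ℚ) :=
  es.foldr (fun e u => if (!u.1 && (decide (e.1 = c) && decide (1 ≤ e.2.2))) = true then
    (true, e.2.1, (e.1, e.2.1, e.2.2 - 1) :: u.2.2) else (u.1, u.2.1, e :: u.2.2)) (false, 0, [])

def labelList (cs : List ℚ) (es : List (ℚ × ℚ × ℚ)) : List (ℚ × ℚ × ℚ) × List ℚ :=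
  cs.foldr (fun c s => ((pick c s.1).2.2, (pick c s.1).2.1 :: s.2)) (es, [])

theorem val_labels (cs : Tm (Ty.Val ι K) (.list .num)) (es : Tm (Ty.Val ι K) (.list Entry)) :
    (labels cs es).val d = (labelList (cs.val d) (es.val d)).2 := by
  simp only [labels, Tm.val, val_foldr', val_bind', val_and', val_not', val_hsub]
  rfl

theorem pick_spec (c : ℚ) (vs : List (ℚ × ℚ)) (x : ℚ × ℚ → ℚ) (hn : vs.Nodup) :
    (∃ v ∈ vs, v.1 = c ∧ 1 ≤ x v ∧
      pick c (entries vs x) = (true, v.2, entries vs (Function.update x v (x v - 1)))) ∨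
    ((∀ v ∈ vs, v.1 = c → ¬ 1 ≤ x v) ∧ pick c (entries vs x) = (false, 0, entries vs x)) := by
  induction vs with
  | nil => right; simp [pick, entries]
  | cons w vs ih =>
    rw [List.nodup_cons] at hn
    have hcons : pick c (entries (w :: vs) x) =
        if (!(pick c (entries vs x)).1 && (decide (w.1 = c) && decide (1 ≤ x w))) = true then
          (true, w.2, (w.1, w.2, x w - 1) :: (pick c (entries vs x)).2.2)
        else ((pick c (entries vs x)).1, (pick c (entries vs x)).2.1,
          (w.1, w.2, x w) :: (pick c (entries vs x)).2.2) := rfl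
    rw [hcons]
    rcases ih hn.2 with ⟨v, hv, h1, h2, h3⟩ | ⟨h1, h2⟩
    · left
      refine ⟨v, by simp [hv], h1, h2, ?_⟩
      rw [h3]
      have : w ≠ v := fun h => hn.1 (h ▸ hv)
      simp [entries, this]
    · by_cases hw : w.1 = c ∧ 1 ≤ x w
      · left
        refine ⟨w, by simp, hw.1, hw.2, ?_⟩
        have : ∀ v ∈ vs, v ≠ w := fun v hv h => hn.1 (h ▸ hv)
        rw [h2, if_pos (by simpa using hw)]
        simp only [entries, List.map_cons, Function.update_self]
        congr 3
        refine List.map_congr_left fun v hv => ?_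
        rw [Function.update_of_ne (this v hv)]
      · right
        refine ⟨?_, ?_⟩
        · intro v hv
          rcases List.mem_cons.1 hv with rfl | hv
          · exact fun h h' => hw ⟨h, h'⟩
          · exact h1 v hv
        · rw [h2, if_neg]
          · rfl
          · simpa using hw

theorem regionSum_update {vs : List (ℚ × ℚ)} {x : ℚ × ℚ → ℚ} {v : ℚ × ℚ} (hv : v ∈ vs) (c : ℚ) :
    regionSum vs (Function.update x v (x v - 1)) c =
      regionSum vs x c - if v.1 = c then 1 else 0 := by
  have : ∀ u, Function.update x v (x v - 1) u = x u - if u = v then 1 else 0 := by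
    intro u
    by_cases h : u = v
    · subst h; simp
    · simp [h]
  simp only [regionSum, this, Finset.sum_sub_distrib]
  simp [Finset.sum_ite_eq', hv]

/-- The values `y` are what is left of `x` after the points have been served: each label takes one
unit from the variable of its region and ball. Every value splits into the rest and the number of
points that were given this variable. -/
theorem labelList_spec {vs : List (ℚ × ℚ)} (hn : vs.Nodup) (cs : List ℚ) (x : ℚ × ℚ → ℚ)
    (hx : ∀ v ∈ vs, ∃ m : ℕ, x v = m) (hc : ∀ c, (cs.count c : ℚ) ≤ regionSum vs x c) :
    ∃ y out, labelList cs (entries vs x) = (entries vs y, out) ∧ out.length = cs.length ∧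
      (∀ v ∈ vs, ∃ m : ℕ, y v = m) ∧ (∀ v ∈ vs, x v = y v + ((cs.zip out).count v : ℚ)) ∧
      (∀ c, regionSum vs x c = regionSum vs y c + (cs.count c : ℚ)) ∧
      ∀ u ∈ cs.zip out, u ∈ vs := by
  induction cs with
  | nil => exact ⟨x, [], rfl, rfl, hx, by simp, by simp, by simp⟩
  | cons c cs ih =>
    have hc' : ∀ c', (cs.count c' : ℚ) + (if c = c' then 1 else 0) ≤ regionSum vs x c' := by
      intro c'
      have := hc c'
      rw [List.count_cons] at this
      push_cast at this
      simpa [beq_iff_eq] using this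
    obtain ⟨y, out, h1, h2, h3, h4, h5, h6⟩ := ih fun c' => by
      refine le_trans ?_ (hc' c')
      split_ifs <;> simp
    rcases pick_spec c vs y hn with ⟨v, hv, hvc, hv1, hp⟩ | ⟨hno, -⟩
    · refine ⟨Function.update y v (y v - 1), v.2 :: out, ?_, by simp [h2], ?_, ?_, ?_, ?_⟩
      · rw [labelList, List.foldr_cons]
        rw [labelList] at h1
        rw [h1, hp]
      · intro u hu
        by_cases huv : u = v
        · subst huv
          obtain ⟨m, hm⟩ := h3 u hu
          rw [hm] at hv1 ⊢
          have : 1 ≤ m := by exact_mod_cast hv1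
          exact ⟨m - 1, by rw [Function.update_self]; push_cast [this]; ring⟩
        · rw [Function.update_of_ne huv]; exact h3 u hu
      · intro u hu
        rw [List.zip_cons_cons, List.count_cons, h4 u hu]
        have hvv : (c, v.2) = v := Prod.ext hvc.symm rfl
        rw [hvv]
        by_cases huv : u = v
        · subst huv; simp
        · simp [huv, Ne.symm huv]
      · intro c'
        rw [regionSum_update hv, h5 c', List.count_cons, hvc]
        push_cast
        simp only [beq_iff_eq]
        ring
      · intro u hu
        rw [List.zip_cons_cons] at hu
        rcases List.mem_cons.1 hu with rfl | hu
        · rwa [show (c, v.2) = v from Prod.ext hvc.symm rfl]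
        · exact h6 u hu
    -- If no variable of the region `c` has a unit left, then its natural values are all `0`. But
    -- the region still had room for the present point.
    · exfalso
      have h7 : regionSum vs y c ≤ 0 := by
        refine Finset.sum_nonpos fun v hv => ?_
        simp only [Finset.mem_filter, List.mem_toFinset] at hv
        obtain ⟨m, hm⟩ := h3 v hv.1
        have := hno v hv.1 hv.2
        rw [hm] at this ⊢
        have hm0 : m = 0 := by
          by_contra h
          exact this (by exact_mod_cast Nat.one_le_iff_ne_zero.2 h)
        simp [hm0]
      have h8 := hc' c
      have h9 := h5 c
      simp only [if_true] at h8
      linarith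

/-- If the points of each region are as many as its variables say, then so are the points of each
cluster. -/
theorem count_labelList {vs : List (ℚ × ℚ)} (hn : vs.Nodup) (cs : List ℚ) (x : ℚ × ℚ → ℚ)
    (hx : ∀ v ∈ vs, ∃ m : ℕ, x v = m) (hc : ∀ c, regionSum vs x c = cs.count c) :
    ∃ out, (labelList cs (entries vs x)).2 = out ∧ out.length = cs.length ∧
      (∀ j, (out.count j : ℚ) = ballSum vs x j) ∧ ∀ u ∈ cs.zip out, u ∈ vs := by
  obtain ⟨y, out, h1, h2, h3, h4, h5, h6⟩ := labelList_spec hn cs x hx fun c => (hc c).ge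
  refine ⟨out, by rw [h1], h2, fun j => ?_, h6⟩
  -- Since the counts match the region sums exactly, all units are used up in the end.
  have hy : ∀ v ∈ vs, y v = 0 := by
    intro v hv
    have h7 : regionSum vs y v.1 = 0 := by have := h5 v.1; rw [hc] at this; linarith
    refine (Finset.sum_eq_zero_iff_of_nonneg (fun u hu => ?_)).1 h7 v (by simp [hv])
    simp only [Finset.mem_filter, List.mem_toFinset] at hu
    obtain ⟨m, hm⟩ := h3 u hu.1
    rw [hm]
    positivity
  have : ballSum vs x j = ∑ v ∈ vs.toFinset with v.2 = j, ((cs.zip out).count v : ℚ) := by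
    refine Finset.sum_congr rfl fun v hv => ?_
    simp only [Finset.mem_filter, List.mem_toFinset] at hv
    rw [h4 v hv.1, hy v hv.1, zero_add]
  rw [this, sum_count _ _ h6]
  have hout : out = (cs.zip out).map Prod.snd := (List.map_snd_zip h2.le).symm
  conv_lhs => rw [hout]
  rw [List.count_eq_countP, List.countP_map]
  congr 1

end Labels

/-! ### Binary codes of the regions, variables, and tuples. -/

section Regions

/-- The positions below `k` of the digits `1` of `c`, in decreasing order. -/
def bits (k c : ℕ) : List ℚ :=
  ((List.range k).reverse.filter fun j => c.testBit j).map fun j : ℕ => (j : ℚ)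

theorem bits_succ_of_lt {j c : ℕ} (h : c < 2 ^ j) : bits (j + 1) c = bits j c := by
  simp [bits, List.range_succ, Nat.testBit_lt_two_pow h]

theorem bits_succ_add {j c : ℕ} (h : c < 2 ^ j) : bits (j + 1) (2 ^ j + c) = (j : ℚ) :: bits j c := by
  have h1 : (2 ^ j + c).testBit j = true := by
    rw [Nat.testBit_two_pow_add_eq, Nat.testBit_lt_two_pow h]; rfl
  have h2 : (List.range j).reverse.filter (fun i => (2 ^ j + c).testBit i) =
      (List.range j).reverse.filter (fun i => c.testBit i) := by
    refine List.filter_congr fun i hi => ?_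
    rw [Nat.testBit_two_pow_add_gt (by simpa using hi)]
  simp only [bits, List.range_succ, List.reverse_append, List.reverse_cons, List.reverse_nil,
    List.nil_append, List.cons_append]
  rw [List.filter_cons_of_pos h1, h2, List.map_cons]

def regionList (k : ℕ) : List (ℚ × List ℚ) := (List.range (2 ^ k)).map fun c : ℕ => ((c : ℚ), bits k c)

/-- The codes below `2 ^ (j + 1)` are those below `2 ^ j`, and the same with the digit `j` added. -/
theorem val_regions (k : Tm (Ty.Val ι K) .num) {n : ℕ} (hk : k.val d = (n : ℚ)) :
    (regions k).val d = regionList n := by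
  have h : ∀ j : ℕ, ((List.range j).map fun i : ℕ => (i : ℚ)).foldl
      (fun (s : ℚ × List (ℚ × List ℚ)) (i : ℚ) => (2 * s.1, s.2 ++ s.2.map fun e =>
        (e.1 + s.1, i :: e.2))) (1, [(0, [])]) = ((2 : ℚ) ^ j, regionList j) := by
    intro j
    induction j with
    | zero => simp [regionList, bits]
    | succ j ih =>
      rw [List.range_succ, List.map_append, List.foldl_append, ih]
      simp only [List.map_cons, List.map_nil, List.foldl_cons, List.foldl_nil, Prod.mk.injEq]
      refine ⟨by ring, ?_⟩
      simp only [regionList]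
      rw [pow_succ, mul_two, List.range_add, List.map_append, List.map_map, List.map_map]
      congr 1
      · refine List.map_congr_left fun c hc => ?_
        rw [bits_succ_of_lt (by simpa using hc)]
      · refine List.map_congr_left fun c hc => ?_
        simp only [Function.comp]
        rw [bits_succ_add (by simpa using hc)]
        push_cast
        rw [add_comm]
  simp only [regions, Tm.val, val_foldl', val_range d k n hk, val_append, val_map]
  exact congrArg Prod.snd (h n)

/-- The variables of the system. -/
def varList (k : ℕ) : List (ℚ × ℚ) :=
  (List.range (2 ^ k)).flatMap fun c : ℕ => (bits k c).map fun j => ((c : ℚ), j)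

theorem val_sysVars (regs : Tm (Ty.Val ι K) (.list (.prod .num (.list .num)))) {k : ℕ}
    (h : regs.val d = regionList k) : (sysVars regs).val d = varList k := by
  simp only [sysVars, val_flatMap, val_map, Tm.val, h, regionList, varList, List.flatMap_map]

theorem mem_varList {k : ℕ} {v : ℚ × ℚ} :
    v ∈ varList k ↔ ∃ c j : ℕ, c < 2 ^ k ∧ j < k ∧ c.testBit j = true ∧ v = ((c : ℚ), (j : ℚ)) := by
  simp only [varList, bits, List.mem_flatMap, List.mem_map, List.mem_filter, List.mem_range,
    List.mem_reverse]
  constructor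
  · rintro ⟨c, hc, _, ⟨j, ⟨hj, hcj⟩, rfl⟩, rfl⟩
    exact ⟨c, j, hc, hj, hcj, rfl⟩
  · rintro ⟨c, j, hc, hj, hcj, rfl⟩
    exact ⟨c, hc, _, ⟨j, ⟨hj, hcj⟩, rfl⟩, rfl⟩

theorem nodup_varList (k : ℕ) : (varList k).Nodup := by
  rw [varList, List.nodup_flatMap]
  constructor
  · intro c _
    refine List.Nodup.map (fun _ _ h => (Prod.mk.inj h).2) ?_
    refine List.Nodup.map Nat.cast_injective ?_
    exact (List.nodup_reverse.2 List.nodup_range).filter _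
  · refine List.Pairwise.imp ?_ List.nodup_range
    intro c c' hcc
    rw [Function.onFun, List.disjoint_left]
    rintro v hv hv'
    obtain ⟨j, -, rfl⟩ := List.mem_map.1 hv
    obtain ⟨j', -, h⟩ := List.mem_map.1 hv'
    exact hcc (by exact_mod_cast (Prod.mk.inj h).1.symm)

/-- The code of the region that contains a point with the list `row` of distances. -/
def codeOf (t : List ℚ) (r : K) (row : List K) : ℚ :=
  (t.foldl (fun (s : ℚ × ℚ) i =>
    (2 * s.1, if decide (row.getD ⌊i⌋₊ r ≤ r) = true then s.2 + s.1 else s.2)) (1, 0)).2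

theorem val_codes (T : Tm (Ty.Val ι K) (.list (.list .dst))) (t : Tm (Ty.Val ι K) (.list .num))
    (r : Tm (Ty.Val ι K) .dst) :
    (codes T t r).val d = (T.val d).map (codeOf (t.val d) (r.val d)) := by
  simp only [codes, val_map, Tm.val, val_foldl', val_nth]
  rfl

/-- The first component of the fold is the next power of two. The new digit lies above all digits
set so far, so adding it leaves these unchanged. -/
theorem codeOf_spec (t : List ℚ) (r : K) (row : List K) :
    ∃ c : ℕ, codeOf t r row = c ∧ c < 2 ^ t.length ∧
      ∀ j < t.length, c.testBit j = decide (row.getD ⌊t.getD j 0⌋₊ r ≤ r) := by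
  suffices h : ∃ c : ℕ, (t.foldl (fun (s : ℚ × ℚ) i =>
    (2 * s.1, if decide (row.getD ⌊i⌋₊ r ≤ r) = true then s.2 + s.1 else s.2)) (1, 0)) =
      ((2 : ℚ) ^ t.length, (c : ℚ)) ∧ c < 2 ^ t.length ∧
      ∀ j < t.length, c.testBit j = decide (row.getD ⌊t.getD j 0⌋₊ r ≤ r) by
    obtain ⟨c, h1, h2⟩ := h
    exact ⟨c, by rw [codeOf, h1], h2⟩
  induction t using List.reverseRecOn with
  | nil => exact ⟨0, by simp⟩
  | append_singleton t i ih =>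
    obtain ⟨c, h1, h2, h3⟩ := ih
    rw [List.foldl_append, h1]
    have hget : ∀ j < t.length, (t ++ [i]).getD j 0 = t.getD j 0 := fun j hj => by
      rw [List.getD_append _ _ _ _ hj]
    have hlast : (t ++ [i]).getD t.length 0 = i := by simp
    simp only [List.foldl_cons, List.foldl_nil, List.length_append, List.length_singleton]
    by_cases h : row.getD ⌊i⌋₊ r ≤ r
    · refine ⟨2 ^ t.length + c, ?_, by rw [pow_succ]; omega, ?_⟩
      · rw [if_pos (by simpa using h)]
        push_cast
        exact Prod.ext (by simp only; ring) (by simp only; ring)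
      · intro j hj
        rcases Nat.lt_succ_iff_lt_or_eq.1 hj with hj | rfl
        · rw [hget j hj, Nat.testBit_two_pow_add_gt hj, h3 j hj]
        · rw [hlast, Nat.testBit_two_pow_add_eq, Nat.testBit_lt_two_pow h2]
          simpa using h
    · refine ⟨c, ?_, by rw [pow_succ]; omega, ?_⟩
      · rw [if_neg (by simpa using h)]
        exact Prod.ext (by simp only; ring) rfl
      · intro j hj
        rcases Nat.lt_succ_iff_lt_or_eq.1 hj with hj | rfl
        · rw [hget j hj, h3 j hj]
        · rw [hlast, Nat.testBit_lt_two_pow h2]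
          simpa using h

theorem mem_tuples (k : Tm (Ty.Val ι K) .num) {n : ℕ} (hk : k.val d = (n : ℚ)) (t : List ℚ) :
    t ∈ (show List (List ℚ) from (tuples k).val d) ↔
      t.length = n ∧ ∀ i ∈ t, ∃ j < n, i = (j : ℕ) := by
  have h : ∀ m (t : List ℚ), t ∈ ((fun ts : List (List ℚ) => ts.flatMap fun t =>
      ((List.range n).map fun i : ℕ => (i : ℚ)).map fun j => j :: t)^[m] [[]]) ↔
      t.length = m ∧ ∀ i ∈ t, ∃ j < n, i = (j : ℕ) := by
    intro m
    induction m with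
    | zero => simp
    | succ m ih =>
      intro t
      rw [Function.iterate_succ_apply']
      simp only [List.mem_flatMap, List.mem_map, List.mem_range]
      constructor
      · rintro ⟨t, ht, _, ⟨j, hj, rfl⟩, rfl⟩
        obtain ⟨h1, h2⟩ := (ih t).1 ht
        refine ⟨by simp [h1], ?_⟩
        intro i hi
        rcases List.mem_cons.1 hi with rfl | hi
        · exact ⟨j, hj, rfl⟩
        · exact h2 i hi
      · rintro ⟨h1, h2⟩
        rcases t with _ | ⟨i, t⟩
        · simp at h1
        · obtain ⟨j, hj, rfl⟩ := h2 i (by simp)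
          exact ⟨t, (ih t).2 ⟨by simpa using h1, fun i hi => h2 i (by simp [hi])⟩, _, ⟨j, hj, rfl⟩, rfl⟩
  rw [← h n t]
  have e1 : ∀ v : ℚ, v = (n : ℚ) → (range (Tm.var (V := Ty.Val ι K) (a := .num) v)).val d =
      (List.range n).map (fun i : ℕ => (i : ℚ)) := fun v hv => val_range d _ n hv
  simp only [tuples, val_bind', val_repeat', Tm.val, val_flatMap, val_map, hk, Nat.floor_natCast]
  rw [e1 n rfl]

end Regions
end Prog

namespace Prog

variable {ι K : Type} [LinearOrder K] (d : ι → ι → K)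

/-! ### The system as inequalities on the values of the variables. -/

section System

/-- The coefficient `a` at the variables that satisfy `p`. -/
def coeff (vs : List (ℚ × ℚ)) (p : ℚ × ℚ → Bool) (a : ℚ) : List ℚ :=
  vs.map fun v => if p v = true then a else 0

def systemList (k : ℕ) (L U : ℚ) (regs : List (ℚ × List ℚ)) (vs : List (ℚ × ℚ)) (cs : List ℚ) :
    List (List ℚ × ℚ) :=
  (regs.flatMap fun e =>
    [(coeff vs (fun v => decide (v.1 = e.1)) 1, (cs.countP (fun x => decide (x = e.1)) : ℚ)),
      (coeff vs (fun v => decide (v.1 = e.1)) (-1),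
        0 - (cs.countP (fun x => decide (x = e.1)) : ℚ))]) ++
  ((((List.range k).map fun j : ℕ => (j : ℚ)).flatMap fun j =>
    [(coeff vs (fun v => decide (v.2 = j)) 1, U), (coeff vs (fun v => decide (v.2 = j)) (-1), 0 - L)])
  ++ vs.map fun w => (coeff vs (fun v => decide (v.1 = w.1) && decide (v.2 = w.2)) (-1), 0 - 0))

theorem val_system (k L U : Tm (Ty.Val ι K) .num)
    (regs : Tm (Ty.Val ι K) (.list (.prod .num (.list .num))))
    (vs : Tm (Ty.Val ι K) (.list (.prod .num .num))) (cs : Tm (Ty.Val ι K) (.list .num)) {n : ℕ}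
    (hk : k.val d = (n : ℚ)) :
    (system k L U regs vs cs).val d =
      systemList n (L.val d) (U.val d) (regs.val d) (vs.val d) (cs.val d) := by
  simp only [system, val_append, val_flatMap, val_bind', Tm.val, sumLe, leSum, val_map, val_count,
    val_and', val_hsub, val_range d k n hk, systemList, coeff]
  rfl

theorem dotProd_coeff {vs : List (ℚ × ℚ)} (hn : vs.Nodup) (p : ℚ × ℚ → Bool) (a : ℚ)
    (x : ℚ × ℚ → ℚ) :
    dotProd (coeff vs p a) (vs.map x) = a * ∑ v ∈ vs.toFinset with p v = true, x v := by
  induction vs with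
  | nil => simp [coeff]
  | cons w vs ih =>
    rw [List.nodup_cons] at hn
    have := ih hn.2
    simp only [coeff, List.map_cons, dotProd_cons, List.toFinset_cons] at this ⊢
    rw [this, Finset.filter_insert]
    split_ifs with h
    · rw [Finset.sum_insert (by simp [hn.1]), mul_add]
    · simp

/-- The values `x` solve the system of the algorithm. -/
structure Solves (k : ℕ) (L U : ℚ) (regs : List (ℚ × List ℚ)) (vs : List (ℚ × ℚ)) (cs : List ℚ)
    (x : ℚ × ℚ → ℚ) : Prop where
  region : ∀ e ∈ regs, regionSum vs x e.1 = (cs.count e.1 : ℚ)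
  lower : ∀ j < k, L ≤ ballSum vs x (j : ℕ)
  upper : ∀ j < k, ballSum vs x (j : ℕ) ≤ U
  nonneg : ∀ v ∈ vs, 0 ≤ x v

/-- Each equation is present as two opposite inequalities. As the variables are distinct, the scalar
products are sums over regions, over balls, or single values. -/
theorem holds_systemList {k : ℕ} {L U : ℚ} {regs : List (ℚ × List ℚ)} {vs : List (ℚ × ℚ)}
    {cs : List ℚ} {x : ℚ × ℚ → ℚ} (hn : vs.Nodup) :
    (∀ e ∈ systemList k L U regs vs cs, Holds (vs.map x) e) ↔ Solves k L U regs vs cs x := by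
  have hcount : ∀ c, (cs.countP (fun x => decide (x = c)) : ℚ) = cs.count c := by
    intro c
    rw [List.count_eq_countP]
    congr 1
  have h1 : ∀ J, ∑ v ∈ vs.toFinset with decide (v.1 = J) = true, x v = regionSum vs x J := by
    intro J; simp [regionSum]
  have h2 : ∀ j, ∑ v ∈ vs.toFinset with decide (v.2 = j) = true, x v = ballSum vs x j := by
    intro J; simp [ballSum]
  have h3 : ∀ w ∈ vs, ∑ v ∈ vs.toFinset with (decide (v.1 = w.1) && decide (v.2 = w.2)) = true, x v
      = x w := by
    intro w hw
    rw [show (vs.toFinset.filter fun v => (decide (v.1 = w.1) && decide (v.2 = w.2)) = true) = {w} by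
      ext v
      simp only [Finset.mem_filter, List.mem_toFinset, Bool.and_eq_true, decide_eq_true_eq,
        Finset.mem_singleton, ← Prod.ext_iff]
      exact ⟨fun h => h.2, fun h => ⟨h ▸ hw, h⟩⟩]
    simp
  simp only [systemList, List.mem_append, List.mem_flatMap, List.mem_map, List.mem_cons,
    List.not_mem_nil, or_false, Holds, hcount]
  constructor
  · intro h
    refine ⟨fun e he => le_antisymm ?_ ?_, fun j hj => ?_, fun j hj => ?_, fun v hv => ?_⟩
    · have := h _ (.inl ⟨e, he, .inl rfl⟩)
      rw [dotProd_coeff hn, h1] at this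
      linarith
    · have := h _ (.inl ⟨e, he, .inr rfl⟩)
      rw [dotProd_coeff hn, h1] at this
      simp only at this
      linarith
    · have := h _ (.inr (.inl ⟨j, ⟨j, by simpa using hj, rfl⟩, .inr rfl⟩))
      rw [dotProd_coeff hn, h2] at this
      simp only at this
      linarith
    · have := h _ (.inr (.inl ⟨j, ⟨j, by simpa using hj, rfl⟩, .inl rfl⟩))
      rw [dotProd_coeff hn, h2] at this
      linarith
    · have := h _ (.inr (.inr ⟨v, hv, rfl⟩))
      rw [dotProd_coeff hn, h3 v hv] at this
      simp only at this
      linarith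
  · rintro h _ (⟨e, he, rfl | rfl⟩ | ⟨_, ⟨j, hj, rfl⟩, rfl | rfl⟩ | ⟨v, hv, rfl⟩)
    · rw [dotProd_coeff hn, h1, h.region e he]; simp
    · rw [dotProd_coeff hn, h1, h.region e he]; simp
    · rw [dotProd_coeff hn, h2]; have := h.upper j (by simpa using hj); linarith
    · rw [dotProd_coeff hn, h2]; have := h.lower j (by simpa using hj); simp only; linarith
    · rw [dotProd_coeff hn, h3 v hv]; have := h.nonneg v hv; simp only; linarith

/-- Allows the solution list found by elimination to be treated as a function on the variables. -/
theorem exists_map_eq {vs : List (ℚ × ℚ)} (hn : vs.Nodup) (y : List ℚ)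
    (hy : y.length = vs.length) : ∃ x, y = vs.map x := by
  refine ⟨fun v => y.getD (vs.idxOf v) 0, List.ext_getElem (by simp [hy]) fun i h1 h2 => ?_⟩
  rw [List.getElem_map, hn.idxOf_getElem, List.getD_eq_getElem _ _ h1]

theorem length_systemList {k : ℕ} {L U : ℚ} {regs : List (ℚ × List ℚ)} {vs : List (ℚ × ℚ)}
    {cs : List ℚ} : ∀ e ∈ systemList k L U regs vs cs, e.1.length = vs.length := by
  simp only [systemList, List.mem_append, List.mem_flatMap, List.mem_map, List.mem_cons,
    List.not_mem_nil, or_false]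
  rintro _ (⟨e, he, rfl | rfl⟩ | ⟨_, ⟨j, hj, rfl⟩, rfl | rfl⟩ | ⟨v, hv, rfl⟩) <;> simp [coeff]

theorem hasSigns_systemList {k : ℕ} {L U : ℚ} {regs : List (ℚ × List ℚ)} {vs : List (ℚ × ℚ)}
    {cs : List ℚ} (hn : vs.Nodup) : HasSigns vs.length (systemList k L U regs vs cs) := by
  intro i hi
  refine List.mem_append_right _ (List.mem_append_right _
    (List.mem_map.2 ⟨vs[i], List.getElem_mem hi, ?_⟩))
  refine Prod.ext (List.ext_getElem (by simp [coeff]) fun j h1 h2 => ?_) (sub_zero _)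
  have hj : j < vs.length := by simpa [coeff] using h1
  simp only [coeff, List.getElem_map, List.getElem_range, Bool.and_eq_true, decide_eq_true_eq,
    ← Prod.ext_iff, hn.getElem_inj_iff]

theorem solveList_systemList {k : ℕ} {L U : ℚ} {regs : List (ℚ × List ℚ)} {vs : List (ℚ × ℚ)}
    {cs : List ℚ} (hn : vs.Nodup) :
    ((∃ x, Solves k L U regs vs cs x) →
      (solveList vs.length (systemList k L U regs vs cs)).1 = true) ∧
    ((solveList vs.length (systemList k L U regs vs cs)).1 = true → ∃ x, Solves k L U regs vs cs x ∧
      (solveList vs.length (systemList k L U regs vs cs)).2 = vs.map x) := by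
  obtain ⟨h1, h2⟩ := solveList_spec vs.length (systemList k L U regs vs cs) length_systemList
    (hasSigns_systemList hn)
  constructor
  · rintro ⟨x, hx⟩
    exact h1 (vs.map x) (by simp) ((holds_systemList hn).2 hx)
  · intro h
    obtain ⟨h3, h4⟩ := h2 h
    obtain ⟨x, hx⟩ := exists_map_eq hn _ h3
    rw [hx] at h4 ⊢
    exact ⟨x, (holds_systemList hn).1 h4, rfl⟩

end System

/-! ### Gonzalez's algorithm. -/

section Gonzalez

def farthest (s₁ : ι) (tab : List (ι × K)) : ι × K :=
  tab.foldl (fun best e => if decide (e.2 ≤ best.2) = true then best else e) (s₁, d s₁ s₁)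

def gonzalezStep (s₁ : ι) (s : List ι × List (ι × K)) : List ι × List (ι × K) :=
  (s.1 ++ [(farthest d s₁ s.2).1], s.2.map fun e =>
    (e.1, if decide (d e.1 (farthest d s₁ s.2).1 ≤ e.2) = true
      then d e.1 (farthest d s₁ s.2).1 else e.2))

theorem val_gonzalez (ps : Tm (Ty.Val ι K) (.list .pt)) (s₁ : Tm (Ty.Val ι K) .pt)
    (k : Tm (Ty.Val ι K) .num) {n : ℕ} (hk : k.val d = (n : ℚ)) (hn : 1 ≤ n) :
    (gonzalez ps s₁ k).val d = ((gonzalezStep d (s₁.val d))^[n - 1] ([s₁.val d],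
      (ps.val d).map fun p => (p, d p (s₁.val d)))).1 := by
  have : ⌊(n : ℚ) - 1⌋₊ = n - 1 := by
    rw [← Nat.cast_one, ← Nat.cast_sub hn, Nat.floor_natCast]
  simp only [gonzalez, Tm.val, val_repeat', val_map, val_bind', val_foldl', val_append,
    val_hsub, hk, this]
  rfl

/-- The fold starts with `s₁` at distance `d s₁ s₁`, which need not be an entry of the table, but
survives only if no entry is larger. -/
theorem farthest_spec (s₁ : ι) (tab : List (ι × K)) :
    (farthest d s₁ tab ∈ tab ∨ farthest d s₁ tab = (s₁, d s₁ s₁)) ∧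
      ∀ e ∈ tab, e.2 ≤ (farthest d s₁ tab).2 := by
  unfold farthest
  induction tab using List.reverseRecOn with
  | nil => simp
  | append_singleton tab e ih =>
    rw [List.foldl_append, List.foldl_cons, List.foldl_nil]
    obtain ⟨h1, h2⟩ := ih
    generalize List.foldl (fun best e : ι × K => if decide (e.2 ≤ best.2) = true then best else e)
      (s₁, d s₁ s₁) tab = b at *
    simp only [decide_eq_true_eq]
    split_ifs with h
    · refine ⟨h1.imp_left fun h => List.mem_append_left _ h, fun e' he' => ?_⟩
      rcases List.mem_append.1 he' with he' | he'
      · exact h2 e' he'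
      · rw [List.mem_singleton.1 he']; exact h
    · refine ⟨.inl (by simp), fun e' he' => ?_⟩
      rcases List.mem_append.1 he' with he' | he'
      · exact (h2 e' he').trans (not_le.1 h).le
      · rw [List.mem_singleton.1 he']

/-- After `j` steps of Gonzalez's algorithm, the selected points have distances greater than `ρ`,
or each point has distance at most `ρ` from a selected point. -/
theorem gonzalezStep_iterate (ps : List ι) (s₁ : ι) (j : ℕ) :
    ∀ S tab, (gonzalezStep d s₁)^[j] ([s₁], ps.map fun p => (p, d p s₁)) = (S, tab) →
    S.length = j + 1 ∧ tab.map Prod.fst = ps ∧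
    (∀ e ∈ tab, (∃ s ∈ S, e.2 = d e.1 s) ∧ ∀ s ∈ S, e.2 ≤ d e.1 s) ∧
    ∀ ρ, d s₁ s₁ ≤ ρ →
      S.Pairwise (fun s s' => ρ < d s' s) ∨ ∀ p ∈ ps, ∃ s ∈ S, d p s ≤ ρ := by
  induction j with
  | zero =>
    rintro S tab h
    obtain ⟨rfl, rfl⟩ := Prod.mk.inj h
    exact ⟨rfl, by simp [Function.comp_def], by simp, fun ρ _ => .inl (by simp)⟩
  | succ j ih =>
    intro S' tab' h
    rw [Function.iterate_succ_apply'] at h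
    rcases hs : (gonzalezStep d s₁)^[j] ([s₁], ps.map fun p => (p, d p s₁)) with ⟨S, tab⟩
    obtain ⟨h1, h2, h3, h4⟩ := ih S tab hs
    rw [hs] at h
    obtain ⟨f1, f2⟩ := farthest_spec d s₁ tab
    simp only [gonzalezStep] at h
    obtain ⟨rfl, rfl⟩ := Prod.mk.inj h
    set q := farthest d s₁ tab
    refine ⟨by simp [h1], by simpa [Function.comp_def] using h2, ?_, fun ρ hρ => ?_⟩
    · intro e' he'
      obtain ⟨e, he, rfl⟩ := List.mem_map.1 he'
      obtain ⟨⟨s, hs, hs'⟩, h6⟩ := h3 e he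
      simp only [decide_eq_true_eq]
      split_ifs with hle
      · refine ⟨⟨q.1, by simp, rfl⟩, fun s hs => ?_⟩
        rcases List.mem_append.1 hs with hs | hs
        · exact hle.trans (h6 s hs)
        · rw [List.mem_singleton.1 hs]
      · refine ⟨⟨s, by simp [hs], hs'⟩, fun s hs => ?_⟩
        rcases List.mem_append.1 hs with hs | hs
        · exact h6 s hs
        · rw [List.mem_singleton.1 hs]; exact (not_le.1 hle).le
    · rcases h4 ρ hρ with h4 | h4
      -- Either the largest distance to the selected points is at most `ρ`, and all points are near;
      -- or the new point is farther than `ρ` from all points selected before. The start value of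
      -- the maximum falls under the first case, as `d s₁ s₁ ≤ ρ`.
      · by_cases hq : q.2 ≤ ρ
        · right
          intro p hp
          rw [← h2] at hp
          obtain ⟨e, he, rfl⟩ := List.mem_map.1 hp
          obtain ⟨s, hs, hs'⟩ := (h3 e he).1
          exact ⟨s, by simp [hs], hs' ▸ (f2 e he).trans hq⟩
        · left
          rw [List.pairwise_append]
          refine ⟨h4, by simp, fun s hs s' hs' => ?_⟩
          rw [List.mem_singleton.1 hs']
          rcases f1 with f1 | f1
          · exact (not_le.1 hq).trans_le ((h3 q f1).2 s hs)
          · rw [f1] at hq; exact absurd hρ hq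
      · right
        intro p hp
        obtain ⟨s, hs, hs'⟩ := h4 p hp
        exact ⟨s, by simp [hs], hs'⟩

theorem gonzalez_spec (ps : Tm (Ty.Val ι K) (.list .pt)) (s₁ : Tm (Ty.Val ι K) .pt)
    (k : Tm (Ty.Val ι K) .num) {n : ℕ} (hk : k.val d = (n : ℚ)) (hn : 1 ≤ n) :
    ∃ S : List ι, (gonzalez ps s₁ k).val d = S ∧ S.length = n ∧
      ∀ ρ, d (s₁.val d) (s₁.val d) ≤ ρ → S.Pairwise (fun s s' => ρ < d s' s) ∨
        ∀ p ∈ (show List ι from ps.val d), ∃ s ∈ S, d p s ≤ ρ := by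
  rw [val_gonzalez d ps s₁ k hk hn]
  obtain ⟨h1, -, -, h4⟩ := gonzalezStep_iterate d (ps.val d) (s₁.val d) (n - 1) _ _ rfl
  exact ⟨_, rfl, by rw [h1]; omega, h4⟩

end Gonzalez

/-! ### Binary search. -/

section Search

/-- One round of the binary search, where `g` solves the system for a given radius. -/
def searchStep (R : List K) (g : K → Bool × List ℚ) (t : List ℚ)
    (s : (ℚ × ℚ) × K × List ℚ × List ℚ) : (ℚ × ℚ) × K × List ℚ × List ℚ :=
  if (g (R.getD ⌊((⌊(s.1.1 + s.1.2) / 2⌋ : ℤ) : ℚ)⌋₊ s.2.1)).1 = true then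
    ((s.1.1, ((⌊(s.1.1 + s.1.2) / 2⌋ : ℤ) : ℚ)),
      if decide (R.getD ⌊((⌊(s.1.1 + s.1.2) / 2⌋ : ℤ) : ℚ)⌋₊ s.2.1 ≤ s.2.1) = true then
        (R.getD ⌊((⌊(s.1.1 + s.1.2) / 2⌋ : ℤ) : ℚ)⌋₊ s.2.1, t,
          (g (R.getD ⌊((⌊(s.1.1 + s.1.2) / 2⌋ : ℤ) : ℚ)⌋₊ s.2.1)).2)
      else s.2)
  else ((((⌊(s.1.1 + s.1.2) / 2⌋ : ℤ) : ℚ) + 1, s.1.2), s.2)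

/-- The solution of the system for the tuple `t` and the radius `r`. -/
def solveFor (k : ℕ) (L U : ℚ) (regs : List (ℚ × List ℚ)) (vs : List (ℚ × ℚ)) (T : List (List K))
    (t : List ℚ) (r : K) : Bool × List ℚ :=
  solveList vs.length (systemList k L U regs vs (T.map (codeOf t r)))

theorem val_search (k L U : Tm (Ty.Val ι K) .num)
    (regs : Tm (Ty.Val ι K) (.list (.prod .num (.list .num))))
    (vs : Tm (Ty.Val ι K) (.list (.prod .num .num))) (T : Tm (Ty.Val ι K) (.list (.list .dst)))
    (R : Tm (Ty.Val ι K) (.list .dst)) (best : Tm (Ty.Val ι K) Record)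
    (t : Tm (Ty.Val ι K) (.list .num)) {n : ℕ} (hk : k.val d = (n : ℚ)) :
    (search k L U regs vs T R best t).val d =
      (loopVal (fun s => !decide (s.1.2 ≤ s.1.1)) (searchStep (R.val d)
        (solveFor n (L.val d) (U.val d) (regs.val d) (vs.val d) (T.val d) (t.val d)) (t.val d))
        (List.length (R.val d))
        ((0, (List.length (R.val d) : ℚ)), best.val d)).2 := by
  have hsys := fun cs => val_system d k L U regs vs cs hk
  simp only [search, val_bind', Tm.val, val_while', val_length, val_not', val_hdiv,
    val_nth, val_solve, hsys, val_codes, Nat.floor_natCast]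
  rfl

/-- The binary length of the search interval is the rank of the search. It bounds the rounds
logarithmically, both for correctness and for the running time. -/
theorem size_half_lt {m : ℕ} (hm : 0 < m) {m' : ℕ} (h : m' ≤ m / 2) : m'.size < m.size := by
  have h1 : m < 2 ^ m.size := Nat.lt_size_self m
  have h2 : 0 < m.size := Nat.size_pos.2 hm
  have h3 : m'.size ≤ m.size - 1 := by
    rw [Nat.size_le]
    have : 2 ^ m.size = 2 * 2 ^ (m.size - 1) := by
      rw [← pow_succ']; congr 1; omega
    omega
  omega

/-- The number of rounds that a binary search still needs. -/
def searchRank (s : (ℚ × ℚ) × K × List ℚ × List ℚ) : ℕ := Nat.size ⌊s.1.2 - s.1.1⌋₊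

/-- The invariant of the binary search, where `Good` are the records of feasible solutions. -/
structure SearchInv (R : List K) (g : K → Bool × List ℚ) (Good : K × List ℚ × List ℚ → Prop)
    (best₀ : K × List ℚ × List ℚ) (lo hi : ℕ) (s : (ℚ × ℚ) × K × List ℚ × List ℚ) : Prop where
  bounds : s.1 = ((lo : ℚ), (hi : ℚ))
  le : lo ≤ hi
  le_length : hi ≤ R.length
  good : Good s.2 ∨ ∀ r ∈ R, r ≤ s.2.1
  mono : s.2.1 ≤ best₀.1
  good_of : Good best₀ → Good s.2
  upper : hi < R.length → Good s.2 ∧ ∀ i, hi ≤ i → ∀ h : i < R.length, s.2.1 ≤ R[i]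
  lower : ∀ i < lo, ∃ i', i ≤ i' ∧ ∃ h : i' < R.length, (g R[i']).1 = false

/-- Monotonicity of feasibility is not used: below `lo` the invariant only knows of an infeasible
radius further up, and from `hi` on only that the best radius is not larger. -/
theorem SearchInv.step {R : List K} {g : K → Bool × List ℚ} {Good : K × List ℚ × List ℚ → Prop}
    {best₀ : K × List ℚ × List ℚ} {lo hi : ℕ} {s : (ℚ × ℚ) × K × List ℚ × List ℚ} {t : List ℚ}
    (hR : R.Pairwise (· ≤ ·)) (hg : ∀ r, (g r).1 = true → Good (r, t, (g r).2))
    (h : SearchInv R g Good best₀ lo hi s) (hlt : lo < hi) :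
    ∃ lo' hi', SearchInv R g Good best₀ lo' hi' (searchStep R g t s) ∧
      hi' - lo' ≤ (hi - lo) / 2 := by
  obtain ⟨⟨l, u⟩, best⟩ := s
  obtain ⟨rfl, rfl⟩ := Prod.mk.inj h.bounds
  have hmid : ⌊((lo : ℚ) + hi) / 2⌋ = (((lo + hi) / 2 : ℕ) : ℤ) := by
    have := Nat.floor_div_eq_div (K := ℚ) (lo + hi) 2
    rw [← this, Int.natCast_floor_eq_floor (by positivity)]
    push_cast
    rfl
  obtain ⟨m, hm⟩ : ∃ m, m = (lo + hi) / 2 := ⟨_, rfl⟩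
  have hmR : m < R.length := by have := h.le_length; omega
  have hget : R.getD m best.1 = R[m] := List.getD_eq_getElem _ _ hmR
  simp only [searchStep, hmid, ← hm, Int.cast_natCast, Nat.floor_natCast, hget, decide_eq_true_eq]
  split_ifs with h1 h2
  · refine ⟨lo, m, ⟨rfl, by omega, hmR.le, .inl (hg _ h1), h2.trans h.mono, fun _ => hg _ h1,
      fun _ => ⟨hg _ h1, fun i hi hi' => ?_⟩, h.lower⟩, by omega⟩
    exact hR.rel_get_of_le (a := ⟨m, hmR⟩) (b := ⟨i, hi'⟩) hi
  -- A feasible radius is ignored only if the best radius is smaller. Then the latter is not a bound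
  -- of all radii, as the start value is, so it comes from a solution.
  · have hgood : Good best := h.good.resolve_right fun h' => h2 (h' _ (List.getElem_mem hmR))
    refine ⟨lo, m, ⟨rfl, by omega, hmR.le, .inl hgood, h.mono, fun _ => hgood,
      fun _ => ⟨hgood, fun i hi hi' => ?_⟩, h.lower⟩, by omega⟩
    exact (not_le.1 h2).le.trans (hR.rel_get_of_le (a := ⟨m, hmR⟩) (b := ⟨i, hi'⟩) hi)
  · refine ⟨m + 1, hi, ⟨by push_cast; rfl, by omega, h.le_length, h.good, h.mono, h.good_of,
      h.upper, fun i hi => ⟨m, by omega, hmR, by simpa using h1⟩⟩, by omega⟩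

theorem SearchInv.rank {R : List K} {g : K → Bool × List ℚ} {Good : K × List ℚ × List ℚ → Prop}
    {best₀ : K × List ℚ × List ℚ} {lo hi : ℕ} {s : (ℚ × ℚ) × K × List ℚ × List ℚ}
    (h : SearchInv R g Good best₀ lo hi s) : searchRank s = (hi - lo).size := by
  rw [searchRank, h.bounds]
  simp only
  rw [← Nat.cast_sub h.le, Nat.floor_natCast]

theorem searchStep_spec {R : List K} {g : K → Bool × List ℚ} {Good : K × List ℚ × List ℚ → Prop}
    {best₀ : K × List ℚ × List ℚ} {t : List ℚ}
    (hR : R.Pairwise (· ≤ ·)) (hg : ∀ r, (g r).1 = true → Good (r, t, (g r).2))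
    (s : (ℚ × ℚ) × K × List ℚ × List ℚ) (h : ∃ lo hi, SearchInv R g Good best₀ lo hi s)
    (hs : (!decide (s.1.2 ≤ s.1.1)) = true) :
    (∃ lo hi, SearchInv R g Good best₀ lo hi (searchStep R g t s)) ∧
      searchRank (searchStep R g t s) < searchRank s := by
  obtain ⟨lo, hi, h⟩ := h
  have hlt : lo < hi := by
    rw [h.bounds] at hs
    simpa using hs
  obtain ⟨lo', hi', h', h''⟩ := h.step hR hg hlt
  exact ⟨⟨lo', hi', h'⟩, by rw [h.rank, h'.rank]; exact size_half_lt (by omega) h''⟩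

theorem SearchInv.start {R : List K} {g : K → Bool × List ℚ} {Good : K × List ℚ × List ℚ → Prop}
    {best₀ : K × List ℚ × List ℚ} (h : Good best₀ ∨ ∀ r ∈ R, r ≤ best₀.1) :
    SearchInv R g Good best₀ 0 R.length ((0, (R.length : ℚ)), best₀) :=
  ⟨by simp, by simp, le_rfl, h, le_rfl, id, fun h => absurd h (lt_irrefl _), by simp⟩

/-- If all radii from `ρ` on are feasible, then the position of `ρ` cannot be below the final `lo`,
where an infeasible radius would follow. So it is at least `hi`, and the best radius is at most `ρ`.
-/
theorem loopVal_searchStep {R : List K} {g : K → Bool × List ℚ}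
    {Good : K × List ℚ × List ℚ → Prop} {best₀ : K × List ℚ × List ℚ} {t : List ℚ}
    (hR : R.Pairwise (· ≤ ·)) (hg : ∀ r, (g r).1 = true → Good (r, t, (g r).2))
    (h : Good best₀ ∨ ∀ r ∈ R, r ≤ best₀.1) (best : K × List ℚ × List ℚ)
    (hb : best = (loopVal (fun s => !decide (s.1.2 ≤ s.1.1)) (searchStep R g t) R.length
      ((0, (R.length : ℚ)), best₀)).2) :
    (Good best ∨ ∀ r ∈ R, r ≤ best.1) ∧ best.1 ≤ best₀.1 ∧ (Good best₀ → Good best) ∧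
      ∀ ρ ∈ R, (∀ r, ρ ≤ r → (g r).1 = true) → Good best ∧ best.1 ≤ ρ := by
  set z := loopVal (fun s => !decide (s.1.2 ≤ s.1.1)) (searchStep R g t) R.length
    ((0, (R.length : ℚ)), best₀) with hz
  have hstep := searchStep_spec (best₀ := best₀) hR hg
  have h0 : ∃ lo hi, SearchInv R g Good best₀ lo hi ((0, (R.length : ℚ)), best₀) :=
    ⟨_, _, .start h⟩
  obtain ⟨lo, hi, h1⟩ : ∃ lo hi, SearchInv R g Good best₀ lo hi z :=
    loopVal_inv (fun s => ∃ lo hi, SearchInv R g Good best₀ lo hi s)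
      (fun s hs hc => (hstep s hs hc).1) _ h0
  have h2 := loopVal_end (fun s => ∃ lo hi, SearchInv R g Good best₀ lo hi s) searchRank hstep
    R.length h0 (by
      rw [(SearchInv.start (g := g) h).rank, Nat.size_le]
      exact Nat.lt_two_pow_self)
  rw [← hz, h1.bounds] at h2
  have hle : hi ≤ lo := by simpa using h2
  rw [hb]
  refine ⟨h1.good, h1.mono, h1.good_of, fun ρ hρ hf => ?_⟩
  obtain ⟨i, hi', rfl⟩ := List.getElem_of_mem hρ
  have hi2 : hi ≤ i := by
    by_contra hcon
    obtain ⟨i', h3, h4, h5⟩ := h1.lower i (by omega)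
    have h6 := hf R[i'] (hR.rel_get_of_le (a := ⟨i, hi'⟩) (b := ⟨i', h4⟩) h3)
    rw [h6] at h5
    exact absurd h5 (by simp)
  obtain ⟨h3, h4⟩ := h1.upper (by omega)
  exact ⟨h3, h4 i hi2 hi'⟩

end Search
end Prog

namespace Prog

/-! ### Solutions of the system and balanced assignments. -/

section Feasibility

variable {ι K : Type} [LinearOrder K] (d : ι → ι → K)

/-- The tuples of `k` positions below `k`. -/
def IsTuple (k : ℕ) (t : List ℚ) : Prop := t.length = k ∧ ∀ i ∈ t, ∃ j < k, i = (j : ℕ)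

/-- The point at the `j`-th position of the tuple `t` of positions in `S`. -/
def centerOf (S : List ι) (s₁ : ι) (t : List ℚ) (j : ℕ) : ι := S.getD ⌊t.getD j 0⌋₊ s₁

/-- For tuples of positions below `k` all look-ups are in range, so the default values `r`, `0` and
`s₁` play no role. -/
theorem codeOf_center {k : ℕ} {S : List ι} (hS : S.length = k) (s₁ : ι) {t : List ℚ}
    (ht : IsTuple k t) (r : K) (p : ι) :
    ∃ c : ℕ, codeOf t r (S.map (d p)) = c ∧ c < 2 ^ k ∧
      ∀ j < k, c.testBit j = decide (d p (centerOf S s₁ t j) ≤ r) := by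
  obtain ⟨c, h1, h2, h3⟩ := codeOf_spec t r (S.map (d p))
  rw [ht.1] at h2 h3
  refine ⟨c, h1, h2, fun j hj => ?_⟩
  rw [h3 j hj]
  have hj' : j < t.length := ht.1 ▸ hj
  obtain ⟨i, hi, hti⟩ := ht.2 _ (List.getElem_mem hj')
  have hi' : i < S.length := hS ▸ hi
  rw [centerOf, List.getD_eq_getElem _ _ hj', hti, Nat.floor_natCast,
    List.getD_eq_getElem _ _ hi', List.getD_eq_getElem _ _ (by simpa using hi'), List.getElem_map]

/-- The region codes of the points. -/
def pointCodes (n : ℕ) (d : Fin n → Fin n → K) (S : List (Fin n)) (t : List ℚ) (r : K) : List ℚ :=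
  ((List.finRange n).map fun p => S.map (d p)).map (codeOf t r)

/-- A balanced assignment of the points to balls that contain them gives a solution of the
system. -/
theorem solves_of_assign {n k L U : ℕ} (d : Fin n → Fin n → K) {S : List (Fin n)}
    (hS : S.length = k) (s₁ : Fin n) {t : List ℚ} (ht : IsTuple k t) {r : K} (f : Fin n → Fin k)
    (hf : ∀ p, d p (centerOf S s₁ t (f p)) ≤ r)
    (hL : ∀ j, L ≤ (Finset.univ.filter (fun i => f i = j)).card)
    (hU : ∀ j, (Finset.univ.filter (fun i => f i = j)).card ≤ U) :
    ∃ x, Solves k L U (regionList k) (varList k) (pointCodes n d S t r) x := by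
  set code : Fin n → ℚ := fun p => codeOf t r (S.map (d p)) with hcode
  -- The value of a variable is the number of points with this region and this cluster. The pairs
  -- are variables of the system because each point lies in the ball of its cluster.
  set A : List (ℚ × ℚ) := (List.finRange n).map fun p => (code p, ((f p : ℕ) : ℚ)) with hA
  have hAvs : ∀ v ∈ A, v ∈ varList k := by
    intro v hv
    obtain ⟨p, -, rfl⟩ := List.mem_map.1 hv
    obtain ⟨c, h1, h2, h3⟩ := codeOf_center d hS s₁ ht r p
    refine mem_varList.2 ⟨c, f p, h2, (f p).2, ?_, by simp [hcode, h1]⟩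
    rw [h3 _ (f p).2]
    simpa using hf p
  have hball : ∀ j : Fin k, ballSum (varList k) (fun v => (A.count v : ℚ)) (j : ℕ) =
      ((Finset.univ.filter (fun i => f i = j)).card : ℚ) := by
    intro j
    rw [ballSum, sum_count _ _ hAvs, hA, List.countP_map, List.countP_eq_length_filter,
      ← List.toFinset_card_of_nodup ((List.nodup_finRange n).filter _)]
    congr 2
    ext p
    simp [Fin.ext_iff]
  refine ⟨fun v => (A.count v : ℚ), fun e _ => ?_, fun j hj => ?_, fun j hj => ?_, fun v _ => ?_⟩
  · rw [regionSum, sum_count _ _ hAvs, hA, List.countP_map, pointCodes, List.map_map,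
      List.count_eq_countP, List.countP_map]
    congr 1
  · rw [hball ⟨j, hj⟩]; exact_mod_cast hL ⟨j, hj⟩
  · rw [hball ⟨j, hj⟩]; exact_mod_cast hU ⟨j, hj⟩
  · positivity

/-- A number that is not the code of a region has neither variables nor points, so the equations of
the system extend to all numbers. -/
theorem regionSum_eq_count {n k L U : ℕ} (d : Fin n → Fin n → K) {S : List (Fin n)}
    (hS : S.length = k) {t : List ℚ} (ht : IsTuple k t) {r : K} {x : ℚ × ℚ → ℚ}
    (hx : Solves k L U (regionList k) (varList k) (pointCodes n d S t r) x) (c : ℚ) :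
    regionSum (varList k) x c = ((pointCodes n d S t r).count c : ℚ) := by
  by_cases hc : ∃ m < 2 ^ k, c = (m : ℕ)
  · obtain ⟨m, hm, rfl⟩ := hc
    exact hx.region _ (List.mem_map.2 ⟨m, by simpa using hm, rfl⟩)
  · rw [List.count_eq_zero_of_not_mem, regionSum, Finset.sum_eq_zero]
    · simp
    · intro v hv
      simp only [Finset.mem_filter, List.mem_toFinset] at hv
      obtain ⟨m, j, hm, -, -, rfl⟩ := mem_varList.1 hv.1
      exact absurd ⟨m, hm, hv.2.symm⟩ hc
    · intro hmem
      simp only [pointCodes, List.map_map, List.mem_map] at hmem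
      obtain ⟨p, -, rfl⟩ := hmem
      obtain ⟨m, h1, h2, -⟩ := codeOf_center d hS p ht r p
      exact hc ⟨m, h2, h1⟩

/-- A solution of the system in integers gives a balanced assignment. -/
theorem assign_of_solves {n k L U : ℕ} (d : Fin n → Fin n → K) {S : List (Fin n)}
    (hS : S.length = k) (s₁ : Fin n) {t : List ℚ} (ht : IsTuple k t) {r : K} {x y : ℚ × ℚ → ℚ}
    (hx : Solves k L U (regionList k) (varList k) (pointCodes n d S t r) x)
    (hxy : Keeps (varList k) x y) (hy : ∀ v ∈ varList k, ∃ z : ℤ, y v = z) :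
    ∃ f : Fin n → Fin k, (labelList (pointCodes n d S t r) (entries (varList k) y)).2 =
        List.ofFn (fun i => ((f i : ℕ) : ℚ)) ∧
      (∀ p, d p (centerOf S s₁ t (f p)) ≤ r) ∧
      (∀ j, L ≤ (Finset.univ.filter (fun i => f i = j)).card) ∧
      (∀ j, (Finset.univ.filter (fun i => f i = j)).card ≤ U) := by
  obtain ⟨out, h1, h2, h3, h4⟩ := count_labelList (nodup_varList k) (pointCodes n d S t r) y
    (fun v hv => by
      obtain ⟨z, hz⟩ := hy v hv
      have h0 := hxy.nonneg v hv (hx.nonneg v hv)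
      rw [hz] at h0
      lift z to ℕ using by exact_mod_cast h0
      exact ⟨z, by simpa using hz⟩)
    (fun c => by rw [hxy.region, regionSum_eq_count d hS ht hx])
  have hlen : (pointCodes n d S t r).length = n := by simp [pointCodes]
  rw [hlen] at h2
  -- Code and label of a point form a variable of the system, so the label is a binary digit `1` of
  -- the code. This means that the ball contains the point.
  have hmem : ∀ i : Fin n, ∃ j : Fin k, out[i] = ((j : ℕ) : ℚ) ∧ d i (centerOf S s₁ t j) ≤ r := by
    intro i
    have hz : ((pointCodes n d S t r)[(i : ℕ)]'(by rw [hlen]; exact i.2), out[(i : ℕ)]) ∈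
        (pointCodes n d S t r).zip out := by
      have hi : (i : ℕ) < ((pointCodes n d S t r).zip out).length := by
        rw [List.length_zip, hlen, h2]; simp
      rw [← List.getElem_zip (h := hi)]
      exact List.getElem_mem hi
    obtain ⟨c, j, hc, hj, hcj, he⟩ := mem_varList.1 (h4 _ hz)
    obtain ⟨he1, he2⟩ := Prod.mk.inj he
    obtain ⟨c', g1, g2, g3⟩ := codeOf_center d hS s₁ ht r i
    have : c = c' := by
      rw [← Nat.cast_inj (R := ℚ), ← he1, ← g1]
      simp [pointCodes]
    subst this
    rw [g3 j hj] at hcj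
    exact ⟨⟨j, hj⟩, he2, by simpa using hcj⟩
  choose f hf1 hf2 using hmem
  have hout : out = List.ofFn (fun i => ((f i : ℕ) : ℚ)) := by
    refine List.ext_getElem (by simp [h2]) fun i g1 g2 => ?_
    rw [List.getElem_ofFn]
    exact hf1 ⟨i, by simpa using g2⟩
  have hcard : ∀ j : Fin k, ((Finset.univ.filter (fun i => f i = j)).card : ℚ) =
      ballSum (varList k) y (j : ℕ) := by
    intro j
    rw [← h3, hout, List.ofFn_eq_map, List.count_eq_countP, List.countP_map,
      List.countP_eq_length_filter,
      ← List.toFinset_card_of_nodup ((List.nodup_finRange n).filter _)]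
    congr 2
    ext p
    simp [Fin.ext_iff]
  refine ⟨f, by rw [h1, hout], hf2, fun j => ?_, fun j => ?_⟩
  · have := hxy.lower j L (by simpa using hx.lower j j.2)
    rw [← hcard] at this
    exact_mod_cast this
  · have := hxy.upper j U (by simpa using hx.upper j j.2)
    rw [← hcard] at this
    exact_mod_cast this

/-- The recorded radius, tuple and values belong to a solution of the system. -/
def IsRecord (n k L U : ℕ) (d : Fin n → Fin n → K) (S : List (Fin n))
    (b : K × List ℚ × List ℚ) : Prop :=
  IsTuple k b.2.1 ∧ ∃ x, Solves k L U (regionList k) (varList k) (pointCodes n d S b.2.1 b.1) x ∧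
    b.2.2 = (varList k).map x

/-- The best record after the searches for all tuples in `ts`. -/
def searchAll (n k L U : ℕ) (d : Fin n → Fin n → K) (S : List (Fin n)) (R : List K)
    (ts : List (List ℚ)) (b₀ : K × List ℚ × List ℚ) : K × List ℚ × List ℚ :=
  ts.foldl (fun best t => (loopVal (fun s => !decide (s.1.2 ≤ s.1.1))
    (searchStep R (solveFor k L U (regionList k) (varList k)
      ((List.finRange n).map fun p => S.map (d p)) t) t)
    R.length ((0, (R.length : ℚ)), best)).2) b₀

/-- Later searches keep a record valid and never increase its radius, so the result is at least as
good as the search for any single tuple. -/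
theorem searchAll_spec {n k L U : ℕ} (d : Fin n → Fin n → K) (S : List (Fin n)) {R : List K}
    (hR : R.Pairwise (· ≤ ·)) (ts : List (List ℚ)) (hts : ∀ t ∈ ts, IsTuple k t) :
    ∀ (b₀ : K × List ℚ × List ℚ), (IsRecord n k L U d S b₀ ∨ ∀ r ∈ R, r ≤ b₀.1) →
      ((searchAll n k L U d S R ts b₀).1 ≤ b₀.1 ∧
      (IsRecord n k L U d S b₀ → IsRecord n k L U d S (searchAll n k L U d S R ts b₀)) ∧
      ∀ t ∈ ts, ∀ ρ ∈ R, (∀ r, ρ ≤ r →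
          ∃ x, Solves k L U (regionList k) (varList k) (pointCodes n d S t r) x) →
        IsRecord n k L U d S (searchAll n k L U d S R ts b₀) ∧
          (searchAll n k L U d S R ts b₀).1 ≤ ρ) := by
  induction ts with
  | nil => intro b₀ _; exact ⟨le_rfl, id, by simp⟩
  | cons t ts ih =>
    intro b₀ h₀
    obtain ⟨s1, s2⟩ : (∀ r, (∃ x, Solves k L U (regionList k) (varList k)
        (pointCodes n d S t r) x) → (solveFor k L U (regionList k) (varList k)
        ((List.finRange n).map fun p => S.map (d p)) t r).1 = true) ∧
      ∀ r, (solveFor k L U (regionList k) (varList k)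
        ((List.finRange n).map fun p => S.map (d p)) t r).1 = true →
        IsRecord n k L U d S (r, t, (solveFor k L U (regionList k) (varList k)
        ((List.finRange n).map fun p => S.map (d p)) t r).2) :=
      ⟨fun r => (solveList_systemList (nodup_varList k)).1, fun r hr =>
        ⟨hts t (by simp), (solveList_systemList (nodup_varList k)).2 hr⟩⟩
    obtain ⟨h1, h2, h3, h4⟩ := loopVal_searchStep (t := t) (Good := IsRecord n k L U d S) hR s2 h₀
      _ rfl
    obtain ⟨h5, h6, h7⟩ := ih (fun t ht => hts t (by simp [ht])) _ h1
    refine ⟨h5.trans h2, fun h => h6 (h3 h), fun t' ht' ρ hρ hf => ?_⟩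
    rcases List.mem_cons.1 ht' with rfl | ht'
    · obtain ⟨h8, h9⟩ := h4 ρ hρ fun r hr => s1 r (hf r hr)
      exact ⟨h6 h8, h5.trans h9⟩
    · exact h7 t' ht' ρ hρ hf

end Feasibility

/-! ### The approximation factor. -/

section Approximation

variable {X : Type*} [MetricSpace X] {n k L U : ℕ} {P : Fin n → X}

/-- Each point is close to a selected point. -/
theorem exists_near_selected {S : List (Fin n)} (hS : S.length = k)
    (s : BalancedClustering P k L U) {r : ℝ} (hs : s.CoveredBy r)
    (hg : S.Pairwise (fun a b => 2 * r < dist (P b) (P a)) ∨ ∀ p, ∃ a ∈ S, dist (P p) (P a) ≤ 2 * r)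
    (p : Fin n) : ∃ a ∈ S, dist (P p) (P a) ≤ 2 * r := by
  rcases hg with hg | hg
  · by_contra! hcon
    have hne : ∀ a b, 2 * r < dist (P b) (P a) → s.assign a ≠ s.assign b := by
      intro a b hab he
      have h1 := hs a
      have h2 := hs b
      rw [he, dist_comm] at h1
      have := dist_triangle (P b) (s.center (s.assign b)) (P a)
      linarith
    -- Points more than `2 * r` apart lie in different clusters, so a point far from all selected
    -- ones would require `k + 1` clusters.
    have hnd : ((p :: S).map s.assign).Nodup := by
      rw [List.Nodup, List.pairwise_map, List.pairwise_cons]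
      refine ⟨fun a ha => (hne a p (hcon a ha)).symm, hg.imp fun h => hne _ _ h⟩
    have := hnd.length_le_card
    simp [hS] at this
  · exact hg p

/-- For each solution of radius `r`, some tuple of selected points can be used with the same
assignment and radius `4 * r`. -/
theorem exists_tuple {S : List (Fin n)} (hS : S.length = k) (s₁ : Fin n) (hL : 1 ≤ L)
    (s : BalancedClustering P k L U) {r : ℝ} (hs : s.CoveredBy r)
    (hg : S.Pairwise (fun a b => 2 * r < dist (P b) (P a)) ∨
      ∀ p, ∃ a ∈ S, dist (P p) (P a) ≤ 2 * r) :
    ∃ t, IsTuple k t ∧ (∀ j : Fin k, centerOf S s₁ t j ∈ S) ∧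
      ∀ p, dist (P p) (P (centerOf S s₁ t (s.assign p))) ≤ 4 * r := by
  have h1 : ∀ j : Fin k, ∃ i : Fin k, ∀ p, s.assign p = j →
      dist (P p) (P (S[(i : ℕ)]'(hS ▸ i.2))) ≤ 4 * r := by
    intro j
    obtain ⟨q, hq⟩ : ∃ q, s.assign q = j := by
      have := hL.trans (s.lower j)
      obtain ⟨q, hq⟩ := Finset.card_pos.1 (Nat.lt_of_lt_of_le Nat.zero_lt_one this)
      exact ⟨q, by simpa using hq⟩
    obtain ⟨a, ha, hqa⟩ := exists_near_selected hS s hs hg q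
    obtain ⟨i, hi, rfl⟩ := List.getElem_of_mem ha
    refine ⟨⟨i, hS ▸ hi⟩, fun p hp => ?_⟩
    have h2 := hs p
    have h3 := hs q
    rw [hp] at h2
    rw [hq, dist_comm] at h3
    -- The three distances are at most `r`, `r` and `2 * r`.
    have := dist_triangle4 (P p) (s.center j) (P q) (P S[i])
    simp only
    linarith
  choose i hi using h1
  have hc : ∀ j : Fin k, centerOf S s₁ (List.ofFn fun j => ((i j : ℕ) : ℚ)) j =
      S[((i j : Fin k) : ℕ)]'(hS ▸ (i j).2) := by
    intro j
    have hj : ((i j : Fin k) : ℕ) < S.length := hS ▸ (i j).2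
    rw [centerOf, List.getD_eq_getElem (List.ofFn fun j => ((i j : ℕ) : ℚ)) _ (by simp),
      List.getElem_ofFn, Nat.floor_natCast, List.getD_eq_getElem _ _ hj]
  refine ⟨List.ofFn fun j => ((i j : ℕ) : ℚ), ⟨by simp, ?_⟩, fun j => ?_, fun p => ?_⟩
  · intro q hq
    obtain ⟨j, rfl⟩ := (List.mem_ofFn' _ _).1 hq
    exact ⟨i j, (i j).2, rfl⟩
  · rw [hc]; exact List.getElem_mem _
  · rw [hc]; exact hi _ p rfl

/-- There are balanced assignments. -/
theorem exists_balancedClustering (P : Fin n → X) (i₀ : Fin n) (hk : 1 ≤ k)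
    (hL : L ≤ ⌊(n : ℚ) / k⌋₊) (hU : ⌈(n : ℚ) / k⌉₊ ≤ U) :
    ∃ (s : BalancedClustering P k L U) (r : ℝ), s.CoveredBy r := by
  rw [Nat.floor_div_eq_div] at hL
  -- The points are assigned by their residues modulo `k`, so that the cluster sizes are `n / k` or
  -- one more.
  have hcard : ∀ j : Fin k, (Finset.univ.filter (fun i : Fin n =>
      (⟨(i : ℕ) % k, Nat.mod_lt _ hk⟩ : Fin k) = j)).card =
      n / k + if (j : ℕ) < n % k then 1 else 0 := by
    intro j
    have := Nat.count_modEq_card n hk j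
    rw [Nat.mod_eq_of_lt j.2] at this
    rw [← this, Nat.count_eq_card_filter_range, ← Finset.card_map Fin.valEmbedding]
    congr 1
    ext a
    simp only [Finset.mem_map, Finset.mem_filter, Finset.mem_univ, true_and, Fin.valEmbedding_apply,
      Finset.mem_range, Nat.ModEq, Nat.mod_eq_of_lt j.2, Fin.ext_iff]
    constructor
    · rintro ⟨a, ha, rfl⟩; exact ⟨a.2, ha⟩
    · rintro ⟨ha, h⟩; exact ⟨⟨a, ha⟩, h, rfl⟩
  refine ⟨⟨fun _ => P i₀, fun i => ⟨(i : ℕ) % k, Nat.mod_lt _ hk⟩, fun j => ?_, fun j => ?_⟩,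
    ∑ i, dist (P i) (P i₀), fun i => ?_⟩
  · rw [hcard]; omega
  · rw [hcard]
    refine le_trans ?_ hU
    have hk' : (0 : ℚ) < k := by exact_mod_cast hk
    have hn : (n : ℚ) = k * (n / k : ℕ) + (n % k : ℕ) := by exact_mod_cast (Nat.div_add_mod n k).symm
    split_ifs with h
    · rw [Nat.succ_le_iff, Nat.lt_ceil, lt_div_iff₀ hk', hn]
      have : (0 : ℚ) < (n % k : ℕ) := by exact_mod_cast (Nat.zero_le _).trans_lt h
      linarith
    · rw [add_zero]
      have : ((n / k : ℕ) : ℚ) ≤ (n : ℚ) / k := Nat.cast_div_le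
      exact_mod_cast this.trans (Nat.le_ceil _)
  · exact Finset.single_le_sum (f := fun i => dist (P i) (P i₀)) (fun _ _ => dist_nonneg)
      (Finset.mem_univ i)

/-- The search starts with the largest radius as the best one, so that the first feasible radius is
recorded. -/
theorem le_foldl_last {K : Type} [LinearOrder K] (R : List K) (hR : R.Pairwise (· ≤ ·)) (z : K) :
    ∀ r ∈ R, r ≤ R.foldl (fun _ r => r) z := by
  induction R using List.reverseRecOn with
  | nil => simp
  | append_singleton R a ih =>
    intro r hr
    rw [List.foldl_append, List.foldl_cons, List.foldl_nil]
    rcases List.mem_append.1 hr with hr | hr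
    · exact (List.pairwise_append.1 hR).2.2 r hr a (by simp)
    · rw [List.mem_singleton.1 hr]

theorem entries_zip (vs : List (ℚ × ℚ)) (x : ℚ × ℚ → ℚ) :
    List.zipWith (fun v z => (v.1, v.2, z)) vs (vs.map x) = entries vs x := by
  induction vs with
  | nil => rfl
  | cons v vs ih => simpa [entries] using ih

theorem card_balls_le (k : ℕ) : (((varList k).map fun f => f.2).toFinset).card ≤ k := by
  have : ((varList k).map fun f => f.2).toFinset ⊆
      (Finset.range k).image fun j : ℕ => (j : ℚ) := by
    intro j
    simp only [List.mem_toFinset, List.mem_map, Finset.mem_image, Finset.mem_range]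
    rintro ⟨v, hv, rfl⟩
    obtain ⟨c, j, -, hj, -, rfl⟩ := mem_varList.1 hv
    exact ⟨j, hj, rfl⟩
  exact (Finset.card_le_card this).trans (Finset.card_image_le.trans (by simp))

/-- The interface between program and geometry: from here on only the selection `S`, the radii `R`
and the final record are needed. The distances may be any function to a linear order. -/
theorem run_spec {K : Type} [LinearOrder K] {n : ℕ} (d : Fin n → Fin n → K) (i₀ : Fin n)
    (k L U : ℕ) (hk : 1 ≤ k) :
    ∃ (S : List (Fin n)) (R : List K) (best : K × List ℚ × List ℚ),
      S.length = k ∧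
      (∀ ρ, d i₀ i₀ ≤ ρ → S.Pairwise (fun a b => ρ < d b a) ∨ ∀ p, ∃ a ∈ S, d p a ≤ ρ) ∧
      (∀ p, ∀ a ∈ S, d p a ∈ R) ∧
      (∀ t, IsTuple k t → ∀ ρ ∈ R, (∀ r, ρ ≤ r →
          ∃ x, Solves k L U (regionList k) (varList k) (pointCodes n d S t r) x) →
        IsRecord n k L U d S best ∧ best.1 ≤ ρ) ∧
      (IsRecord n k L U d S best → ∃ x y, Solves k L U (regionList k) (varList k)
          (pointCodes n d S best.2.1 best.1) x ∧ Keeps (varList k) x y ∧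
        (∀ v ∈ varList k, ∃ z : ℤ, y v = z) ∧
        (run i₀ k L U).val d = (best.2.1.map fun i => S.getD ⌊i⌋₊ i₀,
          (labelList (pointCodes n d S best.2.1 best.1) (entries (varList k) y)).2)) := by
  obtain ⟨S, hS, hSl, hSg⟩ := gonzalez_spec d (.var (List.finRange n)) (.var i₀)
    (.var ((k : ℕ) : ℚ)) (n := k) rfl hk
  have hTerm := val_sort d (flatMap (.var ((List.finRange n).map fun p => S.map (d p))) fun row => row)
  set R : List K := (sort (flatMap (.var ((List.finRange n).map fun p => S.map (d p)))
    fun row => row)).val d with hR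
  obtain ⟨hRs, hRp⟩ := hTerm
  have hts : ∀ t, t ∈ (show List (List ℚ) from (tuples (V := Ty.Val (Fin n) K)
      (.var ((k : ℕ) : ℚ))).val d) ↔ IsTuple k t :=
    mem_tuples d (.var ((k : ℕ) : ℚ)) rfl
  set ts : List (List ℚ) := (tuples (V := Ty.Val (Fin n) K) (.var ((k : ℕ) : ℚ))).val d with hts'
  set b₀ : K × List ℚ × List ℚ := (R.foldl (fun _ r => r) (d i₀ i₀), [], []) with hb₀
  obtain ⟨-, -, h3⟩ := searchAll_spec (L := L) (U := U) d S hRs ts (fun t ht => (hts t).1 ht) b₀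
    (.inr (le_foldl_last R hRs _))
  refine ⟨S, R, searchAll n k L U d S R ts b₀, hSl, fun ρ hρ => ?_, fun p a ha => ?_,
    fun t ht => h3 t ((hts t).2 ht), ?_⟩
  · simpa using hSg ρ hρ
  · refine hRp.mem_iff.2 ?_
    simp only [val_flatMap, Tm.val]
    exact List.mem_flatMap.2 ⟨_, List.mem_map.2 ⟨p, by simp, rfl⟩, List.mem_map.2 ⟨a, ha, rfl⟩⟩
  · rintro ⟨ht, x, hx, hx'⟩
    have hregs : (regions (V := Ty.Val (Fin n) K) (.var ((k : ℕ) : ℚ))).val d = regionList k :=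
      val_regions d _ rfl
    have hvs : (sysVars (V := Ty.Val (Fin n) K) (.var (regionList k))).val d = varList k :=
      val_sysVars d _ rfl
    have hsearch := fun (b : K × List ℚ × List ℚ) (t : List ℚ) => val_search d
      (.var ((k : ℕ) : ℚ)) (.var ((L : ℕ) : ℚ)) (.var ((U : ℕ) : ℚ)) (.var (regionList k))
      (.var (varList k)) (.var ((List.finRange n).map fun p => S.map (d p))) (.var R)
      (.var b) (.var t) (n := k) rfl
    have hbest : (ts.foldl (fun b t => (search (V := Ty.Val (Fin n) K)
        (.var ((k : ℕ) : ℚ)) (.var ((L : ℕ) : ℚ)) (.var ((U : ℕ) : ℚ)) (.var (regionList k))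
        (.var (varList k)) (.var ((List.finRange n).map fun p => S.map (d p))) (.var R)
        (.var b) (.var t)).val d) b₀ : K × List ℚ × List ℚ) = searchAll n k L U d S R ts b₀ := by
      simp only [hsearch]
      rfl
    simp only [run, algorithm, Tm.val, val_bind', val_map, hS, val_foldl', hregs, hvs, ← hR, ← hts']
    generalize searchAll n k L U d S R ts b₀ = best at *
    simp only [← hb₀, hbest]
    obtain ⟨y, hy, hxy, hyi⟩ := round_spec d x (nodup_varList k) (fun v hv => by
        obtain ⟨c, j, -, -, -, rfl⟩ := mem_varList.1 hv
        have : (0 : ℚ) ≤ c := c.cast_nonneg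
        simp only
        linarith) k (card_balls_le k)
      (fun J => ⟨_, by rw [regionSum_eq_count d hSl ht hx]; exact (Int.cast_natCast _).symm⟩)
      (.var ((k : ℕ) : ℚ)) (zipWith (V := Ty.Val (Fin n) K) (.var (varList k))
        ((Tm.var (V := Ty.Val (Fin n) K) (a := Record) best).snd.snd)
        fun v x => v.fst.pair (v.snd.pair x)) rfl (by
          rw [val_zipWith]
          simp only [Tm.val, hx']
          exact entries_zip _ _)
    refine ⟨x, y, hx, hxy, hyi, ?_⟩
    simp only [val_nth, val_labels, val_codes, Tm.val, hy]
    rfl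

theorem run_isApprox (P : Fin n → X) (i₀ : Fin n) (hk : 1 ≤ k) (hL : 1 ≤ L)
    (hL' : L ≤ ⌊(n : ℚ) / k⌋₊) (hU : ⌈(n : ℚ) / k⌉₊ ≤ U) :
    ∃ (c : Fin k → Fin n) (s : BalancedClustering P k L U),
      s.center = P ∘ c ∧
      (run i₀ k L U).val (fun i j => dist (P i) (P j)) =
        (List.ofFn c, List.ofFn fun i => ((s.assign i : ℕ) : ℚ)) ∧
      s.IsApprox 4 := by
  obtain ⟨S, R, best, hS, hg, hR, hrec, hrun⟩ := run_spec (fun i j => dist (P i) (P j)) i₀ k L U hk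
  have key : ∀ (s : BalancedClustering P k L U) (r : ℝ), s.CoveredBy r →
      IsRecord n k L U (fun i j => dist (P i) (P j)) S best ∧ best.1 ≤ 4 * r := by
    intro s r hs
    have hr : 0 ≤ r := dist_nonneg.trans (hs i₀)
    obtain ⟨t, ht, htS, htr⟩ := exists_tuple hS i₀ hL s hs
      (hg (2 * r) (by simp only [dist_self]; linarith))
    have : Nonempty (Fin n) := ⟨i₀⟩
    -- The threshold is the exact radius of the assignment for the tuple `t`. Unlike `4 * r`, it is
    -- an entry of `R`.
    obtain ⟨p, hp⟩ := Finite.exists_max fun p => dist (P p) (P (centerOf S i₀ t (s.assign p)))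
    obtain ⟨h1, h2⟩ := hrec t ht _ (hR p _ (htS (s.assign p))) fun r' hr' =>
      solves_of_assign (L := L) (U := U) (fun i j => dist (P i) (P j)) hS i₀ ht s.assign
        (fun q => (hp q).trans hr') s.lower s.upper
    exact ⟨h1, h2.trans (htr p)⟩
  -- One solution of any radius is enough to know that the final record belongs to a feasible
  -- system, and hence that the output is a solution.
  obtain ⟨s₀, r₀, hs₀⟩ := exists_balancedClustering (L := L) (U := U) P i₀ hk hL' hU
  have hb := (key s₀ r₀ hs₀).1
  obtain ⟨x, y, hx, hxy, hy, hval⟩ := hrun hb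
  obtain ⟨f, hf1, hf2, hf3, hf4⟩ := assign_of_solves (fun i j => dist (P i) (P j)) hS i₀ hb.1 hx hxy hy
  refine ⟨fun j => centerOf S i₀ best.2.1 j,
    ⟨fun j => P (centerOf S i₀ best.2.1 j), f, hf3, hf4⟩, rfl, ?_, fun t r ht i => ?_⟩
  · rw [hval, hf1]
    refine Prod.ext (List.ext_getElem (by simp [hb.1.1]) fun i h1 h2 => ?_) rfl
    have hi : i < best.2.1.length := by simpa using h1
    simp only [List.getElem_map, List.getElem_ofFn, centerOf]
    rw [List.getD_eq_getElem best.2.1 _ hi]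
  · exact (hf2 i).trans (key t r ht).2

end Approximation
end Prog

namespace Prog

/-! ### Cost rules for the parts whose sizes depend on `k` only. -/

section Bounds

variable {ι K : Type}

/-- The number of list cells of a value. -/
def Ty.size : (a : Ty) → Ty.Val ι K a → ℕ
  | .bool, _ => 0
  | .num, _ => 0
  | .dst, _ => 0
  | .pt, _ => 0
  | .prod a b, x => Ty.size a x.1 + Ty.size b x.2
  | .list a, l => (List.map (fun x => 1 + Ty.size a x) l).sum

theorem length_le_size {a : Ty} (l : List (a.Val ι K)) : l.length ≤ Ty.size (.list a) l := by
  induction l with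
  | nil => simp
  | cons x l ih => simp only [Ty.size, List.map_cons, List.sum_cons, List.length_cons] at ih ⊢; omega

theorem size_cons {a : Ty} (x : a.Val ι K) (l : List (a.Val ι K)) :
    Ty.size (.list a) (x :: l) = 1 + Ty.size a x + Ty.size (.list a) l := by
  simp [Ty.size]

theorem size_le_of_mem {a : Ty} {l : List (a.Val ι K)} {x : a.Val ι K} (hx : x ∈ l) :
    Ty.size a x ≤ Ty.size (.list a) l := by
  induction l with
  | nil => simp at hx
  | cons y l ih =>
    rw [size_cons]
    rcases List.mem_cons.1 hx with rfl | hx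
    · omega
    · have := ih hx; omega

variable [LinearOrder K]

/-- The steps of a term are at most `F N * (w + 1)`, and its value has size at most `F N`. Here `N`
will be a bound on the sizes of the variables. -/
structure Bd (d : ι → ι → K) (τ : ι → ι → ℕ) (w : ℕ) (F : ℕ → ℕ) (N : ℕ) {a : Ty}
    (t : Tm (Ty.Val ι K) a) : Prop where
  cost : t.cost d τ ≤ F N * (w + 1)
  size : Ty.size a (t.val d) ≤ F N

variable {d : ι → ι → K} {τ : ι → ι → ℕ} {w N : ℕ} {F G H : ℕ → ℕ} {a b c : Ty}

theorem Bd.var {x : a.Val ι K} (h : Ty.size a x ≤ N) :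
    Bd d τ w (fun N => N + 1) N (.var x) :=
  ⟨by simp only [Tm.cost]; nlinarith, by simp only [Tm.val]; omega⟩

/-- The new variable can be as large as `F N`, so the body is bounded at `N + F N`. The quantifier
over `N'` lets the rules be nested. -/
theorem Bd.letV {t : Tm (Ty.Val ι K) a} {f : a.Val ι K → Tm (Ty.Val ι K) b} (ht : Bd d τ w F N t)
    (hf : ∀ N', N ≤ N' → ∀ x, Ty.size a x ≤ N' → Bd d τ w G N' (f x)) :
    Bd d τ w (fun N => 1 + F N + G (N + F N)) N (.letV t f) := by
  have h := hf (N + F N) (by omega) (t.val d) (by have := ht.size; omega)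
  have h1 := ht.cost
  have h2 := h.cost
  have h3 := h.size
  constructor
  · simp only [Tm.cost, add_mul, one_mul]; omega
  · simp only [Tm.val]; omega

theorem Bd.boolLit (q : Bool) : Bd d τ w (fun _ => 1) N (.boolLit q) :=
  ⟨by simp only [Tm.cost]; omega, Nat.zero_le _⟩

theorem Bd.lit (q : ℚ) : Bd d τ w (fun _ => 1) N (.lit q) :=
  ⟨by simp only [Tm.cost]; omega, Nat.zero_le _⟩

theorem Bd.nil : Bd d τ w (fun _ => 1) N (.nil : Tm _ (.list a)) :=
  ⟨by simp only [Tm.cost]; omega, Nat.zero_le _⟩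

theorem Bd.ite {p : Tm (Ty.Val ι K) .bool} {s t : Tm (Ty.Val ι K) a} (hp : Bd d τ w F N p)
    (hs : Bd d τ w G N s) (ht : Bd d τ w H N t) :
    Bd d τ w (fun N => 1 + F N + G N + H N) N (.ite p s t) := by
  have h1 := hp.cost
  have h2 := hs.cost
  have h3 := ht.cost
  have h4 := hs.size
  have h5 := ht.size
  constructor
  · simp only [Tm.cost, add_mul, one_mul]; split_ifs <;> omega
  · simp only [Tm.val]; split_ifs <;> omega

theorem Bd.hadd {s t : Tm (Ty.Val ι K) .num} (hs : Bd d τ w F N s) (ht : Bd d τ w G N t) :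
    Bd d τ w (fun N => 1 + F N + G N) N (s + t) :=
  ⟨by have := hs.cost; have := ht.cost
      change 1 + _ + _ ≤ _
      simp only [add_mul, one_mul]; omega, Nat.zero_le _⟩

theorem Bd.hsub {s t : Tm (Ty.Val ι K) .num} (hs : Bd d τ w F N s) (ht : Bd d τ w G N t) :
    Bd d τ w (fun N => 1 + F N + G N) N (s - t) :=
  ⟨by have := hs.cost; have := ht.cost
      change 1 + _ + _ ≤ _
      simp only [add_mul, one_mul]; omega, Nat.zero_le _⟩

theorem Bd.hmul {s t : Tm (Ty.Val ι K) .num} (hs : Bd d τ w F N s) (ht : Bd d τ w G N t) :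
    Bd d τ w (fun N => 1 + F N + G N) N (s * t) :=
  ⟨by have := hs.cost; have := ht.cost
      change 1 + _ + _ ≤ _
      simp only [add_mul, one_mul]; omega, Nat.zero_le _⟩

theorem Bd.hdiv {s t : Tm (Ty.Val ι K) .num} (hs : Bd d τ w F N s) (ht : Bd d τ w G N t) :
    Bd d τ w (fun N => 1 + F N + G N) N (s / t) :=
  ⟨by have := hs.cost; have := ht.cost
      change 1 + _ + _ ≤ _
      simp only [add_mul, one_mul]; omega, Nat.zero_le _⟩

theorem Bd.floor {t : Tm (Ty.Val ι K) .num} (ht : Bd d τ w F N t) :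
    Bd d τ w (fun N => 1 + F N) N (.floor t) :=
  ⟨by have := ht.cost; simp only [Tm.cost, add_mul, one_mul]; omega, Nat.zero_le _⟩

theorem Bd.le {s t : Tm (Ty.Val ι K) .num} (hs : Bd d τ w F N s) (ht : Bd d τ w G N t) :
    Bd d τ w (fun N => 1 + F N + G N) N (.le s t) :=
  ⟨by have := hs.cost; have := ht.cost; simp only [Tm.cost, add_mul, one_mul]; omega, Nat.zero_le _⟩

theorem Bd.eq {s t : Tm (Ty.Val ι K) .num} (hs : Bd d τ w F N s) (ht : Bd d τ w G N t) :
    Bd d τ w (fun N => 1 + F N + G N) N (.eq s t) :=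
  ⟨by have := hs.cost; have := ht.cost; simp only [Tm.cost, add_mul, one_mul]; omega, Nat.zero_le _⟩

theorem Bd.pair {s : Tm (Ty.Val ι K) a} {t : Tm (Ty.Val ι K) b} (hs : Bd d τ w F N s)
    (ht : Bd d τ w G N t) : Bd d τ w (fun N => 1 + F N + G N) N (.pair s t) := by
  have h1 := hs.cost
  have h2 := ht.cost
  have h3 := hs.size
  have h4 := ht.size
  constructor
  · simp only [Tm.cost, add_mul, one_mul]; omega
  · simp only [Tm.val, Ty.size]; omega

theorem Bd.fst {t : Tm (Ty.Val ι K) (.prod a b)} (ht : Bd d τ w F N t) :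
    Bd d τ w (fun N => 1 + F N) N (.fst t) := by
  have h1 := ht.cost
  have h2 := ht.size
  simp only [Ty.size] at h2
  constructor
  · simp only [Tm.cost, add_mul, one_mul]; omega
  · simp only [Tm.val]; omega

theorem Bd.snd {t : Tm (Ty.Val ι K) (.prod a b)} (ht : Bd d τ w F N t) :
    Bd d τ w (fun N => 1 + F N) N (.snd t) := by
  have h1 := ht.cost
  have h2 := ht.size
  simp only [Ty.size] at h2
  constructor
  · simp only [Tm.cost, add_mul, one_mul]; omega
  · simp only [Tm.val]; omega

theorem Bd.cons {s : Tm (Ty.Val ι K) a} {t : Tm (Ty.Val ι K) (.list a)} (hs : Bd d τ w F N s)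
    (ht : Bd d τ w G N t) : Bd d τ w (fun N => 1 + F N + G N) N (.cons s t) := by
  have h1 := hs.cost
  have h2 := ht.cost
  have h3 := hs.size
  have h4 := ht.size
  constructor
  · simp only [Tm.cost, add_mul, one_mul]; omega
  · simp only [Tm.val, size_cons]; omega

theorem Bd.casesV {l : Tm (Ty.Val ι K) (.list a)} {e : Tm (Ty.Val ι K) b}
    {f : a.Val ι K → (Ty.list a).Val ι K → Tm (Ty.Val ι K) b}
    (hl : Bd d τ w F N l) (he : Bd d τ w G N e)
    (hf : ∀ N', N ≤ N' → ∀ x, Ty.size a x ≤ N' → ∀ t, Ty.size (.list a) t ≤ N' →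
      Bd d τ w H N' (f x t)) :
    Bd d τ w (fun N => 1 + F N + G N + H (N + F N)) N (.casesV l e f) := by
  have h1 := hl.cost
  have h2 := he.cost
  have h3 := hl.size
  have h4 := he.size
  rcases h : l.val d with _ | ⟨x, t⟩
  · constructor
    · simp only [Tm.cost, h, add_mul, one_mul]; omega
    · simp only [Tm.val, h]; omega
  · rw [h, size_cons] at h3
    have h5 := hf (N + F N) (by omega) x (by omega) t (by omega)
    have h6 := h5.cost
    have h7 := h5.size
    constructor
    · simp only [Tm.cost, h, add_mul, one_mul]; omega
    · simp only [Tm.val, h]; omega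

/-- The bound for `n` rounds that start with a state of size at most `M`. -/
def foldBd (G : ℕ → ℕ) : ℕ → ℕ → ℕ
  | 0, M => M + 1
  | n + 1, M => 1 + M + G M + foldBd G n (M + G M)

theorem Bd.foldlV {l : Tm (Ty.Val ι K) (.list a)} {s : Tm (Ty.Val ι K) b}
    {f : b.Val ι K → a.Val ι K → Tm (Ty.Val ι K) b} (hl : Bd d τ w F N l) (hs : Bd d τ w G N s)
    (hf : ∀ N', N ≤ N' → ∀ y, Ty.size b y ≤ N' → ∀ x, Ty.size a x ≤ N' → Bd d τ w H N' (f y x)) :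
    Bd d τ w (fun N => F N + G N + foldBd H (F N) (N + F N + G N)) N (.foldlV l s f) := by
  have main : ∀ (n M : ℕ) (l : List (a.Val ι K)) (s : b.Val ι K), l.length ≤ n → N ≤ M →
      Ty.size b s ≤ M → (∀ x ∈ l, Ty.size a x ≤ M) →
      foldlCost (fun y x => (f y x).val d) (fun y x => (f y x).cost d τ) s l ≤
        foldBd H n M * (w + 1) ∧
      Ty.size b (l.foldl (fun y x => (f y x).val d) s) ≤ foldBd H n M := by
    intro n
    induction n with
    | zero =>
      intro M l s hl hN hs _
      obtain rfl : l = [] := by simpa using hl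
      simp only [foldlCost, foldBd, List.foldl_nil, add_mul, one_mul]
      constructor <;> omega
    | succ n ih =>
      intro M l s hl hN hs hx
      rcases l with _ | ⟨x, l⟩
      · simp only [foldlCost, foldBd, List.foldl_nil, add_mul, one_mul]
        constructor <;> omega
      · have h1 := hf M hN s hs x (hx x (by simp))
        have h2 := h1.cost
        obtain ⟨h3, h4⟩ := ih (M + H M) l ((f s x).val d) (by simpa using hl) (by omega)
          (by have := h1.size; omega) (fun x' hx' => by have := hx x' (by simp [hx']); omega)
        simp only [foldlCost, foldBd, List.foldl_cons, add_mul, one_mul]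
        constructor <;> omega
  have h1 := hl.cost
  have h2 := hs.cost
  have h3 := hl.size
  have h4 := hs.size
  obtain ⟨h5, h6⟩ := main (F N) (N + F N + G N) (l.val d) (s.val d)
    ((length_le_size _).trans h3) (by omega) (by omega)
    (fun x hx => by have := size_le_of_mem hx; omega)
  constructor
  · simp only [Tm.cost, add_mul]; omega
  · simp only [Tm.val]; omega

/-- The bound for a right fold over a list of length `n`. -/
def foldrBd (G : ℕ → ℕ) : ℕ → ℕ → ℕ
  | 0, M => M + 1
  | n + 1, M => 1 + foldrBd G n M + G (foldrBd G n M)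

theorem Bd.foldrV {l : Tm (Ty.Val ι K) (.list a)} {s : Tm (Ty.Val ι K) b}
    {f : a.Val ι K → b.Val ι K → Tm (Ty.Val ι K) b} (hl : Bd d τ w F N l) (hs : Bd d τ w G N s)
    (hf : ∀ N', N ≤ N' → ∀ x, Ty.size a x ≤ N' → ∀ y, Ty.size b y ≤ N' → Bd d τ w H N' (f x y)) :
    Bd d τ w (fun N => F N + G N + foldrBd H (F N) (N + F N + G N)) N (.foldrV l s f) := by
  have mono : ∀ n M, M + 1 ≤ foldrBd H n M := by
    intro n M
    induction n with
    | zero => exact le_rfl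
    | succ n ih => rw [foldrBd]; omega
  have main : ∀ (n M : ℕ) (l : List (a.Val ι K)) (s : b.Val ι K), l.length ≤ n → N ≤ M →
      Ty.size b s ≤ M → (∀ x ∈ l, Ty.size a x ≤ M) →
      foldrCost (fun x y => (f x y).val d) (fun x y => (f x y).cost d τ) s l ≤
        foldrBd H n M * (w + 1) ∧
      Ty.size b (l.foldr (fun x y => (f x y).val d) s) ≤ foldrBd H n M := by
    intro n
    induction n with
    | zero =>
      intro M l s hl hN hs _
      obtain rfl : l = [] := by simpa using hl
      simp only [foldrCost, foldrBd, List.foldr_nil, add_mul, one_mul]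
      constructor <;> omega
    | succ n ih =>
      intro M l s hl hN hs hx
      have h0 := mono n M
      rcases l with _ | ⟨x, l⟩
      · simp only [foldrCost, foldrBd, List.foldr_nil, add_mul, one_mul]
        constructor <;> omega
      · obtain ⟨h3, h4⟩ := ih M l s (by simpa using hl) hN hs (fun x' hx' => hx x' (by simp [hx']))
        have h1 := hf (foldrBd H n M) (by omega) x (by have := hx x (by simp); omega) _ h4
        have h2 := h1.cost
        have h5 := h1.size
        simp only [foldrCost, foldrBd, List.foldr_cons, add_mul, one_mul]
        constructor <;> omega
  have h1 := hl.cost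
  have h2 := hs.cost
  have h3 := hl.size
  have h4 := hs.size
  obtain ⟨h5, h6⟩ := main (F N) (N + F N + G N) (l.val d) (s.val d)
    ((length_le_size _).trans h3) (by omega) (by omega)
    (fun x hx => by have := size_le_of_mem hx; omega)
  constructor
  · simp only [Tm.cost, add_mul]; omega
  · simp only [Tm.val]; omega

/-- Numbers have size `0`, so the number of rounds needs the separate bound `hr`. The `+ 1` is there
for the `k + 1` rounds of `findCouples`. -/
theorem Bd.loopV {C : ℕ → ℕ} {m : Tm (Ty.Val ι K) .num} {s : Tm (Ty.Val ι K) b}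
    {p : b.Val ι K → Tm (Ty.Val ι K) .bool} {f : b.Val ι K → Tm (Ty.Val ι K) b}
    (hm : Bd d τ w F N m) (hs : Bd d τ w G N s)
    (hp : ∀ N', N ≤ N' → ∀ y, Ty.size b y ≤ N' → Bd d τ w C N' (p y))
    (hf : ∀ N', N ≤ N' → ∀ y, Ty.size b y ≤ N' → Bd d τ w H N' (f y))
    (hr : ⌊(m.val d : ℚ)⌋₊ ≤ N + 1) :
    Bd d τ w (fun N => F N + G N + foldBd (fun M => C M + H M) (N + 1) (N + G N)) N
      (.loopV m s p f) := by
  have main : ∀ (n M m : ℕ) (s : b.Val ι K), m ≤ n → N ≤ M → Ty.size b s ≤ M →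
      loopCost (fun y => (p y).val d) (fun y => (f y).val d) (fun y => (p y).cost d τ)
        (fun y => (f y).cost d τ) m s ≤ foldBd (fun M => C M + H M) n M * (w + 1) ∧
      Ty.size b (loopVal (fun y => (p y).val d) (fun y => (f y).val d) m s) ≤
        foldBd (fun M => C M + H M) n M := by
    intro n
    induction n with
    | zero =>
      intro M m s hm hN hs
      obtain rfl : m = 0 := by simpa using hm
      simp only [loopCost, loopVal, foldBd, add_mul, one_mul]
      constructor <;> omega
    | succ n ih =>
      intro M m s hm hN hs
      rcases m with _ | m
      · simp only [loopCost, loopVal, foldBd, add_mul, one_mul]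
        constructor <;> omega
      · have h0 := (hp M hN s hs).cost
        have h1 := hf M hN s hs
        have h2 := h1.cost
        obtain ⟨h3, h4⟩ := ih (M + (C M + H M)) m ((f s).val d) (by simpa using hm) (by omega)
          (by have := h1.size; omega)
        simp only [loopCost, loopVal, foldBd, add_mul, one_mul] at h3 h4 ⊢
        split_ifs <;> constructor <;> omega
  have h1 := hm.cost
  have h2 := hs.cost
  have h4 := hs.size
  obtain ⟨h5, h6⟩ := main (N + 1) (N + G N) _ (s.val d) hr (by omega) (by omega)
  constructor
  · simp only [Tm.cost, add_mul]; omega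
  · simp only [Tm.val]; omega

/-- Counting in a long list. -/
theorem Bd.count {l : List (a.Val ι K)} {p : Tm (Ty.Val ι K) a → Tm (Ty.Val ι K) .bool}
    (hl : l.length ≤ w) (hp : ∀ x, x ∈ l → Bd d τ 0 F N (p (.var x))) :
    Bd d τ w (fun N => 6 + F N) N (count (.var l) p) := by
  let f : Ty.Val ι K .num → a.Val ι K → Tm (Ty.Val ι K) .num := fun y x =>
    .ite (p (.var x)) ((.var y : Tm _ .num) + (.lit 1 : Tm _ .num)) (.var y)
  have main : ∀ (l : List (a.Val ι K)) (s : ℚ), (∀ x, x ∈ l → Bd d τ 0 F N (p (.var x))) →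
      foldlCost (fun y x => (f y x).val d) (fun y x => (f y x).cost d τ) s l ≤
        1 + l.length * (5 + F N) := by
    intro l
    induction l with
    | nil => intro s _; simp [foldlCost]
    | cons x l ih =>
      intro s hx
      have h1 := ih ((f s x).val d) (fun x' hx' => hx x' (by simp [hx']))
      have h2 := (hx x (by simp)).cost
      have h3 : (f s x).cost d τ ≤ 4 + F N := by
        have : ((.var s : Tm (Ty.Val ι K) .num) + (.lit 1 : Tm _ .num)).cost d τ = 3 := rfl
        simp only [f, Tm.cost]
        split_ifs <;> omega
      simp only [foldlCost, List.length_cons, add_mul, one_mul] at h1 ⊢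
      omega
  refine ⟨?_, Nat.zero_le _⟩
  have h := main l 0 hp
  have h1 : l.length * (5 + F N) ≤ w * (5 + F N) := Nat.mul_le_mul_right _ hl
  change 1 + 1 + foldlCost (fun y x => (f y x).val d) (fun y x => (f y x).cost d τ) 0 l ≤ _
  nlinarith

end Bounds
end Prog

namespace Prog

/-! ### Uniform bounds for tuples, regions, elimination and rounding. -/

section Bounds

/-- Keeps the actual value of the bound variable. This is needed where the variable limits the
rounds of a loop, which its size says nothing about. -/
theorem Bd.letV' {ι K : Type} [LinearOrder K] {d : ι → ι → K} {τ : ι → ι → ℕ} {w N : ℕ}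
    {F G : ℕ → ℕ} {a b : Ty} {t : Tm (Ty.Val ι K) a} {f : a.Val ι K → Tm (Ty.Val ι K) b}
    (ht : Bd d τ w F N t)
    (hf : ∀ N', N ≤ N' → Ty.size a (t.val d) ≤ N' → Bd d τ w G N' (f (t.val d))) :
    Bd d τ w (fun N => 1 + F N + G (N + F N)) N (.letV t f) := by
  have h := hf (N + F N) (by omega) (by have := ht.size; omega)
  have h1 := ht.cost
  have h2 := h.cost
  have h3 := h.size
  constructor
  · simp only [Tm.cost, add_mul, one_mul]; omega
  · simp only [Tm.val]; omega

theorem Bd.length {ι K : Type} [LinearOrder K] {d : ι → ι → K} {τ : ι → ι → ℕ} {w N : ℕ}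
    {F : ℕ → ℕ} {a : Ty} {l : Tm (Ty.Val ι K) (.list a)} (hl : Bd d τ w F N l) :
    Bd d τ w (fun N => F N + 1 + foldBd (fun N => 1 + (N + 1) + 1) (F N) (N + F N + 1)) N
      (length l) :=
  .foldlV hl (.lit 0) fun _ _ _ hy _ _ => .hadd (.var hy) (.lit 1)

theorem exists_bd_range : ∃ F, ∀ {ι K : Type} [LinearOrder K] (d : ι → ι → K) (τ : ι → ι → ℕ)
    (w N : ℕ) (k : ℚ),
    ⌊k⌋₊ ≤ N → Bd d τ w F N (range (.var k)) := by
  -- The bound `F` is left open, and the rules fill it in as they follow the syntax of the term. As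
  -- it is fixed before all other data, it is uniform in them.
  apply Exists.intro
  intro ι K _ d τ w N k hk
  simp only [range, bind', repeat', while']
  repeat' first
    | intro _ | exact Bd.var (by first | exact Nat.zero_le _ | omega) | exact Bd.boolLit _
    | exact Bd.lit _ | exact Bd.nil | apply Bd.fst | apply Bd.snd | apply Bd.pair | apply Bd.cons
    | apply Bd.ite | apply Bd.hadd | apply Bd.hsub | apply Bd.hmul | apply Bd.hdiv
    | apply Bd.floor | apply Bd.le | apply Bd.eq | apply Bd.letV'
    | apply Bd.casesV | apply Bd.foldlV | apply Bd.foldrV | apply Bd.loopV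
  simp only [Tm.val]; omega

theorem exists_bd_tuples : ∃ F, ∀ {ι K : Type} [LinearOrder K] (d : ι → ι → K) (τ : ι → ι → ℕ)
    (w N : ℕ) (k : ℚ),
    ⌊k⌋₊ ≤ N → Bd d τ w F N (tuples (.var k)) := by
  obtain ⟨R, hR⟩ := exists_bd_range
  apply Exists.intro
  intro ι K _ d τ w N k hk
  simp only [tuples, bind', repeat', while', flatMap, map, foldr', append]
  apply Bd.letV'
  · exact Bd.var (Nat.zero_le _)
  intro N' hN' _
  repeat' first
    | intro _ | exact Bd.var (by first | exact Nat.zero_le _ | omega) | exact Bd.boolLit _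
    | exact Bd.lit _ | exact Bd.nil | apply Bd.fst | apply Bd.snd | apply Bd.pair | apply Bd.cons
    | apply Bd.ite | apply Bd.hadd | apply Bd.hsub | apply Bd.hmul | apply Bd.hdiv
    | apply Bd.floor | apply Bd.le | apply Bd.eq | exact hR _ _ _ _ _ (by simp only [Tm.val]; omega) | apply Bd.letV
    | apply Bd.casesV | apply Bd.foldlV | apply Bd.foldrV | apply Bd.loopV
  simp only [Tm.val]; omega

theorem exists_bd_regions : ∃ F, ∀ {ι K : Type} [LinearOrder K] (d : ι → ι → K) (τ : ι → ι → ℕ)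
    (w N : ℕ) (k : ℚ),
    ⌊k⌋₊ ≤ N → Bd d τ w F N (regions (.var k)) := by
  obtain ⟨R, hR⟩ := exists_bd_range
  apply Exists.intro
  intro ι K _ d τ w N k hk
  simp only [regions, foldl', map, foldr', append]
  repeat' first
    | intro _ | exact Bd.var (by first | exact Nat.zero_le _ | omega) | exact Bd.boolLit _
    | exact Bd.lit _ | exact Bd.nil | apply Bd.fst | apply Bd.snd | apply Bd.pair | apply Bd.cons
    | apply Bd.ite | apply Bd.hadd | apply Bd.hsub | apply Bd.hmul | apply Bd.hdiv
    | apply Bd.floor | apply Bd.le | apply Bd.eq | exact hR _ _ _ _ _ hk | apply Bd.letV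
    | apply Bd.casesV | apply Bd.foldlV | apply Bd.foldrV

theorem exists_bd_sysVars : ∃ F, ∀ {ι K : Type} [LinearOrder K] (d : ι → ι → K) (τ : ι → ι → ℕ)
    (w N : ℕ) (regs : List (ℚ × List ℚ)),
    Ty.size (.list (.prod .num (.list .num))) (ι := ι) (K := K) regs ≤ N →
    Bd d τ w F N (sysVars (.var regs)) := by
  apply Exists.intro
  intro ι K _ d τ w N regs h
  simp only [sysVars, flatMap, map, foldr', append]
  repeat' first
    | intro _ | exact Bd.var (by first | exact Nat.zero_le _ | omega) | exact Bd.boolLit _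
    | exact Bd.lit _ | exact Bd.nil | apply Bd.fst | apply Bd.snd | apply Bd.pair | apply Bd.cons
    | apply Bd.ite | apply Bd.hadd | apply Bd.hsub | apply Bd.hmul | apply Bd.hdiv
    | apply Bd.floor | apply Bd.le | apply Bd.eq | apply Bd.letV
    | apply Bd.casesV | apply Bd.foldlV | apply Bd.foldrV

theorem exists_bd_round : ∃ F, ∀ {ι K : Type} [LinearOrder K] (d : ι → ι → K) (τ : ι → ι → ℕ)
    (w N : ℕ) (k : ℚ)
    (vs : List (ℚ × ℚ)) (best : K × List ℚ × List ℚ), k ≤ N →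
    Ty.size (.list (.prod .num .num)) (ι := ι) (K := K) vs ≤ N →
    Ty.size Record (ι := ι) (K := K) best ≤ N →
    Bd d τ w F N (round (.var k) (zipWith (.var vs) (.snd (.snd (.var (a := Record) best))) fun v x =>
      .pair (.fst v) (.pair (.snd v) x))) := by
  apply Exists.intro
  intro ι K _ d τ w N k vs best hk hvs hbest
  simp only [round, findCouples, isFractional, isFirst, isSecond, count, map, foldr', bind', cases',
    foldl', while', not', and', or', head, any, revAppend, filter, before, upTo, zipWith]
  repeat' first
    | intro _ | exact Bd.var (by first | exact Nat.zero_le _ | omega) | exact Bd.boolLit _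
    | exact Bd.lit _ | exact Bd.nil | apply Bd.fst | apply Bd.snd | apply Bd.pair | apply Bd.cons
    | apply Bd.ite | apply Bd.hadd | apply Bd.hsub | apply Bd.hmul | apply Bd.hdiv
    | apply Bd.floor | apply Bd.le | apply Bd.eq | exact Bd.var (a := Record) (by omega) | apply Bd.length | apply Bd.letV
    | apply Bd.casesV | apply Bd.foldlV | apply Bd.foldrV | apply Bd.loopV
  · apply Nat.floor_le_of_le
    refine (add_le_add hk (le_refl (1 : ℚ))).trans ?_
    norm_cast
    omega
  · rw [val_length, Nat.floor_natCast]
    exact (length_le_size _).trans (by simp only [Tm.val]; omega)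

/-- The list `cs` of region codes is the only long one, and it is only used for counting. This gives
the factor `w + 1`; all else is bounded in terms of `N`. -/
theorem exists_bd_solve : ∃ F, ∀ {ι K : Type} [LinearOrder K] (d : ι → ι → K) (τ : ι → ι → ℕ)
    (w N : ℕ) (k L U : ℚ)
    (regs : List (ℚ × List ℚ)) (vs : List (ℚ × ℚ)) (cs : List ℚ), ⌊k⌋₊ ≤ N →
    Ty.size (.list (.prod .num (.list .num))) (ι := ι) (K := K) regs ≤ N →
    Ty.size (.list (.prod .num .num)) (ι := ι) (K := K) vs ≤ N → cs.length ≤ w →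
    Bd d τ w F N (solve (length (a := .prod .num .num) (.var vs))
      (system (.var k) (.var L) (.var U) (.var regs) (.var vs) (.var cs))) := by
  obtain ⟨R, hR⟩ := exists_bd_range
  apply Exists.intro
  intro ι K _ d τ w N k L U regs vs cs hk hregs hvs hcs
  simp only [solve, system, dot, scaleTail, leading, upperBounds, lowerBounds, unbounded, sumLe,
    leSum, map, flatMap, foldr', bind', cases', foldl', while', repeat', not', and', head, tail,
    append, revAppend, filter, all, zipWith]
  repeat' first
    | intro _ | exact Bd.var (by first | exact Nat.zero_le _ | omega) | exact Bd.boolLit _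
    | exact Bd.lit _ | exact Bd.nil | apply Bd.fst | apply Bd.snd | apply Bd.pair | apply Bd.cons
    | apply Bd.ite | apply Bd.hadd | apply Bd.hsub | apply Bd.hmul | apply Bd.hdiv
    | apply Bd.floor | apply Bd.le | apply Bd.eq | exact hR _ _ _ _ _ (by omega) | apply Bd.length
    | exact Bd.count hcs fun _ _ => Bd.eq (Bd.var (Nat.zero_le _)) (Bd.fst (Bd.var (by omega)))
    | exact Bd.var (a := Ineq) (by omega) | apply Bd.letV
    | apply Bd.casesV | apply Bd.foldlV | apply Bd.foldrV | apply Bd.loopV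
  rw [val_length, Nat.floor_natCast]
  exact (length_le_size _).trans (by simp only [Tm.val]; omega)

end Bounds
end Prog

namespace Prog

/-! ### Explicit step counts for long lists, and the cost of merge sort. -/

section Costs

variable {ι K : Type}

theorem foldlCost_le {α β : Type} {f : β → α → β} {t : β → α → ℕ} (Inv : β → Prop) (c : ℕ)
    (l : List α) (h : ∀ s, Inv s → ∀ x ∈ l, t s x ≤ c ∧ Inv (f s x)) {s : β} (hs : Inv s) :
    foldlCost f t s l ≤ 1 + l.length * (1 + c) := by
  induction l generalizing s with
  | nil => simp [foldlCost]
  | cons x l ih =>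
    obtain ⟨h1, h2⟩ := h s hs x (by simp)
    have h3 := ih (fun s hs y hy => h s hs y (by simp [hy])) h2
    simp only [foldlCost, List.length_cons, add_mul, one_mul] at h3 ⊢
    omega

theorem foldrCost_le {α β : Type} {f : α → β → β} {t : α → β → ℕ} (Inv : β → Prop) (c : ℕ)
    (l : List α) (h : ∀ s, Inv s → ∀ x ∈ l, t x s ≤ c ∧ Inv (f x s)) {s : β} (hs : Inv s) :
    foldrCost f t s l ≤ 1 + l.length * (1 + c) := by
  suffices foldrCost f t s l ≤ 1 + l.length * (1 + c) ∧ Inv (l.foldr f s) from this.1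
  induction l with
  | nil => simpa [foldrCost] using hs
  | cons x l ih =>
    obtain ⟨h3, h4⟩ := ih (fun s hs y hy => h s hs y (by simp [hy]))
    obtain ⟨h1, h2⟩ := h _ h4 x (by simp)
    refine ⟨?_, h2⟩
    simp only [foldrCost, List.length_cons, add_mul, one_mul] at h3 ⊢
    omega

theorem loopCost_le {β : Type} {p : β → Bool} {f : β → β} {tc tf : β → ℕ} (Inv : β → Prop) (c : ℕ)
    (hc : ∀ s, Inv s → tc s ≤ c) (h : ∀ s, Inv s → p s = true → tf s ≤ c ∧ Inv (f s))
    (m : ℕ) {s : β} (hs : Inv s) : loopCost p f tc tf m s ≤ 1 + m * (1 + 2 * c) := by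
  induction m generalizing s with
  | zero => simp [loopCost]
  | succ m ih =>
    have h0 := hc s hs
    rw [loopCost]
    split_ifs with h1
    · obtain ⟨h2, h3⟩ := h s hs h1
      have h4 := ih h3
      simp only [add_mul, one_mul] at h4 ⊢
      omega
    · simp only [add_mul, one_mul]
      omega

/-- The rank bounds the rounds instead of the limit `m`. Merge sort and binary search have linear
limits, but logarithmic ranks. -/
theorem loopCost_le_rank {β : Type} {p : β → Bool} {f : β → β} {tc tf : β → ℕ} (Inv : β → Prop)
    (ρ : β → ℕ) (c : ℕ) (hc : ∀ s, Inv s → tc s ≤ c)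
    (h : ∀ s, Inv s → p s = true → tf s ≤ c ∧ Inv (f s) ∧ ρ (f s) < ρ s)
    (m : ℕ) {s : β} (hs : Inv s) : loopCost p f tc tf m s ≤ (ρ s + 1) * (1 + 2 * c) := by
  induction m generalizing s with
  | zero => rw [loopCost]; nlinarith
  | succ m ih =>
    have h0 := hc s hs
    rw [loopCost]
    split_ifs with h1
    · obtain ⟨h2, h3, h5⟩ := h s hs h1
      have h4 := ih h3
      have h6 : (ρ (f s) + 1) * (1 + 2 * c) ≤ ρ s * (1 + 2 * c) := Nat.mul_le_mul_right _ h5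
      simp only [add_mul, one_mul] at h4 h6 ⊢
      omega
    · simp only [add_mul, one_mul]
      omega


variable [LinearOrder K]

/-- The evaluation of the term `t` takes at most `c` steps, and its value satisfies `P`. -/
structure Runs (d : ι → ι → K) (τ : ι → ι → ℕ) {a : Ty} (t : Tm (Ty.Val ι K) a) (c : ℕ)
    (P : a.Val ι K → Prop) : Prop where
  cost : t.cost d τ ≤ c
  val : P (t.val d)

variable {d : ι → ι → K} {τ : ι → ι → ℕ} {a b : Ty}

theorem Runs.mono {t : Tm (Ty.Val ι K) a} {c c' : ℕ} {P Q : a.Val ι K → Prop} (h : Runs d τ t c P)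
    (hc : c ≤ c') (hP : ∀ x, P x → Q x) : Runs d τ t c' Q :=
  ⟨h.cost.trans hc, hP _ h.val⟩

theorem Runs.bind {t : Tm (Ty.Val ι K) a} {f : Tm (Ty.Val ι K) a → Tm (Ty.Val ι K) b}
    {c c' : ℕ} {P : a.Val ι K → Prop} {Q : b.Val ι K → Prop} (h : Runs d τ t c P)
    (hf : ∀ x, P x → Runs d τ (f (.var x)) c' Q) : Runs d τ (bind' t f) (1 + c + c') Q := by
  have h' := hf _ h.val
  refine ⟨?_, h'.val⟩
  have h1 := h.cost
  have h2 := h'.cost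
  simp only [bind', Tm.cost]
  omega

theorem Runs.foldl {l : Tm (Ty.Val ι K) (.list a)} {s : Tm (Ty.Val ι K) b}
    {f : Tm (Ty.Val ι K) b → Tm (Ty.Val ι K) a → Tm (Ty.Val ι K) b} {A B C r : ℕ}
    {E : a.Val ι K → Prop} {Inv : b.Val ι K → Prop}
    (hl : Runs d τ l A fun l => l.length ≤ r ∧ ∀ x ∈ l, E x) (hs : Runs d τ s B Inv)
    (hf : ∀ y, Inv y → ∀ x, E x → Runs d τ (f (.var y) (.var x)) C Inv) :
    Runs d τ (foldl' l s f) (A + B + 1 + r * (1 + C)) Inv := by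
  have h1 := hl.cost
  have h2 := hs.cost
  obtain ⟨h3, h4⟩ := hl.val
  have h5 := Nat.mul_le_mul_right (1 + C) h3
  constructor
  · simp only [foldl', Tm.cost]
    refine (Nat.add_le_add_left (foldlCost_le Inv C _ (fun y hy x hx => ?_) hs.val) _).trans ?_
    · have := hf y hy x (h4 x hx)
      exact ⟨this.cost, this.val⟩
    · omega
  · rw [val_foldl']
    exact List.foldlRecOn _ _ hs.val fun y hy x hx => (hf y hy x (h4 x hx)).val

theorem Runs.foldr {l : Tm (Ty.Val ι K) (.list a)} {s : Tm (Ty.Val ι K) b}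
    {f : Tm (Ty.Val ι K) a → Tm (Ty.Val ι K) b → Tm (Ty.Val ι K) b} {A B C r : ℕ}
    {E : a.Val ι K → Prop} {Inv : b.Val ι K → Prop}
    (hl : Runs d τ l A fun l => l.length ≤ r ∧ ∀ x ∈ l, E x) (hs : Runs d τ s B Inv)
    (hf : ∀ y, Inv y → ∀ x, E x → Runs d τ (f (.var x) (.var y)) C Inv) :
    Runs d τ (foldr' l s f) (A + B + 1 + r * (1 + C)) Inv := by
  have h1 := hl.cost
  have h2 := hs.cost
  obtain ⟨h3, h4⟩ := hl.val
  have h5 := Nat.mul_le_mul_right (1 + C) h3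
  constructor
  · simp only [foldr', Tm.cost]
    refine (Nat.add_le_add_left (foldrCost_le Inv C _ (fun y hy x hx => ?_) hs.val) _).trans ?_
    · have := hf y hy x (h4 x hx)
      exact ⟨this.cost, this.val⟩
    · omega
  · rw [val_foldr']
    exact List.foldrRecOn _ _ hs.val fun y hy x hx => (hf y hy x (h4 x hx)).val

theorem Runs.while {m : Tm (Ty.Val ι K) .num} {s : Tm (Ty.Val ι K) b}
    {p : Tm (Ty.Val ι K) b → Tm (Ty.Val ι K) .bool} {f : Tm (Ty.Val ι K) b → Tm (Ty.Val ι K) b}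
    {A B C r : ℕ} {Inv : b.Val ι K → Prop} (hm : Runs d τ m A fun q => ⌊(q : ℚ)⌋₊ ≤ r)
    (hs : Runs d τ s B Inv) (hp : ∀ y, Inv y → (p (.var y)).cost d τ ≤ C)
    (hf : ∀ y, Inv y → (p (.var y)).val d = true → Runs d τ (f (.var y)) C Inv) :
    Runs d τ (while' m s p f) (A + B + 1 + r * (1 + 2 * C)) Inv := by
  have h1 := hm.cost
  have h2 := hs.cost
  have h5 := Nat.mul_le_mul_right (1 + 2 * C) hm.val
  constructor
  · simp only [while', Tm.cost]
    refine (Nat.add_le_add_left (loopCost_le Inv C hp (fun y hy h => ?_) _ hs.val) _).trans ?_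
    · have := hf y hy h
      exact ⟨this.cost, this.val⟩
    · omega
  · rw [val_while']
    exact loopVal_inv Inv (fun y hy h => (hf y hy h).val) _ hs.val

theorem Runs.while_rank {m : Tm (Ty.Val ι K) .num} {s : Tm (Ty.Val ι K) b}
    {p : Tm (Ty.Val ι K) b → Tm (Ty.Val ι K) .bool} {f : Tm (Ty.Val ι K) b → Tm (Ty.Val ι K) b}
    {A B C r : ℕ} {Inv : b.Val ι K → Prop} (ρ : b.Val ι K → ℕ) (hm : m.cost d τ ≤ A)
    (hs : Runs d τ s B fun y => Inv y ∧ ρ y ≤ r) (hp : ∀ y, Inv y → (p (.var y)).cost d τ ≤ C)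
    (hf : ∀ y, Inv y → (p (.var y)).val d = true →
      Runs d τ (f (.var y)) C fun y' => Inv y' ∧ ρ y' < ρ y) :
    Runs d τ (while' m s p f) (A + B + (r + 1) * (1 + 2 * C)) Inv := by
  have h2 := hs.cost
  obtain ⟨h3, h4⟩ := hs.val
  have h5 := Nat.mul_le_mul_right (1 + 2 * C) (Nat.add_le_add_right h4 1)
  constructor
  · simp only [while', Tm.cost]
    refine (Nat.add_le_add_left (loopCost_le_rank Inv ρ C hp (fun y hy h => ?_) _ h3) _).trans ?_
    · have := hf y hy h
      exact ⟨this.cost, this.val⟩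
    · omega
  · rw [val_while']
    exact loopVal_inv Inv (fun y hy h => (hf y hy h).val.1) _ h3

variable (d τ)

theorem cost_map_le (l : Tm (Ty.Val ι K) (.list a)) (f : Tm (Ty.Val ι K) a → Tm (Ty.Val ι K) b)
    (c : ℕ) (h : ∀ x, x ∈ l.val d → (f (.var x)).cost d τ ≤ c) :
    (map l f).cost d τ ≤ l.cost d τ + 2 + List.length (l.val d) * (c + 3) := by
  simp only [map, foldr', Tm.cost, Tm.val]
  refine (Nat.add_le_add_left (foldrCost_le (fun _ => True) (c + 2) _
    (fun s _ x hx => ⟨by have := h x hx; omega, trivial⟩) trivial) _).trans ?_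
  rw [show c + 3 = 1 + (c + 2) by omega]
  omega

theorem cost_append (l l' : Tm (Ty.Val ι K) (.list a)) :
    (append l l').cost d τ ≤ l.cost d τ + l'.cost d τ + 1 + List.length (l.val d) * 4 := by
  have := foldrCost_le (f := fun x y => (Tm.cons (.var x) (.var y) : Tm (Ty.Val ι K) (.list a)).val d)
    (t := fun x y => (Tm.cons (.var x) (.var y) : Tm (Ty.Val ι K) (.list a)).cost d τ)
    (fun _ => True) 3 (l.val d)
    (fun s _ x hx => ⟨by simp only [Tm.cost]; omega, trivial⟩) (s := l'.val d) trivial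
  simp only [append, foldr', Tm.cost, Tm.val] at this ⊢
  omega

theorem cost_revAppend (l l' : Tm (Ty.Val ι K) (.list a)) :
    (revAppend l l').cost d τ ≤ l.cost d τ + l'.cost d τ + 1 + List.length (l.val d) * 4 := by
  have := foldlCost_le (f := fun y x => (Tm.cons (.var x) (.var y) : Tm (Ty.Val ι K) (.list a)).val d)
    (t := fun y x => (Tm.cons (.var x) (.var y) : Tm (Ty.Val ι K) (.list a)).cost d τ)
    (fun _ => True) 3 (l.val d)
    (fun s _ x hx => ⟨by simp only [Tm.cost]; omega, trivial⟩) (s := l'.val d) trivial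
  simp only [revAppend, foldl', Tm.cost, Tm.val] at this ⊢
  omega

theorem cost_length (l : Tm (Ty.Val ι K) (.list a)) :
    (length l).cost d τ ≤ l.cost d τ + 2 + List.length (l.val d) * 4 := by
  have := foldlCost_le (f := fun y (_ : a.Val ι K) =>
      ((.var y : Tm (Ty.Val ι K) .num) + (.lit 1 : Tm (Ty.Val ι K) .num)).val d)
    (t := fun y _ => ((.var y : Tm (Ty.Val ι K) .num) + (.lit 1 : Tm (Ty.Val ι K) .num)).cost d τ)
    (fun _ => True) 3 (l.val d)
    (fun s _ x hx => ⟨by simp only [Tm.cost]; omega, trivial⟩) (s := (0 : ℚ)) trivial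
  simp only [length, foldl', Tm.cost, Tm.val] at this ⊢
  omega

theorem cost_nth (e : Tm (Ty.Val ι K) a) (l : Tm (Ty.Val ι K) (.list a)) (i : Tm (Ty.Val ι K) .num) :
    (nth e l i).cost d τ ≤
      e.cost d τ + l.cost d τ + i.cost d τ + 3 + ⌊(i.val d : ℚ)⌋₊ * 7 := by
  have := loopCost_le (p := fun y => (Tm.boolLit true : Tm (Ty.Val ι K) .bool).val d)
    (f := fun y => (tail (.var y : Tm (Ty.Val ι K) (.list a))).val d)
    (tc := fun y => (Tm.boolLit true : Tm (Ty.Val ι K) .bool).cost d τ)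
    (tf := fun y => (tail (.var y : Tm (Ty.Val ι K) (.list a))).cost d τ)
    (fun _ => True) 3 (fun _ _ => by simp only [Tm.cost]; omega) (fun s _ _ => ⟨by
      simp only [tail, cases', Tm.cost]; split <;> omega, trivial⟩) ⌊(i.val d : ℚ)⌋₊ (s := l.val d)
    trivial
  simp only [nth, head, cases', repeat', while', Tm.cost] at this ⊢
  split <;> omega

theorem runs_merge (l l' : List K) :
    Runs d τ (merge (.var l) (.var l') : Tm (Ty.Val ι K) (.list .dst))
      (75 * (1 + l.length + l'.length)) fun _ => True := by
  have h1 := cost_length d τ (.var l : Tm (Ty.Val ι K) (.list .dst))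
  have h2 := cost_length d τ (.var l' : Tm (Ty.Val ι K) (.list .dst))
  simp only [Tm.cost, Tm.val] at h1 h2
  refine Runs.mono (.bind (P := fun x => x = l) ⟨le_rfl, rfl⟩ fun x hx =>
    .bind (P := fun x => x = l') ⟨le_rfl, rfl⟩ fun x' hx' =>
    .bind (a := .prod (.list .dst) (.prod (.list .dst) (.list .dst)))
      (c' := 12 + 8 * (l.length + l'.length))
      (P := fun s : List K × List K × List K => s.1.length + s.2.1.length + s.2.2.length =
      l.length + l'.length) (.while (r := l.length + l'.length)
      (A := 7 + 4 * (l.length + l'.length)) (B := 5) (C := 22) ?_ ?_ ?_ ?_)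
    fun s hs => ⟨?_, trivial⟩)
    ?_ fun _ h => h
  all_goals try subst hx
  all_goals try subst hx'
  · constructor
    · simp only [Tm.cost]; omega
    · simp only [Tm.val, val_length]
      rw [← Nat.cast_add, Nat.floor_natCast]
  · constructor
    · simp only [Tm.cost]; omega
    · simp [Tm.val]
  · rintro ⟨_ | ⟨x, t⟩, _ | ⟨x', t'⟩, acc⟩ - <;>
      simp [Tm.cost, not', or', isNil, cases', Tm.val]
  · rintro ⟨_ | ⟨x, t⟩, _ | ⟨x', t'⟩, acc⟩ hs -
    · exact ⟨by simp [cases', Tm.cost, Tm.val], by simpa [cases', Tm.val] using hs⟩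
    · exact ⟨by simp [cases', Tm.cost, Tm.val], by simpa [cases', Tm.val] using hs⟩
    · exact ⟨by simp [cases', Tm.cost, Tm.val], by simpa [cases', Tm.val] using hs⟩
    · simp only [List.length_cons] at hs
      by_cases hx : x ≤ x'
      · refine ⟨by simp [cases', Tm.cost, Tm.val, hx], ?_⟩
        simp only [cases', Tm.val, hx, decide_true, if_true, List.length_cons]
        omega
      · refine ⟨by simp [cases', Tm.cost, Tm.val, hx], ?_⟩
        simp only [cases', Tm.val, hx, decide_false, if_false, List.length_cons, Bool.false_eq_true]
        omega
  · have h3 := cost_append d τ (Tm.var s).fst (Tm.var s).snd.fst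
    refine (cost_revAppend d τ _ _).trans ?_
    simp only [Tm.cost, Tm.val] at h3 ⊢
    omega
  · simp only [Tm.cost]
    omega

/-- In the induction, the summand `75 * s.1.flatten.length` reserves the share of the waiting list
in the merge to come. -/
theorem runs_mergePass (ls : List (List K)) :
    Runs d τ (mergePass (.var ls) : Tm (Ty.Val ι K) (.list (.list .dst)))
      (30 + 90 * (ls.length + ls.flatten.length)) fun ls' => ls' = mergePairs ls := by
  let f : List (List K) × List (List K) → List K →
      Tm (Ty.Val ι K) (.prod (.list (.list .dst)) (.list (.list .dst))) :=
    fun y x => .casesV (Tm.fst (a := .list (.list .dst)) (b := .list (.list .dst)) (.var y))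
      (.pair (.cons (.var x) .nil) (.snd (a := .list (.list .dst)) (.var y)))
      fun p _ => .pair .nil (.cons (merge (.var p) (.var x)) (.snd (a := .list (.list .dst)) (.var y)))
  have main : ∀ (ls : List (List K)) (s : List (List K) × List (List K)), s.1.length ≤ 1 →
      foldlCost (fun y x => (f y x).val d) (fun y x => (f y x).cost d τ) s ls ≤
        1 + 90 * (ls.length + ls.flatten.length) + 75 * s.1.flatten.length ∧
      List.length (ls.foldl (fun y x => (f y x).val d) s).1 ≤ 1 := by
    intro ls
    induction ls with
    | nil => intro s hs; exact ⟨by simp [foldlCost], hs⟩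
    | cons l ls ih =>
      rintro ⟨_ | ⟨p, _ | _⟩, out⟩ hs
      · obtain ⟨h1, h2⟩ := ih ((f ([], out) l).val d) (by simp [f, Tm.val])
        refine ⟨?_, h2⟩
        have h3 : ((f ([], out) l).cost d τ) = 9 := by simp [f, Tm.val, Tm.cost]
        have h4 : List.length (((f ([], out) l).val d).1 : List (List K)).flatten = l.length := by
          simp [f, Tm.val]
        simp only [foldlCost, List.length_cons, List.flatten_cons, List.length_append]
        omega
      · obtain ⟨h1, h2⟩ := ih ((f ([p], out) l).val d) (by simp [f, Tm.val])
        refine ⟨?_, h2⟩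
        have h5 := (runs_merge (d := d) (τ := τ) p l).cost
        have h3 : ((f ([p], out) l).cost d τ) ≤ 10 + 75 * (1 + p.length + l.length) := by
          change 1 + 2 + (1 + 1 + (1 + _ + 2)) ≤ _
          omega
        have h4 : List.length (((f ([p], out) l).val d).1 : List (List K)).flatten = 0 := by
          simp [f, Tm.val]
        simp only [foldlCost, List.length_cons, List.flatten_cons, List.length_append,
          List.flatten_nil, List.length_nil]
        omega
      · simp at hs
  refine ⟨?_, val_mergePass ..⟩
  obtain ⟨h1, h2⟩ := main ls ([], []) (by simp)
  have h3 := fun s => cost_append d τ (Tm.fst (.var s : Tm (Ty.Val ι K)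
    (.prod (.list (.list .dst)) (.list (.list .dst))))) (.snd (.var s))
  simp only [mergePass, bind', foldl', Tm.cost, Tm.val] at h3 ⊢
  refine (Nat.add_le_add_left (h3 _) _).trans ?_
  simp only [List.flatten_nil, List.length_nil] at h1
  change 1 + (1 + 3 + foldlCost (fun y x => (f y x).val d) (fun y x => (f y x).cost d τ) ([], []) ls)
    + (5 + List.length (ls.foldl (fun y x => (f y x).val d) ([], [])).1 * 4) ≤ _
  omega

/-- A pass over `m` entries in at most `m` lists is linear in `m`, and it lowers `Nat.clog 2` of the
number of lists by one. -/
theorem runs_sort {l : Tm (Ty.Val ι K) (.list .dst)} {c m : ℕ}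
    (hl : Runs d τ l c fun l => l.length = m) :
    Runs d τ (sort l) (c + 500 * (m + 1) * (Nat.clog 2 m + 1)) fun R => R.length = m := by
  refine ⟨?_, (val_sort d l).2.length_eq.trans hl.val⟩
  have key : Runs d τ (sort l) (1 + c + (1 + ((3 + 4 * m) + (3 + 6 * m) +
      (Nat.clog 2 m + 1) * (1 + 2 * (30 + 180 * m))) + 1)) fun _ => True := by
    refine Runs.bind hl fun x hx => ?_
    have h1 := cost_length d τ (.var x : Tm (Ty.Val ι K) (.list .dst))
    have h2 := cost_map_le d τ (.var x : Tm (Ty.Val ι K) (.list .dst))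
      (fun x => .cons x .nil) 3 (fun x _ => by simp only [Tm.cost]; omega)
    have h3 := Runs.while_rank (d := d) (τ := τ) (ι := ι) (K := K) (A := 3 + 4 * m)
      (B := 3 + 6 * m) (r := Nat.clog 2 m) (C := 30 + 180 * m)
      (m := length (.var x : Tm (Ty.Val ι K) (.list .dst)))
      (s := map (.var x : Tm (Ty.Val ι K) (.list .dst)) fun x => .cons x .nil)
      (p := fun ls => not' (isNil (tail ls))) (f := mergePass)
      (Inv := fun ls : List (List K) => SortInv x ls ∧ ls.length ≤ m)
      (fun ls : List (List K) => Nat.clog 2 ls.length) ?_ ?_ ?_ ?_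
    · refine ⟨?_, trivial⟩
      have h4 := h3.cost
      simp only [head, cases', Tm.cost]
      split <;> omega
    · simp only [Tm.cost] at h1
      change List.length x = m at hx
      simp only [Tm.val, hx] at h1
      omega
    · change List.length x = m at hx
      simp only [Tm.cost, Tm.val, hx] at h2
      refine ⟨by omega, ?_⟩
      rw [val_map]
      simp only [Tm.val]
      exact ⟨⟨SortInv.start x, by simp [hx]⟩, by simp [hx]⟩
    · rintro (_ | ⟨l, _ | _⟩) _ <;> simp [tail, isNil, not', cases', Tm.cost, Tm.val] <;> omega
    · rintro ls ⟨h4, h5⟩ h6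
      have h7 := runs_mergePass (d := d) (τ := τ) (ι := ι) ls
      have h8 : ls.flatten.length = m := h4.2.length_eq.trans hx
      have h9 := (mergePairs_spec ls h4.1).2.2
      refine h7.mono (by omega) ?_
      rintro _ rfl
      refine ⟨⟨h4.mergePairs, by omega⟩, ?_⟩
      rw [h9]
      simp only [val_not', val_isNil, val_tail, Tm.val] at h6
      have h10 : 2 ≤ ls.length := by
        rcases ls with _ | ⟨x, _ | ⟨y, s⟩⟩ <;> simp at h6 ⊢
      have h11 := Nat.clog_of_two_le (b := 2) (by norm_num) h10
      rw [show ls.length + 2 - 1 = ls.length + 1 from rfl] at h11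
      omega
  refine key.cost.trans ?_
  have h1 : (Nat.clog 2 m + 1) * (1 + 2 * (30 + 180 * m)) ≤
      (Nat.clog 2 m + 1) * (400 * (m + 1)) := Nat.mul_le_mul_left _ (by omega)
  have h2 : 1 * (m + 1) ≤ (Nat.clog 2 m + 1) * (m + 1) := Nat.mul_le_mul_right _ (by omega)
  have h3 : (Nat.clog 2 m + 1) * (400 * (m + 1)) = 400 * ((Nat.clog 2 m + 1) * (m + 1)) := by ring
  have h4 : 500 * (m + 1) * (Nat.clog 2 m + 1) = 500 * ((Nat.clog 2 m + 1) * (m + 1)) := by ring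
  omega

end Costs
end Prog

namespace Prog

/-! ### Costs of the selection, the region codes and the labels. -/

section Parts

variable {ι K : Type} [LinearOrder K] {d : ι → ι → K} {τ : ι → ι → ℕ} {a b : Ty}

theorem runs_sort_le {l : Tm (Ty.Val ι K) (.list .dst)} {c m : ℕ}
    (hl : Runs d τ l c fun l => l.length ≤ m) :
    Runs d τ (sort l) (c + 500 * (m + 1) * (Nat.clog 2 m + 1)) fun R =>
      R.length ≤ m ∧ List.Pairwise (· ≤ ·) (R : List K) := by
  have h := runs_sort (d := d) (τ := τ) (m := List.length (l.val d)) ⟨hl.cost, rfl⟩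
  refine ⟨h.cost.trans ?_, h.val.trans_le hl.val, (val_sort d l).1⟩
  have h1 : Nat.clog 2 (List.length (l.val d)) ≤ Nat.clog 2 m := Nat.clog_mono_right 2 hl.val
  have h2 := hl.val
  gcongr

theorem Runs.fst {t : Tm (Ty.Val ι K) (.prod a b)} {c : ℕ} {P : a.Val ι K → Prop}
    (h : Runs d τ t c fun x => P x.1) : Runs d τ (.fst t) (1 + c) P :=
  ⟨by have := h.cost; simp only [Tm.cost]; omega, h.val⟩

theorem Runs.snd {t : Tm (Ty.Val ι K) (.prod a b)} {c : ℕ} {P : b.Val ι K → Prop}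
    (h : Runs d τ t c fun x => P x.2) : Runs d τ (.snd t) (1 + c) P :=
  ⟨by have := h.cost; simp only [Tm.cost]; omega, h.val⟩

theorem Runs.pair {s : Tm (Ty.Val ι K) a} {t : Tm (Ty.Val ι K) b} {A B : ℕ} {P : a.Val ι K → Prop}
    {Q : b.Val ι K → Prop} (hs : Runs d τ s A P) (ht : Runs d τ t B Q) :
    Runs d τ (.pair s t) (1 + A + B) fun x => P x.1 ∧ Q x.2 :=
  ⟨by have := hs.cost; have := ht.cost; simp only [Tm.cost]; omega, hs.val, ht.val⟩

theorem Runs.map {l : Tm (Ty.Val ι K) (.list a)} {f : Tm (Ty.Val ι K) a → Tm (Ty.Val ι K) b}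
    {A C r : ℕ} {E : a.Val ι K → Prop} {E' : b.Val ι K → Prop}
    (hl : Runs d τ l A fun l => l.length ≤ r ∧ ∀ x ∈ l, E x)
    (hf : ∀ x, E x → Runs d τ (f (.var x)) C E') :
    Runs d τ (map l f) (A + 2 + r * (C + 3)) fun l => l.length ≤ r ∧ ∀ x ∈ l, E' x := by
  obtain ⟨h1, h2⟩ := hl.val
  constructor
  · refine (cost_map_le d τ l f C fun x hx => (hf x (h2 x hx)).cost).trans ?_
    have := hl.cost
    gcongr
  · rw [val_map]
    refine ⟨by simpa using h1, fun y hy => ?_⟩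
    obtain ⟨x, hx, rfl⟩ := List.mem_map.1 hy
    exact (hf x (h2 x hx)).val

theorem Runs.append {l l' : Tm (Ty.Val ι K) (.list a)} {A B r r' : ℕ}
    (hl : Runs d τ l A fun l => l.length ≤ r) (hl' : Runs d τ l' B fun l => l.length ≤ r') :
    Runs d τ (append l l') (A + B + 1 + r * 4) fun l => l.length ≤ r + r' := by
  have h1 := hl.cost
  have h2 := hl'.cost
  have h3 := hl.val
  have h4 := hl'.val
  constructor
  · exact (cost_append d τ l l').trans (by omega)
  · rw [val_append, List.length_append]
    omega

/-- The invariant depends on the number of the round, because the list of selected points grows. -/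
theorem Runs.repeat {m : Tm (Ty.Val ι K) .num} {s : Tm (Ty.Val ι K) b}
    {f : Tm (Ty.Val ι K) b → Tm (Ty.Val ι K) b} {A B C r : ℕ} (Inv : ℕ → b.Val ι K → Prop)
    (hm : Runs d τ m A fun q => ⌊(q : ℚ)⌋₊ = r) (hs : Runs d τ s B (Inv 0))
    (hf : ∀ i < r, ∀ y, Inv i y → Runs d τ (f (.var y)) C (Inv (i + 1))) :
    Runs d τ (repeat' m s f) (A + B + 1 + r * (2 + C)) (Inv r) := by
  have main : ∀ (j i : ℕ) (y : b.Val ι K), i + j = r → Inv i y →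
      loopCost (fun _ => true) (fun y => (f (.var y)).val d) (fun _ => 1)
        (fun y => (f (.var y)).cost d τ) j y ≤ 1 + j * (2 + C) ∧
      Inv r (loopVal (fun _ => true) (fun y => (f (.var y)).val d) j y) := by
    intro j
    induction j with
    | zero => intro i y h hy; exact ⟨by simp [loopCost], by rwa [← h]⟩
    | succ j ih =>
      intro i y h hy
      have h1 := hf i (by omega) y hy
      obtain ⟨h2, h3⟩ := ih (i + 1) _ (by omega) h1.val
      have h4 := h1.cost
      refine ⟨?_, h3⟩
      simp only [loopCost, if_true, add_mul, one_mul] at h2 ⊢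
      omega
  obtain ⟨h1, h2⟩ := main r 0 _ (by omega) hs.val
  have h3 := hm.cost
  have h4 := hs.cost
  have h5 := hm.val
  refine ⟨?_, ?_⟩
  · simp only [repeat', while', Tm.cost, Tm.val, h5]
    omega
  · simp only [repeat', while', Tm.val, h5]
    exact h2

theorem runs_gonzalez {ps : List ι} {s₁ : ι} {k M : ℕ} (hτ : ∀ i j, τ i j ≤ M) (hk : 1 ≤ k) :
    Runs d τ (gonzalez (.var ps) (.var s₁) (.var (k : ℚ)) : Tm (Ty.Val ι K) (.list .pt))
      (100 * (k + 1) ^ 2 * (ps.length + 1) * (M + 1)) fun S => S.length ≤ k := by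
  obtain ⟨n, hn⟩ : ∃ n, n = ps.length := ⟨_, rfl⟩
  have hround : ∀ (i : ℕ) (y : Ty.Val ι K (.prod (.list .pt) (.list (.prod .pt .dst)))),
      List.length y.1 ≤ i + 1 ∧ List.length y.2 ≤ n →
      Runs d τ (bind' (.fst (foldl' (.snd (.var y))
        (.pair (.var s₁) (.dist (.var s₁) (.var s₁))) fun best e =>
        .ite (.leD (.snd e) (.snd best)) best e)) fun q =>
      .pair (append (.fst (.var y)) (.cons q .nil))
        (map (.snd (.var y)) fun e => bind' (.dist (.fst e) q) fun x =>
          .pair (.fst e) (.ite (.leD x (.snd e)) x (.snd e))) :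
        Tm (Ty.Val ι K) (.prod (.list .pt) (.list (.prod .pt .dst))))
      (40 + 4 * i + M + n * (40 + M))
      fun y => List.length y.1 ≤ i + 1 + 1 ∧ List.length y.2 ≤ n := by
    rintro i y ⟨h1, h2⟩
    have hsnd : Runs d τ (.snd (.var y))
        2 fun l => l.length ≤ n ∧ ∀ x ∈ l, True := ⟨by simp [Tm.cost], h2, by simp⟩
    refine Runs.mono (.bind (P := fun _ => True) (.fst (.foldl (C := 8) (B := M + 5)
      (Inv := fun _ => True) hsnd ⟨?_, trivial⟩ fun _ _ _ _ => ⟨?_, trivial⟩)) fun q _ =>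
      .pair (.append (A := 2) (B := 3) (r := i + 1) (r' := 1) ⟨?_, h1⟩ ⟨?_, ?_⟩)
        (.map (C := 20 + M) (E' := fun _ => True) hsnd fun _ _ => ⟨?_, trivial⟩)) ?_ ?_
    · have := hτ s₁ s₁
      simp only [Tm.cost, Tm.val]; omega
    · simp only [Tm.cost]; split <;> omega
    · simp [Tm.cost]
    · simp [Tm.cost]
    · simp [Tm.val]
    · simp only [bind', Tm.cost, Tm.val]
      refine (Nat.add_le_add (Nat.add_le_add_left (Nat.add_le_add_right (Nat.add_le_add_right
        (Nat.add_le_add_left (hτ _ _) _) _) _) _)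
        (Nat.add_le_add_left (m := 7) ?_ _)).trans ?_
      · exact (by decide : ∀ b : Bool, (1 + (1 + 1 + (1 + 1)) + if b = true then 1 else 1 + 1) ≤ 7) _
      · omega
    · ring_nf
      omega
    · exact fun _ h => ⟨h.1, h.2.1⟩
  refine Runs.mono (.fst (P := fun S => List.length S ≤ k - 1 + 1) (.mono (.repeat (A := 3) (B := 8 + n * (M + 8)) (C := 40 + 4 * k + M + n * (40 + M))
    (fun i (y : Ty.Val ι K (.prod (.list .pt) (.list (.prod .pt .dst)))) =>
      List.length y.1 ≤ i + 1 ∧ List.length y.2 ≤ n) (r := k - 1) ⟨?_, ?_⟩ ⟨?_, ?_⟩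
      fun i hi y hy => (hround i y hy).mono ?_ fun _ h => h) le_rfl fun _ h => h.1)) ?_ fun _ h => h.trans (by omega)
  · change 1 + 1 + 1 ≤ 3
    rfl
  · rw [val_hsub]
    simp only [Tm.val]
    rw [← Nat.cast_one, ← Nat.cast_sub hk, Nat.floor_natCast]
  · have h1 := cost_map_le d τ (.var ps) (fun p => (p.pair (p.dist (.var s₁)) :
      Tm (Ty.Val ι K) (.prod .pt .dst))) (M + 5) (fun x _ => by
        have := hτ x s₁; simp only [Tm.cost, Tm.val]; omega)
    simp only [Tm.cost, Tm.val, ← hn] at h1 ⊢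
    have h2 : n * (M + 5 + 3) = n * (M + 8) := rfl
    omega
  · simp [Tm.val, hn]
  · omega
  · rw [← hn]
    -- A round needs about one distance for each point. All terms are measured in multiples of `p`,
    -- which keeps the estimate linear.
    obtain ⟨p, hp⟩ : ∃ p, p = (n + 1) * (M + 1) := ⟨_, rfl⟩
    have h1 : 1 ≤ p := by rw [hp]; nlinarith
    have h2 : n * (M + 8) ≤ 8 * p := by rw [hp]; nlinarith
    have h3 : 42 + 4 * k + M + n * (40 + M) ≤ 84 * ((k + 1) * p) := by
      have h4 : M + n * (40 + M) ≤ 40 * p := by rw [hp]; nlinarith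
      have h5 : k * 1 ≤ k * p := Nat.mul_le_mul_left _ h1
      nlinarith
    have h4 : (k - 1) * (2 + (40 + 4 * k + M + n * (40 + M))) ≤ (k + 1) * (84 * ((k + 1) * p)) :=
      Nat.mul_le_mul (by omega) (by omega)
    have h5 : 100 * (k + 1) ^ 2 * (n + 1) * (M + 1) = 100 * ((k + 1) * ((k + 1) * p)) := by
      rw [hp]; ring
    have h6 : (k + 1) * (84 * ((k + 1) * p)) = 84 * ((k + 1) * ((k + 1) * p)) := by ring
    have h7 : 2 * (2 * p) ≤ (k + 1) * ((k + 1) * p) :=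
      Nat.mul_le_mul (by omega) (Nat.mul_le_mul (by omega) le_rfl)
    omega

end Parts
end Prog

namespace Prog

section Parts

variable {ι K : Type} [LinearOrder K] {d : ι → ι → K} {τ : ι → ι → ℕ} {a b : Ty}

theorem Runs.ite {p : Tm (Ty.Val ι K) .bool} {s t : Tm (Ty.Val ι K) a} {A B : ℕ}
    (hp : p.cost d τ ≤ A) (hs : s.cost d τ ≤ B) (ht : t.cost d τ ≤ B) :
    Runs d τ (.ite p s t) (1 + A + B) fun _ => True :=
  ⟨by simp only [Tm.cost]; split_ifs <;> omega, trivial⟩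

theorem runs_codes {T : List (List K)} {t : List ℚ} {r : Tm (Ty.Val ι K) .dst} {n k : ℕ}
    (hT : T.length ≤ n) (ht : t.length ≤ k) (ht' : ∀ i ∈ t, ⌊i⌋₊ ≤ k) (hr : r.cost d τ ≤ 4) :
    Runs d τ (codes (.var T) (.var t) r) (3 + n * (50 * (k + 1) ^ 2)) fun cs => cs.length ≤ n := by
  refine Runs.mono (.map (A := 1) (r := n) (E := fun _ => True) (E' := fun _ => True)
    (C := 6 + k * (30 + 7 * k)) ⟨by simp [Tm.cost], hT, by simp⟩ fun row _ => Runs.mono (.snd (P := fun _ => True)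
    (.foldl (A := 1) (B := 3) (C := 28 + 7 * k) (r := k) (Inv := fun _ => True) (a := .num)
      (E := fun i : ℚ => ⌊i⌋₊ ≤ k)
      ⟨by simp [Tm.cost], ht, ht'⟩ ⟨by simp [Tm.cost], trivial⟩ fun s _ i hi =>
      Runs.mono (.pair (A := 4) (P := fun _ => True) (Q := fun _ => True) ⟨?_, trivial⟩
        (.ite (A := 14 + 7 * k) (B := 5) ?_ ?_ ?_)) ?_ fun _ _ => trivial)) ?_ fun _ _ => trivial) ?_
    fun _ h => h.1
  · exact le_refl 4
  · have h := cost_nth d τ r (.var row) (.var i)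
    simp only [Tm.cost, Tm.val] at h ⊢
    have : ⌊(i : ℚ)⌋₊ ≤ k := hi
    omega
  · exact le_refl 5
  · simp [Tm.cost]
  · omega
  · have : 1 + (28 + 7 * k) = 29 + 7 * k := by omega
    rw [this, show 30 + 7 * k = 1 + (29 + 7 * k) by omega, Nat.mul_add k 1]
    omega
  · have h : 6 + k * (30 + 7 * k) + 3 ≤ 50 * (k + 1) ^ 2 := by nlinarith
    have := Nat.mul_le_mul_left n h
    omega

theorem pick_length (c : ℚ) (es : List (ℚ × ℚ × ℚ)) : (pick c es).2.2.length = es.length := by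
  induction es with
  | nil => rfl
  | cons e es ih =>
    unfold pick at ih ⊢
    rw [List.foldr_cons]
    split_ifs <;> simp only [List.length_cons, ih]

theorem runs_labels {cs : Tm (Ty.Val ι K) (.list .num)} {es : List (ℚ × ℚ × ℚ)} {A n N : ℕ}
    (hcs : Runs d τ cs A fun cs => cs.length ≤ n) (hes : es.length ≤ N) :
    (labels cs (.var es)).cost d τ ≤ A + 10 + n * (20 + 50 * (N + 1)) := by
  refine (Runs.mono (.snd (P := fun _ => True) (.mono (.foldr (b := .prod (.list Entry) (.list .num)) (r := n)
    (E := fun _ => True) (B := 3) (C := 15 + 50 * (N + 1))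
    (Inv := fun s : List (ℚ × ℚ × ℚ) × List ℚ => s.1.length ≤ N) (hcs.mono le_rfl fun _ h => ⟨h, by simp⟩)
    ⟨by simp [Tm.cost], by simpa [Tm.val] using hes⟩
    fun s hs c _ => Runs.mono (.bind (c' := 10) (a := .prod .bool (.prod .num (.list Entry)))
      (c := 4 + 50 * (N + 1)) (P := fun u : Bool × ℚ × List (ℚ × ℚ × ℚ) => u.2.2.length ≤ N) ⟨?_, ?_⟩
      fun u hu => ⟨?_, ?_⟩) ?_ fun _ h => h) le_rfl fun _ _ => trivial)) ?_ fun _ _ => trivial).cost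
  · suffices h : Runs d τ _ (2 + 5 + 1 + N * (1 + 40)) (fun _ => True) from
      h.cost.trans (b := 2 + 5 + 1 + N * (1 + 40)) (by omega)
    refine .foldr (E := fun _ => True) (Inv := fun _ => True) ⟨by simp [Tm.cost], hs, by simp⟩
      ⟨by simp [Tm.cost], trivial⟩
      fun u _ e _ => .mono (.ite (A := 15) (B := 23) ?_ ?_ ?_) (by omega) fun _ h => h
    · exact (Runs.ite (A := 4) (B := 10) (Runs.ite (A := 2) (B := 1) (by simp [Tm.cost])
        (by simp [Tm.cost]) (by simp [Tm.cost])).cost (Runs.ite (A := 4) (B := 5)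
        (by simp [Tm.cost]) (by simp [Tm.cost]) (by simp [Tm.cost])).cost (by simp [Tm.cost])).cost
    · simp only [Tm.cost]
      change 1 + 1 + (1 + 3 + (1 + (1 + 2 + (1 + 3 + 5)) + 3)) ≤ 23
      omega
    · simp [Tm.cost]
  · simp only [val_foldr', Tm.val, val_and', val_not', val_hsub]
    exact (pick_length c s.1).trans_le hs
  · simp [Tm.cost]
  · exact hu
  · omega
  · have : 1 + (15 + 50 * (N + 1)) ≤ 20 + 50 * (N + 1) := by omega
    have := Nat.mul_le_mul_left n this
    omega

end Parts
end Prog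

namespace Prog

/-! ### The total running time. -/

section Total

/-- The records that a search can find: tuples of positions up to `k`, and lists of length at most
`m`. -/
def SmallRecord {K : Type} (k m : ℕ) (b : K × List ℚ × List ℚ) : Prop :=
  (b.2.1.length ≤ k ∧ ∀ i ∈ b.2.1, ⌊i⌋₊ ≤ k) ∧ b.2.2.length ≤ m

/-- The invariant of the search is reused with `SmallRecord` in the role of the good records. A
round costs a walk to the middle of `R`, the region codes, and one elimination; the number of rounds
is governed by the binary length of `m`. -/
theorem exists_runs_search : ∃ F : ℕ → ℕ, ∀ {ι K : Type} [LinearOrder K] (d : ι → ι → K)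
    (τ : ι → ι → ℕ) (k n m N : ℕ) (L U : ℚ) (regs : List (ℚ × List ℚ)) (vs : List (ℚ × ℚ))
    (T : List (List K)) (R : List K) (best : K × List ℚ × List ℚ) (t : List ℚ), k ≤ N →
    Ty.size (.list (.prod .num (.list .num))) (ι := ι) (K := K) regs ≤ N →
    Ty.size (.list (.prod .num .num)) (ι := ι) (K := K) vs ≤ N →
    T.length ≤ n → R.Pairwise (· ≤ ·) → R.length ≤ m → t.length ≤ k → (∀ i ∈ t, ⌊i⌋₊ ≤ k) →
    SmallRecord k (F N) best →
    Runs d τ (search (.var (k : ℚ)) (.var L) (.var U) (.var regs) (.var vs) (.var T) (.var R)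
        (.var best) (.var t))
      (20 + 4 * m + (m.size + 1) * (1 + 2 * (80 + 7 * m + n * (50 * (k + 1) ^ 2) + F N * (n + 1))))
      (SmallRecord k (F N)) := by
  obtain ⟨F, hF⟩ := exists_bd_solve
  refine ⟨F, ?_⟩
  intro ι K _ d τ k n m N L U regs vs T R best t hk hregs hvs hT hR hm ht ht' hbest
  have hsolve := fun (cs : List ℚ) (hcs : cs.length ≤ n) =>
    hF d τ n N (k : ℚ) L U regs vs cs (by simpa using hk) hregs hvs hcs
  have hlen : (T.map (codeOf t best.1)).length ≤ n := by simpa using hT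
  have hg : ∀ r, (solveFor k L U regs vs T t r).1 = true →
      SmallRecord k (F N) (r, t, (solveFor k L U regs vs T t r).2) := by
    intro r _
    refine ⟨⟨ht, ht'⟩, ?_⟩
    have h := (hsolve (T.map (codeOf t r)) (by simpa using hT)).size
    rw [val_solve, val_system d _ _ _ _ _ _ (n := k) rfl, val_length, Nat.floor_natCast] at h
    have h2 := length_le_size (ι := ι) (K := K) (a := .num) (solveFor k L U regs vs T t r).2
    refine h2.trans (le_trans ?_ h)
    exact Nat.le_add_left _ _
  have hrec := searchStep_spec (R := R) (g := solveFor k L U regs vs T t) (t := t)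
    (Good := SmallRecord k (F N)) (best₀ := best) hR hg
  refine Runs.mono (.bind (a := .num) (c := 3 + 4 * m) (P := fun q : ℚ => q = (R.length : ℚ)) ⟨?_, ?_⟩
    fun q hq => .snd (.mono (.while_rank (A := 1) (B := 5)
      (C := 80 + 7 * m + n * (50 * (k + 1) ^ 2) + F N * (n + 1)) (r := m.size)
      (Inv := fun s : (ℚ × ℚ) × K × List ℚ × List ℚ =>
        ∃ lo hi, SearchInv R (solveFor k L U regs vs T t) (SmallRecord k (F N)) best lo hi s)
      searchRank ?_ ⟨?_, ?_⟩ ?_ ?_) le_rfl ?_)) ?_ fun _ h => h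
  · refine (cost_length (a := .dst) d τ (.var R)).trans ?_
    simp only [Tm.cost, Tm.val]
    omega
  · rw [val_length]
    rfl
  · exact le_refl 1
  · exact le_refl 5
  · subst hq
    have h0 := SearchInv.start (g := solveFor k L U regs vs T t) (R := R) (best₀ := best) (.inl hbest)
    refine ⟨⟨_, _, h0⟩, h0.rank.trans_le ?_⟩
    exact Nat.size_le_size (by omega)
  · intro y _
    have : (not' ((Tm.var y).fst.snd.le (Tm.var y).fst.fst)).cost d τ ≤ 9 := by
      simp only [not', Tm.cost]
      split <;> omega
    omega
  · intro y hy hlt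
    have h1 := hrec y hy (by rwa [val_not'] at hlt)
    refine ⟨?_, ?_⟩
    · suffices h : Runs d τ _ (1 + 10 + (1 + (8 + 7 * m) + (1 + (3 + n * (50 * (k + 1) ^ 2)) +
          (1 + F N * (n + 1) + (1 + 2 + 18))))) (fun _ => True) from
        h.cost.trans (b := 1 + 10 + (1 + (8 + 7 * m) + (1 + (3 + n * (50 * (k + 1) ^ 2)) +
          (1 + F N * (n + 1) + (1 + 2 + 18))))) (by omega)
      refine .bind (a := .num) (P := fun q : ℚ => ⌊q⌋₊ ≤ m) ⟨le_refl 10, ?_⟩ fun mid hmid =>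
        .bind (a := .dst) (P := fun _ => True) ⟨(cost_nth d τ _ _ _).trans ?_, trivial⟩ fun r _ =>
        .bind (runs_codes hT ht ht' (by simp [Tm.cost])) fun cs hcs =>
        .bind (P := fun _ => True) ⟨(hsolve cs hcs).cost, trivial⟩ fun x _ => .ite ?_ ?_ ?_
      · obtain ⟨lo, hi, hy⟩ := hy
        refine Nat.floor_le_of_le ?_
        have h2 : ((y.1.1 : ℚ) + y.1.2) / 2 ≤ m := by
          rw [hy.bounds]
          have h3 : (lo : ℚ) ≤ hi := Nat.cast_le.2 hy.le
          have h4 : (hi : ℚ) ≤ m := Nat.cast_le.2 (hy.le_length.trans hm)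
          simp only
          linarith
        exact (Int.floor_le _).trans h2
      · have h2 : ⌊(mid : ℚ)⌋₊ ≤ m := hmid
        simp only [Tm.cost, Tm.val]
        omega
      · simp [Tm.cost]
      · have h2 : ∀ b : Bool, (if b = true then 1 + 1 + (1 + 1 + (1 + 1)) else 1 + 1) ≤ 6 := by decide
        simp only [Tm.cost]
        have h3 := h2 ((Tm.leD (.var r) (.fst (.snd (.var y)))).val d)
        omega
      · exact (by omega : 10 ≤ 18)
    · have h2 : ∀ z, z = searchStep R (solveFor k L U regs vs T t) t y →
          (∃ lo hi, SearchInv R (solveFor k L U regs vs T t) (SmallRecord k (F N)) best lo hi z) ∧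
            searchRank z < searchRank y := by
        rintro _ rfl
        exact h1
      refine h2 _ ?_
      have hsys := fun cs => val_system d (.var (k : ℚ)) (.var L) (.var U) (.var regs) (.var vs) cs rfl
      simp only [val_bind', Tm.val, val_hdiv, val_nth, val_solve, hsys, val_codes,
        val_length, Nat.floor_natCast]
      rfl
  · rintro y ⟨lo, hi, h⟩
    exact h.good_of hbest
  · omega

end Total
end Prog

namespace Prog

section Total

theorem runs_table {ι K : Type} [LinearOrder K] {d : ι → ι → K} {τ : ι → ι → ℕ} {M k n : ℕ}
    {ps S : List ι} (hτ : ∀ i j, τ i j ≤ M) (hn : ps.length ≤ n) (hS : S.length ≤ k) :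
    Runs d τ (map (.var ps) fun p => map (.var S) fun s => .dist p s :
      Tm (Ty.Val ι K) (.list (.list .dst))) (3 + n * (6 + k * (6 + M)))
      fun T => T.length ≤ n ∧ ∀ row ∈ T, List.length row ≤ k := by
  refine Runs.mono (.map (a := .pt) (b := .list .dst) (A := 1) (r := n) (E := fun _ => True) (C := 3 + k * (6 + M))
    (E' := fun row => List.length row ≤ k) ⟨le_refl 1, hn, by simp⟩ fun p _ =>
    .mono (.map (a := .pt) (b := .dst) (A := 1) (r := k) (E := fun _ => True) (C := 3 + M) (E' := fun _ => True)
    ⟨le_refl 1, hS, by simp⟩ fun s _ => ⟨?_, trivial⟩) ?_ fun _ h => h.1) ?_ fun _ h => h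
  · have := hτ p s
    simp only [Tm.cost, Tm.val]
    omega
  · have : k * (3 + M + 3) = k * (6 + M) := by ring
    omega
  · have : n * (3 + k * (6 + M) + 3) = n * (6 + k * (6 + M)) := by ring
    omega

theorem runs_flatten {ι K : Type} [LinearOrder K] {d : ι → ι → K} {τ : ι → ι → ℕ} {k n : ℕ}
    {T : List (List K)} (hT : T.length ≤ n) (hT' : ∀ row ∈ T, row.length ≤ k) :
    Runs d τ (flatMap (.var T) fun row => row : Tm (Ty.Val ι K) (.list .dst)) (3 + n * (4 + k * 4))
      fun l => l.length ≤ n * k := by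
  constructor
  · have h : Runs d τ (foldr' (.var T : Tm (Ty.Val ι K) (.list (.list .dst)))
        (.nil : Tm (Ty.Val ι K) (.list .dst)) fun x y => append x y)
        (1 + 1 + 1 + n * (1 + (3 + k * 4))) fun _ => True :=
      .foldr (a := .list .dst) (E := fun row : List K => row.length ≤ k) (Inv := fun _ => True)
        ⟨le_refl 1, hT, hT'⟩ ⟨le_refl 1, trivial⟩
        fun y _ x hx => ⟨(cost_append d τ _ _).trans ?_, trivial⟩
    refine h.cost.trans ?_
    rotate_left
    · simp only [Tm.cost, Tm.val]
      have := Nat.mul_le_mul_right 4 hx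
      omega
    · have : n * (1 + (3 + k * 4)) = n * (4 + k * 4) := by ring
      omega
  · simp only [val_flatMap, Tm.val, List.length_flatMap]
    refine (List.sum_le_card_nsmul _ k ?_).trans ?_
    · intro x hx
      obtain ⟨row, hrow, rfl⟩ := List.mem_map.1 hx
      exact hT' row hrow
    · simpa using Nat.mul_le_mul_right k hT

/-- By `k ≤ 2 ^ k`, the factor `k` of the list length adds at most `k` to the logarithm. -/
theorem clog_mul_le (n k : ℕ) : Nat.clog 2 (n * k) ≤ Nat.log 2 n + 1 + k := by
  refine Nat.clog_le_of_le_pow ?_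
  rw [pow_add]
  exact Nat.mul_le_mul (Nat.lt_pow_succ_log_self (by norm_num) n).le Nat.lt_two_pow_self.le

theorem size_mul_le (n k : ℕ) : (n * k).size ≤ Nat.log 2 n + 1 + k := by
  rw [Nat.size_le, pow_add]
  exact Nat.mul_lt_mul_of_lt_of_le (Nat.lt_pow_succ_log_self (by norm_num) n)
    Nat.lt_two_pow_self.le (by positivity)

theorem exists_cost_run (k : ℕ) (hk : 1 ≤ k) : ∃ B : ℕ, ∀ {K : Type} [LinearOrder K] {n : ℕ}
    (d : Fin n → Fin n → K) (τ : Fin n → Fin n → ℕ) (i₀ : Fin n) (L U M : ℕ),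
    (∀ i j, τ i j ≤ M) → (run i₀ k L U).cost d τ ≤ B * (n * (Nat.log 2 n + 1 + M)) := by
  obtain ⟨F₁, hF₁⟩ := exists_bd_regions
  obtain ⟨F₂, hF₂⟩ := exists_bd_sysVars
  obtain ⟨F₃, hF₃⟩ := exists_bd_tuples
  obtain ⟨F₄, hF₄⟩ := exists_runs_search
  obtain ⟨F₅, hF₅⟩ := exists_bd_round
  -- `N` bounds the sizes of the regions and of the variables; `N'` also allows for a record. Both
  -- depend on `k` only.
  obtain ⟨N, hN⟩ : ∃ N, N = k + F₁ k + F₂ (F₁ k) := ⟨_, rfl⟩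
  obtain ⟨N', hN'⟩ : ∃ N', N' = N + k + F₄ N := ⟨_, rfl⟩
  refine ⟨4 * (100 * (k + 1) ^ 2) + (9 + 7 * k) + (7 + 4 * k) + 500 * ((k + 1) * (k + 2)) + (7 + 2 * k) +
    F₁ k + F₂ (F₁ k) + F₃ k + F₃ k * (1 + (20 + 4 * k + (k + 2) *
      (161 + 14 * k + 2 * (50 * (k + 1) ^ 2) + 4 * F₄ N))) + F₅ N' + k * (10 + 7 * k) +
    50 * (k + 1) ^ 2 + (20 + 50 * (F₅ N' + 1)) + 100, ?_⟩
  intro K _ n d τ i₀ L U M hτ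
  obtain ⟨ℓ, hℓ⟩ : ∃ ℓ, ℓ = Nat.log 2 n := ⟨_, rfl⟩
  -- Each part of the cost below is compared with a multiple of `W` by a factor that depends on `k`
  -- only.
  obtain ⟨W, hW⟩ : ∃ W, W = n * (Nat.log 2 n + 1 + M) := ⟨_, rfl⟩
  have hn : 1 ≤ n := i₀.pos
  have hnW : n ≤ W := by rw [hW]; exact Nat.le_mul_of_pos_right _ (by omega)
  have h1W : 1 ≤ W := hn.trans hnW
  have hMW : n * M ≤ W := by rw [hW]; exact Nat.mul_le_mul_left _ (by omega)
  have hℓW : n * (ℓ + 1) ≤ W := by rw [hW, hℓ]; exact Nat.mul_le_mul_left _ (by omega)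
  rw [← hW]
  have hmain : Runs d τ (algorithm (.var (List.finRange n)) (.var i₀) (.var (k : ℚ)) (.var (L : ℚ))
      (.var (U : ℚ))) (1 + 100 * (k + 1) ^ 2 * ((List.finRange n).length + 1) * (M + 1) +
      (1 + (3 + n * (6 + k * (6 + M))) +
        (1 + (3 + n * (4 + k * 4) + 500 * (n * k + 1) * (Nat.clog 2 (n * k) + 1)) +
          (1 + (6 + M + n * k * 2) +
            (1 + F₁ k +
              (1 + F₂ (F₁ k) +
                (1 + (F₃ k + 5 + 1 + F₃ k * (1 + (20 + 4 * (n * k) + ((n * k).size + 1) *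
                  (1 + 2 * (80 + 7 * (n * k) + n * (50 * (k + 1) ^ 2) + F₄ N * (n + 1)))))) +
                  (1 + 3 +
                    (1 + F₅ N' +
                      (1 + (3 + k * (10 + 7 * k)) +
                        (3 + n * (50 * (k + 1) ^ 2) + 10 + n * (20 + 50 * (F₅ N' + 1)))))))))))))
      fun _ => True := by
    have hround : ∀ (vs : List (ℚ × ℚ)) (best : K × List ℚ × List ℚ),
        Ty.size (ι := Fin n) (K := K) (.list (.prod .num .num)) vs ≤ F₂ (F₁ k) →
        SmallRecord k (F₄ N) best → Bd d τ 0 F₅ N' (round (.var (k : ℚ)) (zipWith (.var vs)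
          (.snd (.snd (.var (a := Record) best))) fun v x => .pair (.fst v) (.pair (.snd v) x))) := by
      intro vs best hvs hbest
      refine hF₅ d τ 0 N' k vs best (by exact_mod_cast (by omega)) (by omega) ?_
      have h1 := hbest.1.1
      have h2 := hbest.2
      simp only [Ty.size, List.map_const', List.sum_replicate, smul_eq_mul]
      omega
    refine .mono (.bind (runs_gonzalez hτ hk) fun S hS =>
      .bind (runs_table hτ (n := n) (by simp) hS) fun T hT =>
      .bind (runs_sort_le (runs_flatten hT.1 hT.2)) fun R hR =>
      .bind (c := 6 + M + n * k * 2) (P := fun _ => True) ?_ fun rMax _ =>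
      .bind (c := F₁ k) (P := fun regs => Ty.size _ regs ≤ F₁ k) ?_ fun regs hregs =>
      .bind (c := F₂ (F₁ k)) (P := fun vs => Ty.size _ vs ≤ F₂ (F₁ k)) ?_ fun vs hvs =>
      .bind (.foldl (a := .list .num) (A := F₃ k) (B := 5) (E := fun t : List ℚ => t.length ≤ k ∧ ∀ i ∈ t, ⌊i⌋₊ ≤ k)
        (r := F₃ k) (Inv := SmallRecord k (F₄ N)) ?_ ?_ fun best hbest t ht =>
          hF₄ d τ k n (n * k) N L U regs vs T R best t (by omega) (by omega) (by omega) hT.1 hR.2 hR.1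
            ht.1 ht.2 hbest) fun best hbest =>
      .bind (c := 3) (a := .list .num) (P := fun t : List ℚ => t = best.2.1) ⟨?_, ?_⟩ fun t ht =>
      .bind (c := F₅ N') (P := fun es => List.length es ≤ F₅ N') ⟨?_, ?_⟩ fun es hes =>
      .pair (P := fun _ => True) (Q := fun _ => True) (A := 3 + k * (10 + 7 * k)) ⟨?_, trivial⟩
        ⟨runs_labels (runs_codes (k := k) hT.1 ?_ ?_ ?_) hes, trivial⟩) le_rfl fun _ _ => trivial
    · refine .mono (.foldl (A := 1) (B := 3 + M) (C := 1) (E := fun _ => True)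
        (Inv := fun _ => True) ⟨le_refl 1, hR.1, by simp⟩ ⟨?_, trivial⟩
        fun _ _ _ _ => ⟨le_refl 1, trivial⟩) (by omega) fun _ h => h
      have := hτ i₀ i₀
      simp only [Tm.cost, Tm.val]
      omega
    · have h := hF₁ d τ 0 k k (by simp)
      exact ⟨by simpa using h.cost, h.size⟩
    · have h := hF₂ d τ 0 (F₁ k) regs hregs
      exact ⟨by simpa using h.cost, h.size⟩
    · have h := hF₃ d τ 0 k k (by simp)
      refine ⟨by simpa using h.cost, (length_le_size _).trans h.size, fun t ht => ?_⟩
      obtain ⟨h1, h2⟩ := (mem_tuples d (.var (k : ℚ)) rfl t).1 ht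
      refine ⟨h1.le, fun i hi => ?_⟩
      obtain ⟨j, hj, rfl⟩ := h2 i hi
      rw [Nat.floor_natCast]
      exact hj.le
    · exact ⟨le_refl 5, ⟨by simp [Tm.val], by simp [Tm.val]⟩, by simp [Tm.val]⟩
    · exact le_refl 3
    · rfl
    · simpa using (hround vs best hvs hbest).cost
    · exact (length_le_size _).trans (hround vs best hvs hbest).size
    · refine (Runs.map (r := k) (E := fun i : ℚ => ⌊i⌋₊ ≤ k) (E' := fun _ => True) (A := 1)
        (C := 7 + 7 * k) ⟨le_refl 1, ?_⟩ fun i hi => ⟨(cost_nth d τ _ _ _).trans ?_, trivial⟩).cost.trans ?_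
      · exact ht ▸ hbest.1
      · have h : ⌊(i : ℚ)⌋₊ ≤ k := hi
        simp only [Tm.cost, Tm.val]
        omega
      · have : 7 + 7 * k + 3 = 10 + 7 * k := by omega
        rw [this]
    · exact ht ▸ hbest.1.1
    · exact ht ▸ hbest.1.2
    · exact (by omega : 2 ≤ 4)
  have h1 : 100 * (k + 1) ^ 2 * ((List.finRange n).length + 1) * (M + 1) ≤
      4 * (100 * (k + 1) ^ 2) * W := by
    have h : (n + 1) * (M + 1) ≤ 4 * W := by nlinarith
    rw [List.length_finRange]
    calc _ = 100 * (k + 1) ^ 2 * ((n + 1) * (M + 1)) := by ring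
      _ ≤ 100 * (k + 1) ^ 2 * (4 * W) := Nat.mul_le_mul_left _ h
      _ = _ := by ring
  have hk1 := Nat.mul_le_mul_left k hnW
  have hk2 := Nat.mul_le_mul_left k hMW
  have h2 : n * (6 + k * (6 + M)) ≤ (6 + 7 * k) * W := by
    calc _ = 6 * n + 6 * (k * n) + k * (n * M) := by ring
      _ ≤ 6 * W + 6 * (k * W) + k * W := by omega
      _ = _ := by ring
  have h3 : n * (4 + k * 4) ≤ (4 + 4 * k) * W := by
    calc _ = 4 * n + 4 * (k * n) := by ring
      _ ≤ 4 * W + 4 * (k * W) := by omega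
      _ = _ := by ring
  have hnk : n * k + 1 ≤ n * (k + 1) := by rw [Nat.mul_add]; omega
  have hlog : ∀ q, q ≤ Nat.log 2 n + 1 + k → q + 1 ≤ (k + 2) * (ℓ + 1) := by
    intro q hq
    rw [← hℓ] at hq
    nlinarith
  have h4 : 500 * (n * k + 1) * (Nat.clog 2 (n * k) + 1) ≤ 500 * ((k + 1) * (k + 2)) * W := by
    calc _ ≤ 500 * (n * (k + 1)) * ((k + 2) * (ℓ + 1)) :=
          Nat.mul_le_mul (Nat.mul_le_mul_left _ hnk) (hlog _ (clog_mul_le n k))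
      _ = 500 * ((k + 1) * (k + 2)) * (n * (ℓ + 1)) := by ring
      _ ≤ _ := Nat.mul_le_mul_left _ hℓW
  have h5 : M + n * k * 2 ≤ (1 + 2 * k) * W := by
    calc _ ≤ 1 * (n * M) + 2 * (k * n) := by nlinarith
      _ ≤ W + 2 * (k * W) := by omega
      _ = _ := by ring
  have h6 : F₃ k * (1 + (20 + 4 * (n * k) + ((n * k).size + 1) *
        (1 + 2 * (80 + 7 * (n * k) + n * (50 * (k + 1) ^ 2) + F₄ N * (n + 1))))) ≤
      F₃ k * (1 + (20 + 4 * k + (k + 2) *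
        (161 + 14 * k + 2 * (50 * (k + 1) ^ 2) + 4 * F₄ N))) * W := by
    have h : 1 + 2 * (80 + 7 * (n * k) + n * (50 * (k + 1) ^ 2) + F₄ N * (n + 1)) ≤
        (161 + 14 * k + 2 * (50 * (k + 1) ^ 2) + 4 * F₄ N) * n := by
      have h : F₄ N * (n + 1) ≤ F₄ N * (2 * n) := Nat.mul_le_mul_left _ (by omega)
      nlinarith
    have h' := Nat.mul_le_mul (hlog _ (size_mul_le n k)) h
    rw [Nat.mul_assoc (F₃ k)]
    refine Nat.mul_le_mul_left _ ?_
    have h4' := Nat.mul_le_mul_left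
      ((k + 2) * (161 + 14 * k + 2 * (50 * (k + 1) ^ 2) + 4 * F₄ N)) hℓW
    generalize 161 + 14 * k + 2 * (50 * (k + 1) ^ 2) + 4 * F₄ N = c at *
    have h5' : (k + 2) * (ℓ + 1) * (c * n) = (k + 2) * c * (n * (ℓ + 1)) := by ring
    have hkn : n * k = k * n := Nat.mul_comm ..
    simp only [Nat.add_mul 1, Nat.add_mul 20, Nat.add_mul (20 + 4 * k), Nat.mul_assoc 4] at h4' ⊢
    omega
  have h7 : n * (50 * (k + 1) ^ 2) ≤ 50 * (k + 1) ^ 2 * W := by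
    rw [Nat.mul_comm]
    exact Nat.mul_le_mul_left _ hnW
  have h8 : n * (20 + 50 * (F₅ N' + 1)) ≤ (20 + 50 * (F₅ N' + 1)) * W := by
    rw [Nat.mul_comm]
    exact Nat.mul_le_mul_left _ hnW
  have h9 : ∀ c, c ≤ c * W := fun c => Nat.le_mul_of_pos_right _ h1W
  have h10 := h9 (F₁ k)
  have h11 := h9 (F₂ (F₁ k))
  have h12 := h9 (F₃ k)
  have h13 := h9 (F₅ N')
  have h14 := h9 (k * (10 + 7 * k))
  have h15 := hmain.cost
  change 1 + 1 + (1 + 1 + (1 + 1 + (1 + 1 + (1 + 1 + (algorithm (.var (List.finRange n)) (.var i₀)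
    (.var (k : ℚ)) (.var (L : ℚ)) (.var (U : ℚ))).cost d τ)))) ≤ _
  simp only [Nat.add_mul _ _ W] at h1 h2 h3 h4 h5 h6 h7 h8 ⊢
  omega

end Total
end Prog

theorem corollary1 (k : ℕ) (hk : 1 ≤ k) :
    -- the output is a 4-approximation
    (∀ (X : Type*) [MetricSpace X] (n L U : ℕ) (P : Fin n → X) (i₀ : Fin n),
      1 ≤ L → L ≤ ⌊(n : ℚ) / k⌋₊ → ⌈(n : ℚ) / k⌉₊ ≤ U → U ≤ n →
      ∃ (c : Fin k → Fin n) (s : BalancedClustering P k L U),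
        s.center = P ∘ c ∧
        (Prog.run i₀ k L U).val (fun i j => dist (P i) (P j)) =
          (List.ofFn c, List.ofFn fun i => ((s.assign i : ℕ) : ℚ)) ∧
        s.IsApprox 4) ∧
    -- the running time
    (∀ a : ℝ, ∃ C : ℝ, ∀ (X : Type*) [MetricSpace X] (n L U : ℕ) (P : Fin n → X) (i₀ : Fin n)
      (τ : Fin n → Fin n → ℕ) (D : ℝ),
      1 ≤ L → L ≤ ⌊(n : ℚ) / k⌋₊ → ⌈(n : ℚ) / k⌉₊ ≤ U → U ≤ n →
      1 ≤ D → (∀ i j, (τ i j : ℝ) ≤ a * D) →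
      ((Prog.run i₀ k L U).cost (fun i j => dist (P i) (P j)) τ : ℝ)
        ≤ C * (n * (Real.log n + D))) := by
  refine ⟨fun X _ n L U P i₀ h1 h2 h3 _ => Prog.run_isApprox P i₀ hk h1 h2 h3, fun a => ?_⟩
  obtain ⟨B, hB⟩ := Prog.exists_cost_run k hk
  -- The three summands pay for the change of the base of the logarithm, for the extra `1`, which is
  -- at most `D`, and for the distance evaluations of at most `|a| * D` steps.
  refine ⟨B * (1 / Real.log 2 + 1 + |a|), fun X _ n L U P i₀ τ D _ _ _ _ hD hτ => ?_⟩
  have hn : (1 : ℝ) ≤ n := Nat.one_le_cast.2 i₀.pos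
  have hcost := hB (fun i j => dist (P i) (P j)) τ i₀ L U ⌊a * D⌋₊ fun i j => Nat.le_floor (hτ i j)
  generalize (Prog.run i₀ k L U).cost (fun i j => dist (P i) (P j)) τ = c at hcost ⊢
  have hM : (⌊a * D⌋₊ : ℝ) ≤ |a| * D :=
    (Nat.floor_le ((Nat.cast_nonneg _).trans (hτ i₀ i₀))).trans
      (mul_le_mul_of_nonneg_right (le_abs_self a) (by linarith))
  have hlog : (Nat.log 2 n : ℝ) ≤ 1 / Real.log 2 * Real.log n := by
    have := Real.natLog_le_logb n 2
    rw [Real.logb, Nat.cast_ofNat] at this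
    rwa [one_div_mul_eq_div]
  have h2 : 0 < 1 / Real.log 2 := one_div_pos.2 (Real.log_pos one_lt_two)
  have hl : 0 ≤ Real.log n := Real.log_nonneg hn
  have ha := abs_nonneg a
  calc (c : ℝ)
      ≤ B * (n * (Nat.log 2 n + 1 + ⌊a * D⌋₊)) := by exact_mod_cast hcost
    _ ≤ B * (n * ((1 / Real.log 2 + 1 + |a|) * (Real.log n + D))) := by
        gcongr
        nlinarith [mul_nonneg h2.le (by linarith : 0 ≤ D), mul_nonneg ha hl]
    _ = _ := by ring
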